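/- Let $J\subset(0,\infty)$ be an open interval, $\Phi:J\to\mathbb R$ smooth, and consider the $(2+1)$-dimensional spacetime with coordinates $(t,r,\varphi)$, $r\in J$ (the angle $\varphi$ ranging over $\mathbb R$; everything is invariant under translations of $\varphi$), and metric $$g=-e^{2\Phi(r)}\,dt^2+e^{-2\Phi(r)}\,dr^2+r^2\,d\varphi^2 .$$ A vector field $L$ is lightlike if $L\neq0$ and $g(L,L)=0$ everywhere, and geodesic if $\nabla_LL=fL$ for some function $f$. A photon 2-surface is an immersed surface that is nowhere spacelike and such that every geodesic with lightlike initial vector tangent to the surface stays in the surface for some time. For $A,X\in C^1(J)$ let $$L^{\pm}=A(r)\big(\partial_t+X(r)\,\partial_r\big)\pm r^{-1}\partial_\varphi .$$ **(1) The ansatz.** (a) $[L^+,L^-]=\frac{AX}{r}(L^+-L^-)$. (b) At each point, $L^{\pm}$ is lightlike if and only if $A\ne0$ and $X^2=e^{2\Phi}(e^{2\Phi}-A^{-2})$. (c) $L^+$ and $L^-$ are both lightlike and geodesic on $r\in J$ if and only if there is a constant $R\neq0$ such that on $J$ $$A=\frac rR\,e^{-2\Phi},\qquad X^2=e^{2\Phi}\big(e^{2\Phi}-A^{-2}\big).$$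 Replacing $A$ by $-A$ replaces $L^\pm$ by $-L^\mp$, so one may take $R>0$. (d) If $L^{\pm}$ are lightlike and geodesic, every surface tangent to the planes spanned by $L^+,L^-$ is a timelike photon 2-surface. **(2) The region.** Let $R>0$ and $A=\frac rRe^{-2\Phi}$. At a radius $r$ with $r^2e^{-2\Phi(r)}>R^2$ the equation for $X$ has exactly one positive and one negative solution, $\pm\xi(r)$ with $\xi=e^{2\Phi}\sqrt{1-R^2e^{2\Phi}/r^2}$; where equality holds the only solution is $0$; where $r^2e^{-2\Phi}<R^2$ there is none. **(3) The families.** Let $R>0$ and let $I\subset J$ be a non-empty open interval on which $r^2e^{-2\Phi}>R^2$. Then $1/\xi$ has a primitive $T$ on $I$, and for either sign $\sigma=\pm1$ the $\partial_\varphi$-invariant surfaces $\Sigma_{\sigma,c}=\{t=\sigma T(r)+c,\ r\in I\}$, $c\in\mathbb R$, form a foliation of $\{r\in I\}$ into timelike photon 2-surfaces, which are the integral manifolds of $L^{\pm}$ with $X=\sigma\xi$. Every lightlike vector tangent to $\Sigma_{\sigma,c}$ is the initial vector of a geodesic in $\Sigma_{\sigma,c}$ along which $r$ runs bijectively through $I$.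 Let moreover $b\in J\cap\overline I$ with $b^2e^{-2\Phi(b)}=R^2$. Then, as $r\to b$ in $I$, either $T$ has a finite limit or $|T|\to\infty$ (the surfaces approach $r=b$ asymptotically). If $T\to\ell\in\mathbb R$, then for every $c$ the surface $\Sigma_{1,c}\cup\{t=c+\ell,\ r=b\}\cup\Sigma_{-1,c+2\ell}$ is a smooth $\partial_\varphi$-invariant timelike photon 2-surface, tangent to $\{r=b\}$ where $r=b$; each of its lightlike tangent vectors is the initial vector of a geodesic in it along which $r$ runs through $I$ to $b$ and then back through $I$; and each point with $r\in I$ lies on exactly two of these surfaces. **(4) Reissner–Nordström.** Let $M,Q\in\mathbb R$ and let $F(r)=1-\frac{2M}r+\frac{Q^2}{r^2}$ be positive on $J$. Then $\Phi=\frac12\ln F$ is smooth on $J$ and $g=-F\,dt^2+F^{-1}dr^2+r^2d\varphi^2$. Hence all of the above applies: $L^{\pm}$ are lightlike and geodesic iff $A=\frac{r}{RF}$, $X^2=F(F-A^{-2})$ for some constant $R\ne0$, and the inequality in (2) reads $r^2/F(r)>R^2$. **(5) Exterior Schwarzschild.** Let $M>0$, $F(r)=1-\frac{2M}r$, $\Phi=\frac12\ln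 F$, $J=(2M,\infty)$. Again $L^{\pm}$ are lightlike and geodesic iff $A=\frac{r}{RF}$, $X^2=F(F-A^{-2})$ for some $R\neq0$. Let $R>0$. - If $R<\sqrt{27}M$, then $r^2/F(r)>R^2$ for all $r>2M$; each of the two families foliates the whole region $r>2M$, and along the lightlike geodesics generating a member $r$ runs bijectively through $(2M,\infty)$. - If $R=\sqrt{27}M$, the inequality holds for $r\ne3M$, with equality at $r=3M$. With $T_1,T_2$ primitives of $1/\xi$ on $(2M,3M)$ and $(3M,\infty)$, $T_1\to+\infty$ and $T_2\to-\infty$ as $r\to3M$, so all members $t=\pm T_i(r)+c$ approach $r=3M$ asymptotically. For any signs $\sigma_1,\sigma_2$, the surface $\{r=3M\}$ together with the surfaces $t=\sigma_1T_1(r)+c$ and $t=\sigma_2T_2(r)+c$, $c\in\mathbb R$, decomposes $\{r>2M\}$ into pairwise disjoint timelike photon 2-surfaces; if $\sigma_1=-\sigma_2$ this is a foliation into integral manifolds of the smooth fields $L^{\pm}$ with $X=\sigma_1\xi$ for $r<3M$, $X(3M)=0$, $X=\sigma_2\xi$ for $r>3M$. - If $R>\sqrt{27}M$, there are $2M<r_1<3M<r_2$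 such that on $r>2M$ the inequality holds exactly on $(2M,r_1)\cup(r_2,\infty)$, with equality at $r_1$ and $r_2$. On $I=(2M,r_1)$ with $b=r_1$, and on $I=(r_2,\infty)$ with $b=r_2$, $T$ has a finite limit at $b$, and the two families are glued as in (3) into one family of timelike photon 2-surfaces covering $\{r\in I\}$ twice, whose generating lightlike geodesics come from the horizon, reach the maximal radius $r_1$ and return to the horizon, respectively come from infinity, reach the minimal radius $r_2$ and return to infinity. -/

import Mathlib

open Set Filter Topology
open scoped ContDiff

noncomputable section

namespace PhotonSurface

/-! ### Pseudo-Riemannian geometry in a coordinate domain of `ℝⁿ` -/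

/-- A metric in coordinates: `g x i j` is the component `g_{ij}` at the point `x`. -/
abbrev CoordMetric (n : ℕ) := (Fin n → ℝ) → Matrix (Fin n) (Fin n) ℝ

/-- The value `g_x(v, w)`. -/
def pairing {n : ℕ} (g : CoordMetric n) (x v w : Fin n → ℝ) : ℝ :=
  ∑ i, ∑ j, g x i j * v i * w j

/-- The partial derivative `∂_i f` at `x`. -/
def partialDeriv {n : ℕ} (i : Fin n) (f : (Fin n → ℝ) → ℝ) (x : Fin n → ℝ) : ℝ :=
  fderiv ℝ f x (Pi.single i 1)

/-- The Christoffel symbol `Γ^k_{ij}` of the Levi-Civita derivative. -/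
def christoffel {n : ℕ} (g : CoordMetric n) (k i j : Fin n) (x : Fin n → ℝ) : ℝ :=
  (1 / 2) * ∑ l, (g x)⁻¹ k l *
    (partialDeriv i (fun y => g y j l) x + partialDeriv j (fun y => g y i l) x
      - partialDeriv l (fun y => g y i j) x)

/-- The covariant derivative `∇_V W`. -/
def covDeriv {n : ℕ} (g : CoordMetric n) (V W : (Fin n → ℝ) → (Fin n → ℝ)) (x : Fin n → ℝ) :
    Fin n → ℝ :=
  fun k => fderiv ℝ (fun y => W y k) x (V x) + ∑ i, ∑ j, christoffel g k i j x * V x i * W x j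

/-- A lightlike vector at `x`: nonzero, with `g_x(v, v) = 0`. -/
def IsLightlike {n : ℕ} (g : CoordMetric n) (x v : Fin n → ℝ) : Prop :=
  v ≠ 0 ∧ pairing g x v v = 0

/-- A lightlike vector field on `U`. -/
def IsLightlikeField {n : ℕ} (g : CoordMetric n) (U : Set (Fin n → ℝ))
    (L : (Fin n → ℝ) → (Fin n → ℝ)) : Prop :=
  ∀ x ∈ U, IsLightlike g x (L x)

/-- A geodesic vector field on `U`: `∇_L L = f L` with some function `f`. -/
def IsGeodesicField {n : ℕ} (g : CoordMetric n) (U : Set (Fin n → ℝ))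
    (L : (Fin n → ℝ) → (Fin n → ℝ)) : Prop :=
  ∃ f : (Fin n → ℝ) → ℝ, ∀ x ∈ U, covDeriv g L L x = f x • L x

/-- `μ` is an (affinely parametrized) geodesic in `U`, defined on the open set `D` of
parameters. -/
def IsGeodesicOn {n : ℕ} (g : CoordMetric n) (U : Set (Fin n → ℝ)) (D : Set ℝ)
    (μ : ℝ → (Fin n → ℝ)) : Prop :=
  IsOpen D ∧ MapsTo μ D U ∧ ContDiffOn ℝ 2 μ D ∧
    ∀ s ∈ D, ∀ k, deriv (deriv (fun u => μ u k)) s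
      + ∑ i, ∑ j, christoffel g k i j (μ s) * deriv μ s i * deriv μ s j = 0

/-- `F`, restricted to the open set `W` of the plane, is a smooth immersion into `U`. -/
structure IsImmersedSurface {n : ℕ} (U : Set (Fin n → ℝ)) (W : Set (ℝ × ℝ))
    (F : ℝ × ℝ → (Fin n → ℝ)) : Prop where
  isOpen : IsOpen W
  smooth : ContDiffOn ℝ ∞ F W
  mapsTo : MapsTo F W U
  immersive : ∀ p ∈ W, Function.Injective (fderiv ℝ F p)

/-- The immersed surface has a timelike tangent plane at each of its points. -/
def IsTimelikeSurface {n : ℕ} (g : CoordMetric n) (W : Set (ℝ × ℝ))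
    (F : ℝ × ℝ → (Fin n → ℝ)) : Prop :=
  ∀ p ∈ W, ∃ v, pairing g (F p) (fderiv ℝ F p v) (fderiv ℝ F p v) < 0

/-- Photon 2-surface: an immersed surface which is nowhere spacelike and such that, for every
lightlike vector `w` tangent to it, the geodesic with initial vector `w` stays in the surface for
some time. (As the surface is only immersed, "stays in the surface" means that the geodesic lifts
to a continuous curve `c` in the parameter domain.) -/
structure IsPhotonSurface {n : ℕ} (g : CoordMetric n) (U : Set (Fin n → ℝ)) (W : Set (ℝ × ℝ))
    (F : ℝ × ℝ → (Fin n → ℝ)) : Prop where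
  immersed : IsImmersedSurface U W F
  nowhere_spacelike : ∀ p ∈ W, ∃ v, v ≠ 0 ∧
    pairing g (F p) (fderiv ℝ F p v) (fderiv ℝ F p v) ≤ 0
  contains_geodesics : ∀ p ∈ W, ∀ v, IsLightlike g (F p) (fderiv ℝ F p v) →
    ∃ ε > 0, ∃ c : ℝ → ℝ × ℝ, ContinuousOn c (Ioo (-ε) ε) ∧ MapsTo c (Ioo (-ε) ε) W ∧ c 0 = p ∧
      IsGeodesicOn g U (Ioo (-ε) ε) (F ∘ c) ∧ deriv (F ∘ c) 0 = fderiv ℝ F p v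

/-- The immersed surface is an integral manifold of the planes spanned by `Lp` and `Lm`. -/
def IsIntegralSurface {n : ℕ} (Lp Lm : (Fin n → ℝ) → (Fin n → ℝ)) (W : Set (ℝ × ℝ))
    (F : ℝ × ℝ → (Fin n → ℝ)) : Prop :=
  ∀ p ∈ W, LinearMap.range (fderiv ℝ F p : ℝ × ℝ →ₗ[ℝ] (Fin n → ℝ))
    = Submodule.span ℝ {Lp (F p), Lm (F p)}

/-- `S` is the image of a connected, injectively immersed, timelike photon 2-surface in `U`
whose parametrization has the additional property `Q`. -/
def IsTimelikePhotonSet {n : ℕ} (g : CoordMetric n) (U S : Set (Fin n → ℝ))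
    (Q : Set (ℝ × ℝ) → (ℝ × ℝ → (Fin n → ℝ)) → Prop) : Prop :=
  ∃ (W : Set (ℝ × ℝ)) (F : ℝ × ℝ → (Fin n → ℝ)), IsConnected W ∧ InjOn F W ∧ F '' W = S ∧
    IsPhotonSurface g U W F ∧ IsTimelikeSurface g W F ∧ Q W F

/-- `U` is the disjoint union of the timelike photon 2-surfaces in `𝓕`. -/
structure IsPhotonDecomposition {n : ℕ} (g : CoordMetric n) (U : Set (Fin n → ℝ))
    (𝓕 : Set (Set (Fin n → ℝ))) : Prop where
  cover : ⋃₀ 𝓕 = U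
  disjoint : 𝓕.PairwiseDisjoint id
  leaf : ∀ S ∈ 𝓕, IsTimelikePhotonSet g U S (fun _ _ => True)

/-- `U` is foliated into the timelike photon 2-surfaces in `𝓕`, which are the integral manifolds
of the smooth involutive plane field spanned by `Lp` and `Lm`. -/
structure IsPhotonFoliation {n : ℕ} (g : CoordMetric n) (U : Set (Fin n → ℝ))
    (Lp Lm : (Fin n → ℝ) → (Fin n → ℝ)) (𝓕 : Set (Set (Fin n → ℝ))) : Prop where
  smooth_p : ContDiffOn ℝ ∞ Lp U
  smooth_m : ContDiffOn ℝ ∞ Lm U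
  independent : ∀ x ∈ U, LinearIndependent ℝ ![Lp x, Lm x]
  involutive : ∀ x ∈ U, VectorField.lieBracket ℝ Lp Lm x ∈ Submodule.span ℝ {Lp x, Lm x}
  cover : ⋃₀ 𝓕 = U
  disjoint : 𝓕.PairwiseDisjoint id
  leaf : ∀ S ∈ 𝓕, IsTimelikePhotonSet g U S (IsIntegralSurface Lp Lm)

/-- Every lightlike vector `w` tangent to the surface is the initial vector of a geodesic `μ`
that lies in the surface, is defined on an open interval `D` containing `0`, and has the
property `Q`. -/
def LightlikeGeneratorsSatisfy {n : ℕ} (g : CoordMetric n) (U : Set (Fin n → ℝ))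
    (W : Set (ℝ × ℝ)) (F : ℝ × ℝ → (Fin n → ℝ))
    (Q : Set ℝ → (ℝ → (Fin n → ℝ)) → Prop) : Prop :=
  ∀ p ∈ W, ∀ v, IsLightlike g (F p) (fderiv ℝ F p v) →
    ∃ (D : Set ℝ) (μ : ℝ → (Fin n → ℝ)), D.OrdConnected ∧ 0 ∈ D ∧ IsGeodesicOn g U D μ ∧
      MapsTo μ D (F '' W) ∧ μ 0 = F p ∧ deriv μ 0 = fderiv ℝ F p v ∧ Q D μ

/-! ### The spacetimes `g = -e^{2Φ} dt² + e^{-2Φ} dr² + r² dφ²`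

Coordinates: `x 0 = t`, `x 1 = r`, `x 2 = φ`. -/

/-- The metric `-e^{2Φ(r)} dt² + e^{-2Φ(r)} dr² + r² dφ²`. -/
def sphericalMetric (Φ : ℝ → ℝ) : CoordMetric 3 :=
  fun x => Matrix.diagonal ![-Real.exp (2 * Φ (x 1)), Real.exp (-(2 * Φ (x 1))), (x 1) ^ 2]

/-- The part of the spacetime where the radius coordinate lies in `J`. -/
def region (J : Set ℝ) : Set (Fin 3 → ℝ) := {x | x 1 ∈ J}

/-- The (constant) coordinate vector fields `∂_t`, `∂_r`, `∂_φ`, for `i = 0, 1, 2`. -/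
def coordVec (i : Fin 3) : Fin 3 → ℝ := Pi.single i 1

/-- The vector field `A(r) (∂_t + X(r) ∂_r) + ε r⁻¹ ∂_φ`; `L^±` is the case `ε = ±1`. -/
def ansatz (A X : ℝ → ℝ) (ε : ℝ) : (Fin 3 → ℝ) → (Fin 3 → ℝ) :=
  fun x => A (x 1) • (coordVec 0 + X (x 1) • coordVec 1) + (ε * (x 1)⁻¹) • coordVec 2

/-- Both `L^+` and `L^-` are lightlike and geodesic on `r ∈ J`. -/
def AnsatzLightlikeGeodesic (Φ A X : ℝ → ℝ) (J : Set ℝ) : Prop :=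
  ∀ ε : ℝ, ε = 1 ∨ ε = -1 →
    IsLightlikeField (sphericalMetric Φ) (region J) (ansatz A X ε) ∧
    IsGeodesicField (sphericalMetric Φ) (region J) (ansatz A X ε)

/-- `A(r) = (r / R) e^{-2Φ(r)}`. -/
def coeffA (Φ : ℝ → ℝ) (R r : ℝ) : ℝ := r / R * Real.exp (-(2 * Φ r))

/-- The nonnegative solution `X` of `X² = e^{2Φ} (e^{2Φ} - A⁻²)` with `A = (r / R) e^{-2Φ}`. -/
def speed (Φ : ℝ → ℝ) (R r : ℝ) : ℝ :=
  Real.exp (2 * Φ r) * Real.sqrt (1 - R ^ 2 * Real.exp (2 * Φ r) / r ^ 2)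

/-- The inequality `r² e^{-2Φ(r)} > R²`. -/
def Allowed (Φ : ℝ → ℝ) (R r : ℝ) : Prop := R ^ 2 < r ^ 2 * Real.exp (-(2 * Φ r))

/-- `T` is a primitive of `1 / speed` on `I`: the curves `t = σ T(r) + c` are the solutions of
`dr/dt = σ speed(r)`, `σ = ±1`. -/
def IsTimeFunction (Φ : ℝ → ℝ) (R : ℝ) (I : Set ℝ) (T : ℝ → ℝ) : Prop :=
  ∀ r ∈ I, HasDerivAt T (1 / speed Φ R r) r

/-- Parametrization, by `(r, φ)`, of the rotation-invariant surface `t = σ T(r) + c`. -/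
def memberMap (T : ℝ → ℝ) (σ c : ℝ) : ℝ × ℝ → (Fin 3 → ℝ) :=
  fun p => ![σ * T p.1 + c, p.1, p.2]

/-- The surface `t = σ T(r) + c`, `r ∈ I`. -/
def member (I : Set ℝ) (T : ℝ → ℝ) (σ c : ℝ) : Set (Fin 3 → ℝ) :=
  memberMap T σ c '' (I ×ˢ univ)

/-- The member `t = T(r) + c` of the first family and the member `t = -T(r) + c + 2ℓ` of the
second family, joined along the circle `r = b`, `t = c + ℓ`. -/
def gluedMember (I : Set ℝ) (T : ℝ → ℝ) (b ℓ c : ℝ) : Set (Fin 3 → ℝ) :=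
  member I T 1 c ∪ {x | x 0 = c + ℓ ∧ x 1 = b} ∪ member I T (-1) (c + 2 * ℓ)

/-- Invariance under the flow of `∂_φ`. -/
def RotationInvariant (S : Set (Fin 3 → ℝ)) : Prop :=
  ∀ x ∈ S, ∀ a : ℝ, x + a • coordVec 2 ∈ S

/-- `e^{2Φ} = 1 - 2M/r + Q²/r²`. -/
def reissnerF (M Q r : ℝ) : ℝ := 1 - 2 * M / r + Q ^ 2 / r ^ 2

/-- The potential `Φ` of the Reissner–Nordström metric. -/
def reissnerPhi (M Q r : ℝ) : ℝ := (1 / 2) * Real.log (reissnerF M Q r)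

/-- `e^{2Φ} = 1 - 2M/r`. -/
def schwarzschildF (M r : ℝ) : ℝ := 1 - 2 * M / r

/-- The potential `Φ` of the Schwarzschild metric. -/
def schwarzschildPhi (M r : ℝ) : ℝ := (1 / 2) * Real.log (schwarzschildF M r)

end PhotonSurface

end

namespace PhotonSurface

/-! The metric depends on `r` alone, so everything reduces to ordinary differential equations in
`r`. For `L^±`, being lightlike is an algebraic condition that determines `X²` from `A`. In the
geodesic equation the `φ`-component forces `f = A X / r`; the `r`-component, compared with the
derivative of the lightlike condition, then says that `A e^{2Φ} / r` has derivative zero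
(`deriv_eq_of_geodesic`, `ansatzLightlikeGeodesic_iff`). The constant is `1 / R`, where `R` is the
impact parameter, the quotient of angular momentum and energy. In the plane spanned by `L^±` the
metric is `-4ab` on `a L⁺ + b L⁻`. Hence the plane is timelike, its lightlike vectors are multiples
of `L^±`, and geodesics starting in an integral surface are integral curves of a rescaled tangent
field, which lift to the surface (`exists_lifted_integralCurve`, `integralSurface_isPhotonSurface`).

With the time `t` as parameter the generators satisfy `(dr/dt)² = radialPotential`, and the
second-order equation `d²r/dt² = radialForce`, half the derivative of the potential. The first
equation involves a square root that degenerates at turning points, whereas the second one is smooth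
there. A surface of revolution over a curve `r = ρ(t)` solving both equations (`IsProfile`) is
therefore smooth, timelike and ruled by complete runs of lightlike geodesics, whether or not `dr/dt`
vanishes somewhere (`IsProfile.contDiffOn`, `IsProfile.exists_generator`). A member is such a
surface with `ρ` the inverse of `σ T + c`. If `T` has a limit at a zero `b` of the potential,
extending the inverse by reflection in time gives a profile that turns at `b`
(`IsTimeFunction.exists_glued_profile`); the two derivatives cross the turning time because they
have limits there.

For Schwarzschild the allowed radii are those where the cubic `r³ - R² (r - 2M)` is positive. At `R
= √27 M` it has a double zero at `3M`, so `T` diverges at least logarithmically, while the signed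
square root of the potential is smooth across `3M`. For larger `R` the zeros `r₁`, `r₂` are simple,
`1 / speed` has an integrable inverse square root singularity, and the gluing applies. -/

/-! ### Levi-Civita connection of the metric, and the ansatz fields -/

theorem pairing_sphericalMetric (Φ : ℝ → ℝ) (x v w : Fin 3 → ℝ) :
    pairing (sphericalMetric Φ) x v w = -Real.exp (2 * Φ (x 1)) * v 0 * w 0
      + (Real.exp (2 * Φ (x 1)))⁻¹ * v 1 * w 1 + x 1 ^ 2 * v 2 * w 2 := by
  simp [pairing, sphericalMetric, Fin.sum_univ_three, Matrix.diagonal, Real.exp_neg]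

theorem hasFDerivAt_comp_radius {f : ℝ → ℝ} {f' : ℝ} {x : Fin 3 → ℝ}
    (hf : HasDerivAt f f' (x 1)) :
    HasFDerivAt (fun y : Fin 3 → ℝ => f (y 1))
      (f' • ContinuousLinearMap.proj (R := ℝ) (φ := fun _ : Fin 3 => ℝ) 1) x :=
  hf.comp_hasFDerivAt x
    (ContinuousLinearMap.proj (R := ℝ) (φ := fun _ : Fin 3 => ℝ) 1).hasFDerivAt

theorem partialDeriv_comp_radius {f : ℝ → ℝ} {f' : ℝ} {x : Fin 3 → ℝ}
    (hf : HasDerivAt f f' (x 1)) (i : Fin 3) :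
    partialDeriv i (fun y => f (y 1)) x = if i = 1 then f' else 0 := by
  have h3 : partialDeriv i (fun y => f (y 1)) x
      = (f' • ContinuousLinearMap.proj (R := ℝ) (φ := fun _ : Fin 3 => ℝ) 1) (Pi.single i 1) := by
    unfold partialDeriv
    exact congrArg (fun l => l (Pi.single i 1)) (hasFDerivAt_comp_radius hf).fderiv
  rw [h3]
  by_cases hi : i = 1
  · subst hi; simp
  · simp [hi, eq_comm]

theorem partialDeriv_zero_fun (i : Fin 3) (x : Fin 3 → ℝ) :
    partialDeriv i (fun _ => (0 : ℝ)) x = 0 := by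
  simp [partialDeriv]

theorem hasDerivAt_exp_two_mul {Φ : ℝ → ℝ} {d r : ℝ} (h : HasDerivAt Φ d r) :
    HasDerivAt (fun r => Real.exp (2 * Φ r)) (2 * d * Real.exp (2 * Φ r)) r := by
  convert (h.const_mul 2).exp using 1; ring

theorem hasDerivAt_exp_neg_two_mul {Φ : ℝ → ℝ} {d r : ℝ} (h : HasDerivAt Φ d r) :
    HasDerivAt (fun r => Real.exp (-(2 * Φ r))) (-(2 * d * Real.exp (-(2 * Φ r)))) r := by
  refine (h.const_mul 2).neg.exp.congr_deriv ?_
  simp only [Pi.neg_apply]; ring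

/-- The vector with components `Γ^k_{ij} v^i w^j`, see `sum_christoffel`. -/
noncomputable def connectionForm (Φ : ℝ → ℝ) (x v w : Fin 3 → ℝ) : Fin 3 → ℝ :=
  ![deriv Φ (x 1) * (v 0 * w 1 + v 1 * w 0),
    Real.exp (2 * Φ (x 1)) ^ 2 * deriv Φ (x 1) * v 0 * w 0 - deriv Φ (x 1) * v 1 * w 1
      - Real.exp (2 * Φ (x 1)) * x 1 * v 2 * w 2,
    (v 1 * w 2 + v 2 * w 1) / x 1]

theorem sphericalMetric_inv {Φ : ℝ → ℝ} {x : Fin 3 → ℝ} (hx : x 1 ≠ 0) :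
    (sphericalMetric Φ x)⁻¹ = Matrix.diagonal
      ![-Real.exp (-(2 * Φ (x 1))), Real.exp (2 * Φ (x 1)), (x 1 ^ 2)⁻¹] := by
  apply Matrix.inv_eq_left_inv
  rw [sphericalMetric, Matrix.diagonal_mul_diagonal, ← Matrix.diagonal_one]
  congr 1
  funext i
  fin_cases i
  · simp [← Real.exp_add]
  · simp [← Real.exp_add]
  · simp [hx]

/-- Contracting with arbitrary vectors packs all Christoffel symbols into one vector, so that no
individual symbol has to appear in later arguments. -/
theorem sum_christoffel {Φ : ℝ → ℝ} {x : Fin 3 → ℝ} (hx : x 1 ≠ 0)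
    (hΦ : DifferentiableAt ℝ Φ (x 1)) (v w : Fin 3 → ℝ) (k : Fin 3) :
    ∑ i, ∑ j, christoffel (sphericalMetric Φ) k i j x * v i * w j
      = connectionForm Φ x v w k := by
  have h0 := partialDeriv_comp_radius (hasDerivAt_exp_two_mul hΦ.hasDerivAt).neg
  have h1 := partialDeriv_comp_radius (hasDerivAt_exp_neg_two_mul hΦ.hasDerivAt)
  have h2 := partialDeriv_comp_radius (f := fun r => r ^ 2) (hasDerivAt_pow 2 (x 1))
  have hz := fun i => partialDeriv_zero_fun i x
  simp only [Pi.neg_apply] at h0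
  simp only [christoffel, sphericalMetric_inv hx]
  simp only [sphericalMetric, Fin.sum_univ_three, Matrix.diagonal_apply]
  have he : Real.exp (-(2 * Φ (x 1))) = (Real.exp (2 * Φ (x 1)))⁻¹ := Real.exp_neg _
  have hne : Real.exp (2 * Φ (x 1)) ≠ 0 := (Real.exp_pos _).ne'
  fin_cases k <;>
  · simp [h0, h1, h2, hz, connectionForm, he]
    field_simp
    try ring

theorem ansatz_zero (A X : ℝ → ℝ) (ε : ℝ) (x : Fin 3 → ℝ) : ansatz A X ε x 0 = A (x 1) := by
  simp [ansatz, coordVec]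

theorem ansatz_one (A X : ℝ → ℝ) (ε : ℝ) (x : Fin 3 → ℝ) :
    ansatz A X ε x 1 = A (x 1) * X (x 1) := by
  simp [ansatz, coordVec]

theorem ansatz_two (A X : ℝ → ℝ) (ε : ℝ) (x : Fin 3 → ℝ) : ansatz A X ε x 2 = ε * (x 1)⁻¹ := by
  simp [ansatz, coordVec]

theorem ansatz_neg (A X : ℝ → ℝ) (ε : ℝ) (x : Fin 3 → ℝ) :
    ansatz (-A) X ε x = -ansatz A X (-ε) x := by
  funext i
  fin_cases i <;> simp [ansatz, coordVec]

theorem hasFDerivAt_ansatz {A X : ℝ → ℝ} {A' X' : ℝ} {x : Fin 3 → ℝ} (hx : x 1 ≠ 0)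
    (hA : HasDerivAt A A' (x 1)) (hX : HasDerivAt X X' (x 1)) (ε : ℝ) :
    HasFDerivAt (ansatz A X ε)
      ((ContinuousLinearMap.proj (R := ℝ) (φ := fun _ : Fin 3 => ℝ) 1).smulRight
        ![A', A' * X (x 1) + A (x 1) * X', ε * (-(x 1 ^ 2)⁻¹)]) x := by
  rw [hasFDerivAt_pi']
  intro i
  fin_cases i
  · simp only [Fin.zero_eta, ansatz_zero]
    refine (hasFDerivAt_comp_radius hA).congr_fderiv ?_
    ext v; simp [mul_comm]
  · simp only [Fin.mk_one, ansatz_one]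
    refine (hasFDerivAt_comp_radius (hA.mul hX)).congr_fderiv ?_
    ext v; simp [mul_comm]
  · simp only [Fin.reduceFinMk, ansatz_two]
    refine (hasFDerivAt_comp_radius ((hasDerivAt_inv hx).const_mul ε)).congr_fderiv ?_
    ext v; simp [mul_comm]

theorem lieBracket_ansatz {A X : ℝ → ℝ} {x : Fin 3 → ℝ} (hx : x 1 ≠ 0)
    (hA : DifferentiableAt ℝ A (x 1)) (hX : DifferentiableAt ℝ X (x 1)) :
    VectorField.lieBracket ℝ (ansatz A X 1) (ansatz A X (-1)) x
      = (A (x 1) * X (x 1) / x 1) • (ansatz A X 1 x - ansatz A X (-1) x) := by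
  rw [VectorField.lieBracket,
    (hasFDerivAt_ansatz hx hA.hasDerivAt hX.hasDerivAt _).fderiv,
    (hasFDerivAt_ansatz hx hA.hasDerivAt hX.hasDerivAt _).fderiv]
  funext i
  fin_cases i
  · simp [ansatz_zero, ansatz_one]
  · simp [ansatz_one]
  · simp [ansatz_one, ansatz_two]; field_simp

theorem isLightlike_ansatz_iff {Φ A X : ℝ → ℝ} {x : Fin 3 → ℝ} (hx : x 1 ≠ 0) {ε : ℝ}
    (hε : ε = 1 ∨ ε = -1) :
    IsLightlike (sphericalMetric Φ) x (ansatz A X ε x) ↔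
      A (x 1) ≠ 0 ∧ X (x 1) ^ 2
        = Real.exp (2 * Φ (x 1)) * (Real.exp (2 * Φ (x 1)) - (A (x 1) ^ 2)⁻¹) := by
  have hN : Real.exp (2 * Φ (x 1)) ≠ 0 := (Real.exp_pos _).ne'
  have hε2 : ε ^ 2 = 1 := by rcases hε with h | h <;> simp [h]
  have h0 : ansatz A X ε x ≠ 0 := by
    intro h
    have := congrFun h 2
    rw [ansatz_two] at this
    rcases hε with h | h <;> simp [h, hx] at this
  rw [IsLightlike, pairing_sphericalMetric, ansatz_zero, ansatz_one, ansatz_two]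
  generalize Real.exp (2 * Φ (x 1)) = N at *
  have e : -N * A (x 1) * A (x 1) + N⁻¹ * (A (x 1) * X (x 1)) * (A (x 1) * X (x 1))
      + x 1 ^ 2 * (ε * (x 1)⁻¹) * (ε * (x 1)⁻¹)
      = -N * A (x 1) ^ 2 + A (x 1) ^ 2 * X (x 1) ^ 2 / N + 1 := by
    rw [← hε2]; field_simp
  rw [e]
  constructor
  · rintro ⟨-, h⟩
    have hA : A (x 1) ≠ 0 := by
      intro hA; simp [hA] at h
    refine ⟨hA, ?_⟩
    field_simp at h ⊢
    linear_combination h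
  · rintro ⟨hA, h⟩
    refine ⟨h0, ?_⟩
    rw [h]
    field_simp
    ring

theorem covDeriv_ansatz {Φ A X : ℝ → ℝ} {x : Fin 3 → ℝ} (hx : x 1 ≠ 0)
    (hΦ : DifferentiableAt ℝ Φ (x 1))
    (hA : DifferentiableAt ℝ A (x 1)) (hX : DifferentiableAt ℝ X (x 1)) (ε : ℝ) :
    covDeriv (sphericalMetric Φ) (ansatz A X ε) (ansatz A X ε) x =
      ![A (x 1) * X (x 1) * (deriv A (x 1) + 2 * deriv Φ (x 1) * A (x 1)),
        A (x 1) * X (x 1) * (deriv A (x 1) * X (x 1) + A (x 1) * deriv X (x 1))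
          + Real.exp (2 * Φ (x 1)) ^ 2 * deriv Φ (x 1) * A (x 1) ^ 2
          - deriv Φ (x 1) * (A (x 1) * X (x 1)) ^ 2
          - ε ^ 2 * Real.exp (2 * Φ (x 1)) / x 1,
        ε * (A (x 1) * X (x 1)) / x 1 ^ 2] := by
  have hL := hasFDerivAt_pi'.1 (hasFDerivAt_ansatz hx hA.hasDerivAt hX.hasDerivAt ε)
  funext k
  rw [covDeriv, sum_christoffel hx hΦ, (hL k).fderiv]
  fin_cases k
  · simp [connectionForm, ansatz_zero, ansatz_one]; ring
  · simp [connectionForm, ansatz_zero, ansatz_one, ansatz_two]; field_simp; ring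
  · simp [connectionForm, ansatz_one, ansatz_two]; field_simp; ring

/-- The geodesic equation for a lightlike field `L^ε` of the ansatz amounts to one differential
equation for `A`. -/
theorem deriv_eq_of_geodesic {Φ A X : ℝ → ℝ} {J : Set ℝ} (hJ : IsOpen J) (hJ0 : J ⊆ Ioi 0)
    (hΦ : DifferentiableOn ℝ Φ J) (hA : DifferentiableOn ℝ A J) (hX : DifferentiableOn ℝ X J)
    (hl : ∀ r ∈ J, A r ≠ 0 ∧
      X r ^ 2 = Real.exp (2 * Φ r) * (Real.exp (2 * Φ r) - (A r ^ 2)⁻¹))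
    (hg : IsGeodesicField (sphericalMetric Φ) (region J) (ansatz A X 1)) {r : ℝ} (hr : r ∈ J) :
    deriv A r * r + 2 * deriv Φ r * A r * r = A r := by
  have dΦ := (hΦ.differentiableAt (hJ.mem_nhds hr)).hasDerivAt
  have dA := (hA.differentiableAt (hJ.mem_nhds hr)).hasDerivAt
  have dX := (hX.differentiableAt (hJ.mem_nhds hr)).hasDerivAt
  have r0 : r ≠ 0 := (hJ0 hr).ne'
  have hA0 := (hl r hr).1
  have dN := hasDerivAt_exp_two_mul dΦ
  have hN : Real.exp (2 * Φ r) ≠ 0 := (Real.exp_pos _).ne'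
  -- The lightlike condition without denominators. It holds near `r`, so it can also be
  -- differentiated.
  have key : (fun s => (A s * X s) ^ 2 - (Real.exp (2 * Φ s) * A s) ^ 2 + Real.exp (2 * Φ s))
      =ᶠ[𝓝 r] fun _ => 0 := by
    filter_upwards [hJ.mem_nhds hr] with s hs
    obtain ⟨h0, h1⟩ := hl s hs
    rw [mul_pow, h1]
    field_simp
    ring
  have d1 := (((dA.mul dX).pow 2).sub ((dN.mul dA).pow 2)).add dN
  have e1 := d1.unique ((hasDerivAt_const r (0 : ℝ)).congr_of_eventuallyEq key)
  obtain ⟨f, hf⟩ := hg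
  have hx : ![0, r, 0] ∈ region J := by simpa [region] using hr
  have hc := hf _ hx
  rw [covDeriv_ansatz (by simpa using r0) (by simpa using dΦ.differentiableAt)
    (by simpa using dA.differentiableAt) (by simpa using dX.differentiableAt)] at hc
  have c1 := congrFun hc 1
  have c2 := congrFun hc 2
  simp only [Pi.smul_apply, ansatz_one, ansatz_two, smul_eq_mul] at c1 c2
  simp at c1 c2 e1
  have c0 := key.self_of_nhds
  simp only at c0
  generalize Real.exp (2 * Φ r) = N at *
  generalize f ![0, r, 0] = g at *
  -- The `φ`-component of `L` never vanishes and so determines the factor. The `t`-component carries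
  -- the factor `A X` and says nothing where `X = 0`; the `r`-component is used instead.
  have hgv : g = A r * X r / r := by
    field_simp at c2 ⊢
    linear_combination -c2
  subst hgv
  field_simp at c1
  have hN2 : N ^ 2 * A r ≠ 0 := mul_ne_zero (pow_ne_zero 2 hN) hA0
  apply mul_left_cancel₀ hN2
  linear_combination c1 - r / 2 * e1 + (1 + deriv Φ r * r) * c0

/-- The differential equation for `A` means that `A e^{2Φ} / r` is constant on the interval; the
constant is nonzero because `A` is, and `R` is its inverse. Conversely `f = A X / r` serves for both
signs: the `t`-component is the equation for `A`, the `φ`-component is an identity, and the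
`r`-component follows from the differentiated lightlike condition. -/
theorem ansatzLightlikeGeodesic_iff {Φ A X : ℝ → ℝ} {J : Set ℝ} (hJ : IsOpen J)
    (hJc : J.OrdConnected) (hJ0 : J ⊆ Ioi 0)
    (hΦ : DifferentiableOn ℝ Φ J) (hA : DifferentiableOn ℝ A J) (hX : DifferentiableOn ℝ X J) :
    AnsatzLightlikeGeodesic Φ A X J ↔
      ∃ R : ℝ, R ≠ 0 ∧ ∀ r ∈ J, A r = r / R * Real.exp (-(2 * Φ r)) ∧
        X r ^ 2 = Real.exp (2 * Φ r) * (Real.exp (2 * Φ r) - (A r ^ 2)⁻¹) := by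
  constructor
  · intro h
    have hl : ∀ r ∈ J, A r ≠ 0 ∧
        X r ^ 2 = Real.exp (2 * Φ r) * (Real.exp (2 * Φ r) - (A r ^ 2)⁻¹) := by
      intro r hr
      have hx : ![0, r, 0] ∈ region J := by simpa [region] using hr
      simpa using (isLightlike_ansatz_iff (by simpa using (hJ0 hr).ne') (Or.inl rfl)).1
        ((h 1 (Or.inl rfl)).1 _ hx)
    -- On an empty interval there is no radius at which to read off the constant, and any nonzero
    -- `R` will do.
    rcases J.eq_empty_or_nonempty with rfl | ⟨r₀, hr₀⟩
    · exact ⟨1, one_ne_zero, by simp⟩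
    have hd : ∀ r ∈ J, HasDerivAt (fun s => A s * Real.exp (2 * Φ s) / s) 0 r := by
      intro r hr
      have r0 : r ≠ 0 := (hJ0 hr).ne'
      have e := deriv_eq_of_geodesic hJ hJ0 hΦ hA hX hl (h 1 (Or.inl rfl)).2 hr
      have dΦ := (hΦ.differentiableAt (hJ.mem_nhds hr)).hasDerivAt
      have dA := (hA.differentiableAt (hJ.mem_nhds hr)).hasDerivAt
      refine ((dA.mul (hasDerivAt_exp_two_mul dΦ)).div (hasDerivAt_id r) r0).congr_deriv ?_
      simp only [id, Pi.mul_apply]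
      rw [div_eq_zero_iff]
      left
      linear_combination Real.exp (2 * Φ r) * e
    have hconst : ∀ r ∈ J, A r * Real.exp (2 * Φ r) / r = A r₀ * Real.exp (2 * Φ r₀) / r₀ := by
      intro r hr
      exact hJ.is_const_of_deriv_eq_zero hJc.isPreconnected
        (fun s hs => (hd s hs).differentiableAt.differentiableWithinAt)
        (fun s hs => (hd s hs).deriv) hr hr₀
    have hC : A r₀ * Real.exp (2 * Φ r₀) / r₀ ≠ 0 :=
      div_ne_zero (mul_ne_zero (hl r₀ hr₀).1 (Real.exp_pos _).ne') (hJ0 hr₀).ne'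
    refine ⟨(A r₀ * Real.exp (2 * Φ r₀) / r₀)⁻¹, inv_ne_zero hC, fun r hr => ⟨?_, (hl r hr).2⟩⟩
    rw [← hconst r hr, Real.exp_neg]
    have r0 : r ≠ 0 := (hJ0 hr).ne'
    have := (Real.exp_pos (2 * Φ r)).ne'
    field_simp
  · rintro ⟨R, hR, h⟩ ε hε
    have hA0 : ∀ r ∈ J, A r ≠ 0 := fun r hr => by
      rw [(h r hr).1]
      exact mul_ne_zero (div_ne_zero (hJ0 hr).ne' hR) (Real.exp_pos _).ne'
    refine ⟨fun x hx => (isLightlike_ansatz_iff (hJ0 hx).ne' hε).2 ⟨hA0 _ hx, (h _ hx).2⟩,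
      fun x => A (x 1) * X (x 1) / x 1, fun x hx => ?_⟩
    have hr : x 1 ∈ J := hx
    have r0 : x 1 ≠ 0 := (hJ0 hr).ne'
    have dΦ := hΦ.differentiableAt (hJ.mem_nhds hr)
    have dA := hA.differentiableAt (hJ.mem_nhds hr)
    have dX := hX.differentiableAt (hJ.mem_nhds hr)
    have hN : Real.exp (2 * Φ (x 1)) ≠ 0 := (Real.exp_pos _).ne'
    have keyA : A =ᶠ[𝓝 (x 1)] fun s => s / R * Real.exp (-(2 * Φ s)) := by
      filter_upwards [hJ.mem_nhds hr] with s hs using (h s hs).1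
    have eA : deriv A (x 1) * x 1 + 2 * deriv Φ (x 1) * A (x 1) * x 1 = A (x 1) := by
      have d := ((hasDerivAt_id (x 1)).div_const R).mul (hasDerivAt_exp_neg_two_mul dΦ.hasDerivAt)
      rw [(d.congr_of_eventuallyEq keyA).deriv, (h _ hr).1]
      simp only [id]
      field_simp
      ring
    have key : (fun s => (A s * X s) ^ 2 - (Real.exp (2 * Φ s) * A s) ^ 2 + Real.exp (2 * Φ s))
        =ᶠ[𝓝 (x 1)] fun _ => 0 := by
      filter_upwards [hJ.mem_nhds hr] with s hs
      have h0 := hA0 s hs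
      rw [mul_pow, (h s hs).2]
      field_simp
      ring
    have dN := hasDerivAt_exp_two_mul dΦ.hasDerivAt
    have d1 := (((dA.hasDerivAt.mul dX.hasDerivAt).pow 2).sub
      ((dN.mul dA.hasDerivAt).pow 2)).add dN
    have e1 := d1.unique ((hasDerivAt_const _ (0 : ℝ)).congr_of_eventuallyEq key)
    have c0 := key.self_of_nhds
    have hε2 : ε ^ 2 = 1 := by rcases hε with h | h <;> simp [h]
    rw [covDeriv_ansatz r0 dΦ dA dX]
    simp at e1 c0
    generalize Real.exp (2 * Φ (x 1)) = N at *
    funext k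
    fin_cases k
    · simp [ansatz_zero]
      field_simp
      linear_combination (A (x 1) * X (x 1)) * eA
    · simp [ansatz_one, hε2]
      field_simp
      linear_combination x 1 / 2 * e1 + N ^ 2 * A (x 1) * eA - (1 + deriv Φ (x 1) * x 1) * c0
    · simp [ansatz_two]
      field_simp

/-! ### The radial equation and affinely parametrized geodesics -/

/-- The square of `speed` (where this is positive): `(dr/dt)²` along the generators. -/
noncomputable def radialPotential (Φ : ℝ → ℝ) (R r : ℝ) : ℝ :=
  Real.exp (2 * Φ r) ^ 2 * (1 - R ^ 2 * Real.exp (2 * Φ r) / r ^ 2)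

/-- Half the derivative of `radialPotential`. -/
noncomputable def radialForce (Φ : ℝ → ℝ) (R r : ℝ) : ℝ :=
  2 * deriv Φ r * Real.exp (2 * Φ r) ^ 2
    - 3 * deriv Φ r * R ^ 2 * Real.exp (2 * Φ r) ^ 3 / r ^ 2
    + R ^ 2 * Real.exp (2 * Φ r) ^ 3 / r ^ 3

theorem hasDerivAt_radialPotential {Φ : ℝ → ℝ} {r : ℝ} (hr : r ≠ 0)
    (hΦ : DifferentiableAt ℝ Φ r) (R : ℝ) :
    HasDerivAt (radialPotential Φ R) (2 * radialForce Φ R r) r := by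
  have dN := hasDerivAt_exp_two_mul hΦ.hasDerivAt
  refine ((dN.pow 2).mul (((dN.const_mul (R ^ 2)).div (hasDerivAt_pow 2 r)
    (pow_ne_zero 2 hr)).const_sub 1)).congr_deriv ?_
  simp [radialForce]
  field_simp
  ring

theorem continuousOn_deriv_of_smooth {Φ : ℝ → ℝ} {J : Set ℝ} (hJ : IsOpen J)
    (hΦ : ContDiffOn ℝ ∞ Φ J) : ContinuousOn (deriv Φ) J :=
  hΦ.continuousOn_deriv_of_isOpen hJ (by simp)

theorem differentiableAt_of_smooth {Φ : ℝ → ℝ} {J : Set ℝ} (hJ : IsOpen J)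
    (hΦ : ContDiffOn ℝ ∞ Φ J) {r : ℝ} (hr : r ∈ J) : DifferentiableAt ℝ Φ r :=
  (hΦ.differentiableOn (by simp)).differentiableAt (hJ.mem_nhds hr)

/-- The geodesic equation as a first-order system for position and velocity. Pointwise derivatives
suffice: the derivative of `v` is a continuous expression in `μ` and `v`, so `v` is `C¹` and `μ` is
`C²`. -/
theorem isGeodesicOn_of_hasDerivAt {Φ : ℝ → ℝ} {J D : Set ℝ} (hJ : IsOpen J) (hJ0 : J ⊆ Ioi 0)
    (hΦ : ContDiffOn ℝ ∞ Φ J) (hD : IsOpen D) {μ v : ℝ → Fin 3 → ℝ}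
    (hμJ : ∀ s ∈ D, μ s 1 ∈ J) (hμ : ∀ s ∈ D, HasDerivAt μ (v s) s)
    (hv : ∀ s ∈ D, HasDerivAt v (-connectionForm Φ (μ s) (v s) (v s)) s) :
    IsGeodesicOn (sphericalMetric Φ) (region J) D μ := by
  have hμc : ∀ k, ContinuousOn (fun s => μ s k) D := fun k =>
    continuousOn_pi.1 (fun s hs => (hμ s hs).continuousAt.continuousWithinAt) k
  have hvc : ∀ k, ContinuousOn (fun s => v s k) D := fun k =>
    continuousOn_pi.1 (fun s hs => (hv s hs).continuousAt.continuousWithinAt) k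
  have hΦc : ContinuousOn (fun s => Φ (μ s 1)) D := hΦ.continuousOn.comp (hμc 1) hμJ
  have hΦd : ContinuousOn (fun s => deriv Φ (μ s 1)) D :=
    (continuousOn_deriv_of_smooth hJ hΦ).comp (hμc 1) hμJ
  have hr0 : ∀ s ∈ D, μ s 1 ≠ 0 := fun s hs => (hJ0 (hμJ s hs)).ne'
  have hcf : ContinuousOn (fun s => -connectionForm Φ (μ s) (v s) (v s)) D := by
    apply ContinuousOn.neg
    rw [continuousOn_pi]
    have h0 := hvc 0
    have h1 := hvc 1
    have h2 := hvc 2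
    have m1 := hμc 1
    intro k
    fin_cases k
    · simp only [connectionForm]
      exact hΦd.mul ((h0.mul h1).add (h1.mul h0))
    · simp only [connectionForm]
      have hN : ContinuousOn (fun s => Real.exp (2 * Φ (μ s 1))) D :=
        (hΦc.const_mul 2).rexp
      exact (((((hN.pow 2).mul hΦd).mul h0).mul h0).sub ((hΦd.mul h1).mul h1)).sub
        (((hN.mul m1).mul h2).mul h2)
    · simp only [connectionForm]
      exact ((h1.mul h2).add (h2.mul h1)).div m1 hr0
  refine ⟨hD, hμJ, ?_, ?_⟩
  · have e2 : (2 : WithTop ℕ∞) = 1 + 1 := by norm_num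
    have hv1 : ContDiffOn ℝ 1 v D := by
      rw [← zero_add (1 : WithTop ℕ∞), contDiffOn_succ_iff_deriv_of_isOpen hD]
      refine ⟨fun s hs => (hv s hs).differentiableAt.differentiableWithinAt, by simp, ?_⟩
      rw [contDiffOn_zero]
      exact hcf.congr fun s hs => (hv s hs).deriv
    rw [e2, contDiffOn_succ_iff_deriv_of_isOpen hD]
    refine ⟨fun s hs => (hμ s hs).differentiableAt.differentiableWithinAt, by simp, ?_⟩
    exact hv1.congr fun s hs => (hμ s hs).deriv
  · intro s hs k
    rw [sum_christoffel (hr0 s hs) (differentiableAt_of_smooth hJ hΦ (hμJ s hs)), (hμ s hs).deriv]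
    have : deriv (fun u => μ u k) =ᶠ[𝓝 s] fun u => v u k := by
      filter_upwards [hD.mem_nhds hs] with u hu using ((hasDerivAt_pi.1 (hμ u hu)) k).deriv
    rw [this.deriv_eq, ((hasDerivAt_pi.1 (hv s hs)) k).deriv]
    simp

/-- A curve with conserved energy and angular momentum which solves the radial equation (of second
order) is an affinely parametrized geodesic. -/
theorem isGeodesicOn_of_conserved {Φ : ℝ → ℝ} {J D : Set ℝ} (hJ : IsOpen J) (hJ0 : J ⊆ Ioi 0)
    (hΦ : ContDiffOn ℝ ∞ Φ J) (hD : IsOpen D) {μ : ℝ → Fin 3 → ℝ} {y : ℝ → ℝ} {R κ ε : ℝ}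
    (hε : ε = 1 ∨ ε = -1)
    (hμJ : ∀ s ∈ D, μ s 1 ∈ J)
    (hμ : ∀ s ∈ D, HasDerivAt μ ![κ / Real.exp (2 * Φ (μ s 1)),
      κ * y s / Real.exp (2 * Φ (μ s 1)), κ * (ε * R) / μ s 1 ^ 2] s)
    (hy : ∀ s ∈ D, y s ^ 2 = radialPotential Φ R (μ s 1))
    (hy' : ∀ s ∈ D,
      HasDerivAt y (radialForce Φ R (μ s 1) * (κ / Real.exp (2 * Φ (μ s 1)))) s) :
    IsGeodesicOn (sphericalMetric Φ) (region J) D μ := by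
  refine isGeodesicOn_of_hasDerivAt hJ hJ0 hΦ hD hμJ hμ fun s hs => ?_
  have hr : HasDerivAt (fun u => μ u 1) (κ * y s / Real.exp (2 * Φ (μ s 1))) s := by
    simpa using hasDerivAt_pi.1 (hμ s hs) 1
  have r0 : μ s 1 ≠ 0 := (hJ0 (hμJ s hs)).ne'
  have dΦ := (differentiableAt_of_smooth hJ hΦ (hμJ s hs)).hasDerivAt
  have dN : HasDerivAt (fun u => Real.exp (2 * Φ (μ u 1)))
      (2 * deriv Φ (μ s 1) * Real.exp (2 * Φ (μ s 1))
        * (κ * y s / Real.exp (2 * Φ (μ s 1)))) s :=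
    HasDerivAt.comp s (hasDerivAt_exp_two_mul dΦ) hr
  have hN : Real.exp (2 * Φ (μ s 1)) ≠ 0 := (Real.exp_pos _).ne'
  have e2 := hy s hs
  have hε2 : ε ^ 2 = 1 := by rcases hε with h | h <;> simp [h]
  rw [radialPotential] at e2
  rw [hasDerivAt_pi]
  intro k
  -- The `t`- and `φ`-components express conservation of the energy `κ` and the angular momentum `κ
  -- ε R`. Only the `r`-component needs the equations for `y`.
  fin_cases k
  · simp only [Fin.zero_eta, Matrix.cons_val_zero, connectionForm, Pi.neg_apply]
    refine ((hasDerivAt_const s κ).div dN hN).congr_deriv ?_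
    simp
    field_simp
    ring
  · simp only [Fin.mk_one, Matrix.cons_val_one, connectionForm, Pi.neg_apply]
    refine (((hy' s hs).const_mul κ).div dN hN).congr_deriv ?_
    simp [radialForce]
    field_simp
    field_simp at e2
    rw [hε2]
    linear_combination (-3 * κ ^ 2 * deriv Φ (μ s 1) * μ s 1) * e2
  · simp only [Fin.reduceFinMk, connectionForm, Pi.neg_apply]
    refine ((hasDerivAt_const s (κ * (ε * R))).div (hr.pow 2) (pow_ne_zero 2 r0)).congr_deriv ?_
    simp
    field_simp
    ring

/-! ### Integral surfaces of the ansatz are photon surfaces -/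

/-- A `C¹` vector field which is tangent to an immersion has local integral curves that lift to
the parameter domain. -/
theorem exists_lifted_integralCurve {n : ℕ} {U : Set (Fin n → ℝ)} {W : Set (ℝ × ℝ)}
    {F : ℝ × ℝ → Fin n → ℝ} (hF : IsImmersedSurface U W F) {p : ℝ × ℝ} (hp : p ∈ W)
    {G : (Fin n → ℝ) → Fin n → ℝ} (hG : ContDiffAt ℝ 1 G (F p))
    (hGt : ∀ q ∈ W, ∃ u, fderiv ℝ F q u = G (F q)) :
    ∃ ε > 0, ∃ c : ℝ → ℝ × ℝ, ContinuousOn c (Ioo (-ε) ε) ∧ MapsTo c (Ioo (-ε) ε) W ∧ c 0 = p ∧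
      ∀ s ∈ Ioo (-ε) ε, HasDerivAt (F ∘ c) (G (F (c s))) s := by
  have hWp : W ∈ 𝓝 p := hF.isOpen.mem_nhds hp
  have hFp : ContDiffAt ℝ ∞ F p := hF.smooth.contDiffAt hWp
  -- Pointwise preimages of `G` under `DF` need a formula that is visibly `C¹`. With a left inverse
  -- `Λ` of `DF(p)`, the endomorphism `Λ ∘ DF` is the identity at `p`, hence invertible nearby, and
  -- `V = (Λ ∘ DF)⁻¹ Λ G` is such a formula.
  obtain ⟨Λ₀, hΛ₀⟩ := LinearMap.exists_leftInverse_of_injective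
    (fderiv ℝ F p : ℝ × ℝ →ₗ[ℝ] Fin n → ℝ) (LinearMap.ker_eq_bot.2 (hF.immersive p hp))
  set Λ : (Fin n → ℝ) →L[ℝ] ℝ × ℝ := LinearMap.toContinuousLinearMap Λ₀ with hΛ
  let B : ℝ × ℝ → (ℝ × ℝ →L[ℝ] ℝ × ℝ) := fun q => Λ ∘L fderiv ℝ F q
  have hBp : B p = (ContinuousLinearEquiv.refl ℝ (ℝ × ℝ) : ℝ × ℝ →L[ℝ] ℝ × ℝ) := by
    apply ContinuousLinearMap.coe_injective
    exact hΛ₀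
  have hB : ContDiffAt ℝ 1 B p :=
    (contDiffAt_const (c := Λ)).clm_comp (hFp.fderiv_right (m := 1) (by norm_cast))
  let V : ℝ × ℝ → ℝ × ℝ := fun q => (B q).inverse (Λ (G (F q)))
  have hV : ContDiffAt ℝ 1 V p := by
    have h1 : ContDiffAt ℝ 1 (fun q => (B q).inverse) p := by
      refine ContDiffAt.comp (g := ContinuousLinearMap.inverse) p ?_ hB
      rw [hBp]
      exact contDiffAt_map_inverse (ContinuousLinearEquiv.refl ℝ (ℝ × ℝ))
    have h2 : ContDiffAt ℝ 1 (fun q => Λ (G (F q))) p :=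
      Λ.contDiff.contDiffAt.comp p (hG.comp p (hFp.of_le (by norm_cast)))
    exact h1.clm_apply h2
  have hinv : ∀ᶠ q in 𝓝 p, (B q).IsInvertible := by
    apply hB.continuousAt.eventually
    rw [hBp]
    exact ContinuousLinearEquiv.nhds _
  obtain ⟨c, hc0, ε, hε, hc⟩ :=
    hV.exists_forall_mem_closedBall_exists_eq_forall_mem_Ioo_hasDerivAt₀ 0
  have hcc : ContinuousAt c 0 := (hc 0 (by simp [hε])).continuousAt
  have hgood : ∀ᶠ s in 𝓝 (0 : ℝ), c s ∈ W ∧ (B (c s)).IsInvertible := by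
    have := hcc.tendsto
    rw [hc0] at this
    exact this.eventually ((eventually_mem_set.2 hWp).and hinv)
  obtain ⟨δ, hδ, hδ'⟩ := Metric.eventually_nhds_iff.1 hgood
  refine ⟨min ε δ, lt_min hε hδ, c, ?_, ?_, hc0, ?_⟩
  · intro s hs
    refine (hc s ⟨?_, ?_⟩).continuousAt.continuousWithinAt
    · have := hs.1; have := min_le_left ε δ; linarith
    · have := hs.2; have := min_le_left ε δ; linarith
  · intro s hs
    refine (hδ' ?_).1
    rw [Real.dist_eq, sub_zero, abs_lt]
    have := min_le_right ε δ
    exact ⟨by linarith [hs.1], by linarith [hs.2]⟩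
  · intro s hs
    have h1 : dist s 0 < δ := by
      rw [Real.dist_eq, sub_zero, abs_lt]
      have := min_le_right ε δ
      exact ⟨by linarith [hs.1], by linarith [hs.2]⟩
    have h2 : s ∈ Ioo (0 - ε) (0 + ε) := by
      have := min_le_left ε δ
      exact ⟨by linarith [hs.1], by linarith [hs.2]⟩
    obtain ⟨hW, e, he⟩ := hδ' h1
    obtain ⟨u, hu⟩ := hGt _ hW
    have hFd : HasFDerivAt F (fderiv ℝ F (c s)) (c s) :=
      ((hF.smooth.differentiableOn (by simp)).differentiableAt (hF.isOpen.mem_nhds hW)).hasFDerivAt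
    have h3 := hFd.comp_hasDerivAt s (hc s h2)
    -- Tangency enters here: `G = DF u` gives `Λ G = (Λ ∘ DF) u`, so `V` is the true preimage, not
    -- only a preimage modulo the kernel of `Λ`.
    have hVu : V (c s) = u := by
      change (B (c s)).inverse (Λ (G (F (c s)))) = u
      rw [← hu]
      change (B (c s)).inverse (B (c s) u) = u
      rw [← he, ContinuousLinearMap.inverse_equiv]
      simp
    rwa [hVu, hu] at h3

theorem IsPhotonSurface.of_timelike {n : ℕ} {g : CoordMetric n} {U : Set (Fin n → ℝ)}
    {W : Set (ℝ × ℝ)} {F : ℝ × ℝ → Fin n → ℝ} (hF : IsImmersedSurface U W F)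
    (ht : IsTimelikeSurface g W F)
    (hg : ∀ p ∈ W, ∀ v, IsLightlike g (F p) (fderiv ℝ F p v) →
      ∃ ε > 0, ∃ c : ℝ → ℝ × ℝ, ContinuousOn c (Ioo (-ε) ε) ∧ MapsTo c (Ioo (-ε) ε) W ∧ c 0 = p ∧
        IsGeodesicOn g U (Ioo (-ε) ε) (F ∘ c) ∧ deriv (F ∘ c) 0 = fderiv ℝ F p v) :
    IsPhotonSurface g U W F where
  immersed := hF
  nowhere_spacelike p hp := by
    obtain ⟨v, hv⟩ := ht p hp
    refine ⟨v, ?_, hv.le⟩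
    rintro rfl
    simp [pairing] at hv
  contains_geodesics := hg

/-- The square of the radial component, in terms of `radialPotential`. -/
theorem sq_eq_radialPotential {Φ A X : ℝ → ℝ} {R r : ℝ} (hr : r ≠ 0)
    (hA : A r = r / R * Real.exp (-(2 * Φ r)))
    (hX : X r ^ 2 = Real.exp (2 * Φ r) * (Real.exp (2 * Φ r) - (A r ^ 2)⁻¹)) :
    X r ^ 2 = radialPotential Φ R r := by
  rw [hX, hA, radialPotential, Real.exp_neg]
  have := (Real.exp_pos (2 * Φ r)).ne'
  field_simp

/-- In the basis `L⁺`, `L⁻` the induced metric is `-4ab`. So `L⁺ + L⁻` is timelike and a lightlike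
tangent vector is a multiple of one `L^ε`. Multiplying `L^ε` by `κ R / r` makes it affinely
geodesic; this field is still tangent, so its integral curves lift to the parameter domain. -/
theorem integralSurface_isPhotonSurface {Φ A X : ℝ → ℝ} {J : Set ℝ} {R : ℝ} (hJ : IsOpen J)
    (hJ0 : J ⊆ Ioi 0) (hΦ : ContDiffOn ℝ ∞ Φ J) (hX : ContDiffOn ℝ 1 X J) (hR : R ≠ 0)
    (h : ∀ r ∈ J, A r = r / R * Real.exp (-(2 * Φ r)) ∧
      X r ^ 2 = Real.exp (2 * Φ r) * (Real.exp (2 * Φ r) - (A r ^ 2)⁻¹))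
    {W : Set (ℝ × ℝ)} {F : ℝ × ℝ → Fin 3 → ℝ} (hF : IsImmersedSurface (region J) W F)
    (hi : IsIntegralSurface (ansatz A X 1) (ansatz A X (-1)) W F) :
    IsTimelikeSurface (sphericalMetric Φ) W F ∧
      IsPhotonSurface (sphericalMetric Φ) (region J) W F := by
  have hXW : ∀ r ∈ J, X r ^ 2 = radialPotential Φ R r := fun r hr =>
    sq_eq_radialPotential (hJ0 hr).ne' (h r hr).1 (h r hr).2
  have hA : ∀ r ∈ J, A r = r / (R * Real.exp (2 * Φ r)) := fun r hr => by
    rw [(h r hr).1, Real.exp_neg]; field_simp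
  have htan : ∀ p ∈ W, ∀ a b : ℝ, ∃ u, fderiv ℝ F p u
      = a • ansatz A X 1 (F p) + b • ansatz A X (-1) (F p) := by
    intro p hp a b
    have : a • ansatz A X 1 (F p) + b • ansatz A X (-1) (F p) ∈
        LinearMap.range (fderiv ℝ F p : ℝ × ℝ →ₗ[ℝ] (Fin 3 → ℝ)) := by
      rw [hi p hp]
      exact Submodule.mem_span_pair.2 ⟨a, b, rfl⟩
    exact this
  have hpair : ∀ p ∈ W, ∀ a b : ℝ, pairing (sphericalMetric Φ) (F p)
      (a • ansatz A X 1 (F p) + b • ansatz A X (-1) (F p))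
      (a • ansatz A X 1 (F p) + b • ansatz A X (-1) (F p)) = -(4 * a * b) := by
    intro p hp a b
    have hr : F p 1 ∈ J := hF.mapsTo hp
    have r0 : F p 1 ≠ 0 := (hJ0 hr).ne'
    have hN := (Real.exp_pos (2 * Φ (F p 1))).ne'
    have e := hXW _ hr
    rw [radialPotential] at e
    rw [pairing_sphericalMetric]
    simp only [Pi.add_apply, Pi.smul_apply, smul_eq_mul, ansatz_zero, ansatz_one, ansatz_two,
      hA _ hr]
    field_simp
    field_simp at e
    linear_combination (a + b) ^ 2 * e
  have ht : IsTimelikeSurface (sphericalMetric Φ) W F := by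
    intro p hp
    obtain ⟨u, hu⟩ := htan p hp 1 1
    refine ⟨u, ?_⟩
    rw [hu, hpair p hp]
    norm_num
  refine ⟨ht, .of_timelike hF ht fun p hp v hv => ?_⟩
  have hr : F p 1 ∈ J := hF.mapsTo hp
  have hN := (Real.exp_pos (2 * Φ (F p 1))).ne'
  have r0 : F p 1 ≠ 0 := (hJ0 hr).ne'
  obtain ⟨a, ε, hε, hw⟩ : ∃ a ε : ℝ, (ε = 1 ∨ ε = -1) ∧
      fderiv ℝ F p v = a • ansatz A X ε (F p) := by
    have hmem : fderiv ℝ F p v ∈ LinearMap.range (fderiv ℝ F p : ℝ × ℝ →ₗ[ℝ] (Fin 3 → ℝ)) :=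
      ⟨v, rfl⟩
    rw [hi p hp] at hmem
    obtain ⟨a, b, hab⟩ := Submodule.mem_span_pair.1 hmem
    have hz := hv.2
    rw [← hab, hpair p hp] at hz
    have : a = 0 ∨ b = 0 := by simpa using hz
    rcases this with rfl | rfl
    · exact ⟨b, -1, Or.inr rfl, by rw [← hab]; simp⟩
    · exact ⟨a, 1, Or.inl rfl, by rw [← hab]; simp⟩
  -- the affinely parametrized lightlike field with the given initial vector
  let κ : ℝ := a * F p 1 / R
  let G : (Fin 3 → ℝ) → Fin 3 → ℝ := fun x => ![κ / Real.exp (2 * Φ (x 1)),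
    κ * X (x 1) / Real.exp (2 * Φ (x 1)), κ * (ε * R) / x 1 ^ 2]
  have hGL : ∀ x ∈ region J, G x = (κ * R / x 1) • ansatz A X ε x := by
    intro x hx
    have hx' : x 1 ∈ J := hx
    have x0 : x 1 ≠ 0 := (hJ0 hx').ne'
    have hNx := (Real.exp_pos (2 * Φ (x 1))).ne'
    funext k
    fin_cases k
    · simp [G, ansatz_zero, hA _ hx']; field_simp
    · simp [G, ansatz_one, hA _ hx']; field_simp
    · simp [G, ansatz_two]; field_simp
  have hGd : ContDiffAt ℝ 1 G (F p) := by
    have c1 : ContDiffAt ℝ 1 (fun x : Fin 3 → ℝ => x 1) (F p) := (contDiff_apply ℝ ℝ 1).contDiffAt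
    have cX : ContDiffAt ℝ 1 (fun x : Fin 3 → ℝ => X (x 1)) (F p) :=
      ContDiffAt.comp (F p) (hX.contDiffAt (hJ.mem_nhds hr)) c1
    have cN : ContDiffAt ℝ 1 (fun x : Fin 3 → ℝ => Real.exp (2 * Φ (x 1))) (F p) :=
      (contDiffAt_const.mul (ContDiffAt.comp (F p)
        ((hΦ.contDiffAt (hJ.mem_nhds hr)).of_le (by norm_cast)) c1)).exp
    rw [contDiffAt_pi]
    intro k
    fin_cases k
    · exact (contDiffAt_const (c := κ)).div cN hN
    · exact ((contDiffAt_const (c := κ)).mul cX).div cN hN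
    · exact (contDiffAt_const (c := κ * (ε * R))).div (c1.pow 2) (pow_ne_zero 2 r0)
  have hGt : ∀ q ∈ W, ∃ u, fderiv ℝ F q u = G (F q) := by
    intro q hq
    rw [hGL _ (hF.mapsTo hq)]
    rcases hε with rfl | rfl
    · obtain ⟨u, hu⟩ := htan q hq (κ * R / F q 1) 0
      exact ⟨u, by simpa using hu⟩
    · obtain ⟨u, hu⟩ := htan q hq 0 (κ * R / F q 1)
      exact ⟨u, by simpa using hu⟩
  obtain ⟨δ, hδ, c, hcc, hcW, hc0, hcd⟩ := exists_lifted_integralCurve hF hp hGd hGt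
  refine ⟨δ, hδ, c, hcc, hcW, hc0, ?_, ?_⟩
  · refine isGeodesicOn_of_conserved (y := fun s => X (F (c s) 1)) (R := R) (κ := κ) hJ hJ0 hΦ
      isOpen_Ioo hε (fun s hs => hF.mapsTo (hcW hs)) hcd
      (fun s hs => hXW _ (hF.mapsTo (hcW hs))) fun s hs => ?_
    have hs1 : F (c s) 1 ∈ J := hF.mapsTo (hcW hs)
    have s0 : F (c s) 1 ≠ 0 := (hJ0 hs1).ne'
    have hNs := (Real.exp_pos (2 * Φ (F (c s) 1))).ne'
    have dX := ((hX.differentiableOn (by simp)).differentiableAt (hJ.mem_nhds hs1)).hasDerivAt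
    have dr : HasDerivAt (fun u => F (c u) 1)
        (κ * X (F (c s) 1) / Real.exp (2 * Φ (F (c s) 1))) s := by
      simpa [G] using hasDerivAt_pi.1 (hcd s hs) 1
    have dW := hasDerivAt_radialPotential s0 (differentiableAt_of_smooth hJ hΦ hs1) R
    have key : (fun r => X r ^ 2) =ᶠ[𝓝 (F (c s) 1)] radialPotential Φ R := by
      filter_upwards [hJ.mem_nhds hs1] with r hr using hXW r hr
    -- Differentiating `X² = radialPotential` gives `X X' = radialForce`. As `dr/ds` contains the
    -- factor `X`, this yields the derivative of `X` along the curve without dividing by `X`, which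
    -- may vanish.
    have e := (dX.pow 2).unique (dW.congr_of_eventuallyEq key)
    refine (HasDerivAt.comp s dX dr).congr_deriv ?_
    simp only [Function.comp_apply]
    simp at e
    field_simp
    linear_combination (κ / 2) * e
  · rw [(hcd 0 (by simp [hδ])).deriv, hc0, hGL _ hr, hw]
    congr 1
    simp only [κ]
    field_simp

/-! ### Functions on intervals -/

theorem exists_primitive {I : Set ℝ} (hI : IsOpen I) (hIc : I.OrdConnected) {f : ℝ → ℝ}
    (hf : ContinuousOn f I) {x₀ : ℝ} (hx₀ : x₀ ∈ I) (y₀ : ℝ) :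
    ∃ F : ℝ → ℝ, F x₀ = y₀ ∧ ∀ x ∈ I, HasDerivAt F (f x) x := by
  refine ⟨fun x => y₀ + ∫ s in x₀..x, f s, by simp, fun x hx => ?_⟩
  refine HasDerivAt.const_add y₀ (intervalIntegral.integral_hasDerivAt_right ?_ ?_ ?_)
  · exact (hf.mono (hIc.uIcc_subset hx₀ hx)).intervalIntegrable
  · exact hf.stronglyMeasurableAtFilter hI x hx
  · exact hf.continuousAt (hI.mem_nhds hx)

theorem strictMonoOn_of_hasDerivAt_pos {I : Set ℝ} (hI : IsOpen I) (hIc : I.OrdConnected)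
    {f f' : ℝ → ℝ} (hf : ∀ x ∈ I, HasDerivAt f (f' x) x) (hpos : ∀ x ∈ I, 0 < f' x) :
    StrictMonoOn f I := by
  refine strictMonoOn_of_deriv_pos hIc.convex
    (fun x hx => (hf x hx).continuousAt.continuousWithinAt) fun x hx => ?_
  rw [hI.interior_eq] at hx
  rw [(hf x hx).deriv]
  exact hpos x hx

/-- An order isomorphism between intervals is a homeomorphism. The interval need not be open: it is
also applied to an interval together with its turning radius. -/
theorem exists_continuous_inverse {K : Set ℝ} (hK : K.OrdConnected) {f : ℝ → ℝ}
    (hf : ContinuousOn f K) (hm : StrictMonoOn f K) :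
    (f '' K).OrdConnected ∧ ∃ g : ℝ → ℝ, (∀ x ∈ K, g (f x) = x) ∧ ContinuousOn g (f '' K) := by
  have hfK : (f '' K).OrdConnected := (hK.isPreconnected.image f hf).ordConnected
  refine ⟨hfK, Function.invFunOn f K, fun x hx => hm.injOn.leftInvOn_invFunOn hx, ?_⟩
  have hc := (hm.orderIso f K).symm.continuous
  rw [continuousOn_iff_continuous_domRestrict]
  convert continuous_subtype_val.comp hc using 1
  funext y
  obtain ⟨x, hx⟩ := (hm.orderIso f K).surjective y
  rw [← hx]
  simp only [Function.comp_apply, OrderIso.symm_apply_apply, domRestrict_apply]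
  exact hm.injOn.leftInvOn_invFunOn x.2

theorem isOpen_image_of_strictMonoOn {I : Set ℝ} (hI : IsOpen I) {f : ℝ → ℝ}
    (hf : ContinuousOn f I) (hm : StrictMonoOn f I) : IsOpen (f '' I) := by
  rw [isOpen_iff_mem_nhds]
  rintro _ ⟨x, hx, rfl⟩
  obtain ⟨ε, hε, hball⟩ := Metric.isOpen_iff.1 hI x hx
  rw [Real.ball_eq_Ioo] at hball
  have hsub : Icc (x - ε / 2) (x + ε / 2) ⊆ I := fun y hy =>
    hball ⟨by linarith [hy.1], by linarith [hy.2]⟩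
  have h1 : f (x - ε / 2) < f x := hm (hsub ⟨by linarith, by linarith⟩) hx (by linarith)
  have h2 : f x < f (x + ε / 2) := hm hx (hsub ⟨by linarith, by linarith⟩) (by linarith)
  refine mem_of_superset (Icc_mem_nhds h1 h2) ?_
  exact (intermediate_value_Icc (by linarith) (hf.mono hsub)).trans (image_mono hsub)

theorem hasDerivAt_inverse {I : Set ℝ} {f g : ℝ → ℝ} (hfI : IsOpen (f '' I))
    (hgf : ∀ x ∈ I, g (f x) = x) (hg : ContinuousOn g (f '' I)) {x d : ℝ} (hx : x ∈ I)
    (hd : d ≠ 0) (hf : HasDerivAt f d x) : HasDerivAt g d⁻¹ (f x) := by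
  have hnh : f '' I ∈ 𝓝 (f x) := hfI.mem_nhds ⟨x, hx, rfl⟩
  refine HasDerivAt.of_local_left_inverse (f := f) (hg.continuousAt hnh) ?_ hd ?_
  · rwa [hgf x hx]
  · filter_upwards [hnh]
    rintro _ ⟨y, hy, rfl⟩
    rw [hgf y hy]

/-- By the mean value theorem on either side, a derivative with a limit at `x` is attained at `x`.
This carries the first and second derivative of a glued profile across its turning time. -/
theorem hasDerivAt_of_eventually_ne {f g : ℝ → ℝ} {x : ℝ}
    (h : ∀ᶠ y in 𝓝[≠] x, HasDerivAt f (g y) y) (hf : ContinuousAt f x)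
    (hg : ContinuousAt g x) : HasDerivAt f (g x) x := by
  have hR : HasDerivWithinAt f (g x) (Ici x) x := by
    have hs : {y | HasDerivAt f (g y) y} ∈ 𝓝[>] x :=
      nhdsWithin_mono x (fun y (hy : x < y) => hy.ne') h
    refine hasDerivWithinAt_Ici_of_tendsto_deriv
      (fun y hy => (HasDerivAt.differentiableAt hy).differentiableWithinAt)
      hf.continuousWithinAt hs ?_
    refine Tendsto.congr' ?_ (hg.tendsto.mono_left nhdsWithin_le_nhds)
    filter_upwards [hs] with y hy using (HasDerivAt.deriv hy).symm
  have hL : HasDerivWithinAt f (g x) (Iic x) x := by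
    have hs : {y | HasDerivAt f (g y) y} ∈ 𝓝[<] x :=
      nhdsWithin_mono x (fun y (hy : y < x) => hy.ne) h
    refine hasDerivWithinAt_Iic_of_tendsto_deriv
      (fun y hy => (HasDerivAt.differentiableAt hy).differentiableWithinAt)
      hf.continuousWithinAt hs ?_
    refine Tendsto.congr' ?_ (hg.tendsto.mono_left nhdsWithin_le_nhds)
    filter_upwards [hs] with y hy using (HasDerivAt.deriv hy).symm
  simpa using hR.union hL

theorem OrdConnected.preimage_mul_sub {E : Set ℝ} (hE : E.OrdConnected) (k c : ℝ) :
    {s | k * (s - c) ∈ E}.OrdConnected := by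
  rcases le_total 0 k with hk | hk
  · exact hE.preimage_mono (f := fun s => k * (s - c)) fun a b hab =>
      mul_le_mul_of_nonneg_left (by linarith) hk
  · exact hE.preimage_anti (f := fun s => k * (s - c)) fun a b hab =>
      mul_le_mul_of_nonpos_left (by linarith) hk

/-! ### Smoothness of the coefficients -/

theorem contDiffOn_exp_two_mul {Φ : ℝ → ℝ} {J : Set ℝ} {n : WithTop ℕ∞}
    (hΦ : ContDiffOn ℝ n Φ J) : ContDiffOn ℝ n (fun r => Real.exp (2 * Φ r)) J :=
  (contDiffOn_const.mul hΦ).exp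

theorem contDiffOn_radialForce {Φ : ℝ → ℝ} {J : Set ℝ} (hJ : IsOpen J) (hJ0 : J ⊆ Ioi 0)
    (hΦ : ContDiffOn ℝ ∞ Φ J) (R : ℝ) : ContDiffOn ℝ ∞ (radialForce Φ R) J := by
  have hN := contDiffOn_exp_two_mul hΦ
  have hd : ContDiffOn ℝ ∞ (deriv Φ) J := hΦ.deriv_of_isOpen hJ (by simp)
  have hr : ∀ n : ℕ, ∀ r ∈ J, r ^ n ≠ 0 := fun n r hr => pow_ne_zero n (hJ0 hr).ne'
  have h2 : ContDiffOn ℝ ∞ (fun r : ℝ => r ^ 2) J := contDiffOn_id.pow 2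
  have h3 : ContDiffOn ℝ ∞ (fun r : ℝ => r ^ 3) J := contDiffOn_id.pow 3
  exact (((contDiffOn_const.mul hd).mul (hN.pow 2)).sub
    ((((contDiffOn_const.mul hd).mul contDiffOn_const).mul (hN.pow 3)).div h2 (hr 2))).add
    ((contDiffOn_const.mul (hN.pow 3)).div h3 (hr 3))

theorem contDiffOn_coeffA {Φ : ℝ → ℝ} {J : Set ℝ} (hΦ : ContDiffOn ℝ ∞ Φ J) (R : ℝ) :
    ContDiffOn ℝ ∞ (coeffA Φ R) J :=
  (contDiffOn_id.div_const R).mul (contDiffOn_const.mul hΦ).neg.exp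

theorem Allowed.one_sub_pos {Φ : ℝ → ℝ} {R r : ℝ} (h : Allowed Φ R r) :
    0 < 1 - R ^ 2 * Real.exp (2 * Φ r) / r ^ 2 := by
  rw [Allowed, Real.exp_neg] at h
  have hN := Real.exp_pos (2 * Φ r)
  -- The inequality itself excludes `r = 0`, since `R² ≥ 0`.
  have hr : 0 < r ^ 2 := by
    have h0 := (sq_nonneg R).trans_lt h
    exact pos_of_mul_pos_left h0 (inv_pos.2 hN).le
  rw [sub_pos, div_lt_one hr]
  rwa [← div_eq_mul_inv, lt_div_iff₀ hN] at h

theorem Allowed.speed_pos {Φ : ℝ → ℝ} {R r : ℝ} (h : Allowed Φ R r) : 0 < speed Φ R r :=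
  mul_pos (Real.exp_pos _) (Real.sqrt_pos.2 h.one_sub_pos)

theorem Allowed.speed_sq {Φ : ℝ → ℝ} {R r : ℝ} (h : Allowed Φ R r) :
    speed Φ R r ^ 2 = radialPotential Φ R r := by
  rw [speed, mul_pow, Real.sq_sqrt h.one_sub_pos.le, radialPotential]

theorem contDiffOn_speed {Φ : ℝ → ℝ} {I : Set ℝ} (hI0 : I ⊆ Ioi 0) {R : ℝ}
    (hΦ : ContDiffOn ℝ ∞ Φ I) (hal : ∀ r ∈ I, Allowed Φ R r) :
    ContDiffOn ℝ ∞ (speed Φ R) I := by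
  have hN := contDiffOn_exp_two_mul hΦ
  have h2 : ContDiffOn ℝ ∞ (fun r : ℝ => r ^ 2) I := contDiffOn_id.pow 2
  refine hN.mul (ContDiffOn.sqrt (contDiffOn_const.sub ((contDiffOn_const.mul hN).div h2
    fun r hr => pow_ne_zero 2 (hI0 hr).ne')) fun r hr => (hal r hr).one_sub_pos.ne')

/-- In substance this is `speed · speed' = (speed²)' / 2`, where `speed²` is the potential. -/
theorem hasDerivAt_speed {Φ : ℝ → ℝ} {J : Set ℝ} (hJ : IsOpen J) (hJ0 : J ⊆ Ioi 0)
    (hΦ : ContDiffOn ℝ ∞ Φ J) {R r : ℝ} (hr : r ∈ J) (h : Allowed Φ R r) :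
    HasDerivAt (speed Φ R) (radialForce Φ R r / speed Φ R r) r := by
  have dΦ := (differentiableAt_of_smooth hJ hΦ hr).hasDerivAt
  have r0 : r ≠ 0 := (hJ0 hr).ne'
  have dN := hasDerivAt_exp_two_mul dΦ
  have hq := h.one_sub_pos
  refine (dN.mul ((((dN.const_mul (R ^ 2)).div (hasDerivAt_pow 2 r)
    (pow_ne_zero 2 r0)).const_sub 1).sqrt hq.ne')).congr_deriv ?_
  simp only [Pi.div_apply]
  have hs := Real.sqrt_pos.2 hq
  have hs2 := Real.sq_sqrt hq.le
  rw [speed, radialForce]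
  set S := Real.sqrt (1 - R ^ 2 * Real.exp (2 * Φ r) / r ^ 2)
  have hN := (Real.exp_pos (2 * Φ r)).ne'
  field_simp
  field_simp at hs2
  simp only [Nat.cast_ofNat]
  linear_combination (4 * r ^ 2 * deriv Φ r) * hs2

/-! ### Rotation-invariant surfaces -/

/-- The rotation-invariant surface over the curve `(t, r) = (a, b)`. -/
def revolutionMap (a b : ℝ → ℝ) : ℝ × ℝ → Fin 3 → ℝ := fun p => ![a p.1, b p.1, p.2]

theorem memberMap_eq_revolutionMap (T : ℝ → ℝ) (σ c : ℝ) :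
    memberMap T σ c = revolutionMap (fun r => σ * T r + c) id := rfl

theorem hasFDerivAt_revolutionMap {a b : ℝ → ℝ} {a' b' : ℝ} {p : ℝ × ℝ}
    (ha : HasDerivAt a a' p.1) (hb : HasDerivAt b b' p.1) :
    HasFDerivAt (revolutionMap a b) (ContinuousLinearMap.pi
      ![a' • ContinuousLinearMap.fst ℝ ℝ ℝ, b' • ContinuousLinearMap.fst ℝ ℝ ℝ,
        ContinuousLinearMap.snd ℝ ℝ ℝ]) p := by
  rw [hasFDerivAt_pi']
  intro i
  fin_cases i
  · exact ha.comp_hasFDerivAt p hasFDerivAt_fst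
  · exact hb.comp_hasFDerivAt p hasFDerivAt_fst
  · exact hasFDerivAt_snd

theorem fderiv_revolutionMap {a b : ℝ → ℝ} {a' b' : ℝ} {p : ℝ × ℝ}
    (ha : HasDerivAt a a' p.1) (hb : HasDerivAt b b' p.1) (v : ℝ × ℝ) :
    fderiv ℝ (revolutionMap a b) p v = ![a' * v.1, b' * v.1, v.2] := by
  rw [(hasFDerivAt_revolutionMap ha hb).fderiv]
  funext i
  fin_cases i <;> simp

theorem contDiffOn_revolutionMap {a b : ℝ → ℝ} {E : Set ℝ} {n : WithTop ℕ∞}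
    (ha : ContDiffOn ℝ n a E) (hb : ContDiffOn ℝ n b E) :
    ContDiffOn ℝ n (revolutionMap a b) (E ×ˢ univ) := by
  have hE : MapsTo (Prod.fst : ℝ × ℝ → ℝ) (E ×ˢ univ) E := fun p hp => hp.1
  rw [contDiffOn_pi]
  intro i
  fin_cases i
  · exact ha.comp contDiffOn_fst hE
  · exact hb.comp contDiffOn_fst hE
  · exact contDiffOn_snd

theorem isImmersedSurface_revolutionMap {a b a' b' : ℝ → ℝ} {E J : Set ℝ} (hE : IsOpen E)
    (ha : ContDiffOn ℝ ∞ a E) (hb : ContDiffOn ℝ ∞ b E)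
    (ha' : ∀ t ∈ E, HasDerivAt a (a' t) t) (hb' : ∀ t ∈ E, HasDerivAt b (b' t) t)
    (h0 : ∀ t ∈ E, a' t ≠ 0 ∨ b' t ≠ 0) (hJ : MapsTo b E J) :
    IsImmersedSurface (region J) (E ×ˢ univ) (revolutionMap a b) where
  isOpen := hE.prod isOpen_univ
  smooth := contDiffOn_revolutionMap ha hb
  mapsTo p hp := hJ hp.1
  immersive p hp := by
    rw [injective_iff_map_eq_zero]
    intro v hv
    rw [fderiv_revolutionMap (ha' _ hp.1) (hb' _ hp.1)] at hv
    have e0 := congrFun hv 0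
    have e1 := congrFun hv 1
    have e2 := congrFun hv 2
    simp at e0 e1 e2
    have : v.1 = 0 := by
      rcases h0 _ hp.1 with h | h
      · exact e0.resolve_left h
      · exact e1.resolve_left h
    exact Prod.ext this e2

/-- `ρ`, with derivative `ρ'`, describes a curve `r = ρ(t)` which solves the equation
`(dr/dt)² = e^{4Φ} (1 - R² e^{2Φ} / r²)` and the equation of second order that follows from it
where `dr/dt ≠ 0`. -/
structure IsProfile (Φ : ℝ → ℝ) (R : ℝ) (J E : Set ℝ) (ρ ρ' : ℝ → ℝ) : Prop where
  isOpen : IsOpen E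
  ordConnected : E.OrdConnected
  mapsTo : MapsTo ρ E J
  hasDerivAt : ∀ t ∈ E, HasDerivAt ρ (ρ' t) t
  sq_eq : ∀ t ∈ E, ρ' t ^ 2 = radialPotential Φ R (ρ t)
  hasDerivAt' : ∀ t ∈ E, HasDerivAt ρ' (radialForce Φ R (ρ t)) t

namespace IsProfile

variable {Φ ρ ρ' : ℝ → ℝ} {R : ℝ} {J E : Set ℝ}

/-- Bootstrapping with the second-order equation, whose right-hand side is smooth in `ρ`: each step
gains one derivative for `ρ` and `ρ'` together. The first-order equation would involve a square root
that vanishes at turning points. -/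
theorem contDiffOn (h : IsProfile Φ R J E ρ ρ') (hJ : IsOpen J) (hJ0 : J ⊆ Ioi 0)
    (hΦ : ContDiffOn ℝ ∞ Φ J) : ContDiffOn ℝ ∞ ρ E := by
  have hW := contDiffOn_radialForce hJ hJ0 hΦ R
  have key : ∀ n : ℕ, ContDiffOn ℝ n ρ E ∧ ContDiffOn ℝ n ρ' E := by
    intro n
    induction n with
    | zero =>
      exact ⟨contDiffOn_zero.2 fun t ht => (h.hasDerivAt t ht).continuousAt.continuousWithinAt,
        contDiffOn_zero.2 fun t ht => (h.hasDerivAt' t ht).continuousAt.continuousWithinAt⟩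
    | succ n ih =>
      push_cast
      rw [contDiffOn_succ_iff_deriv_of_isOpen h.isOpen, contDiffOn_succ_iff_deriv_of_isOpen h.isOpen]
      refine ⟨⟨fun t ht => (h.hasDerivAt t ht).differentiableAt.differentiableWithinAt, by simp,
        ih.2.congr fun t ht => (h.hasDerivAt t ht).deriv⟩,
        fun t ht => (h.hasDerivAt' t ht).differentiableAt.differentiableWithinAt, by simp, ?_⟩
      refine ContDiffOn.congr (f := fun t => radialForce Φ R (ρ t)) ?_
        fun t ht => (h.hasDerivAt' t ht).deriv
      exact (hW.of_le (by exact_mod_cast le_top)).comp ih.1 h.mapsTo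
  exact contDiffOn_infty.2 fun n => (key n).1

theorem isImmersedSurface (h : IsProfile Φ R J E ρ ρ') (hJ : IsOpen J) (hJ0 : J ⊆ Ioi 0)
    (hΦ : ContDiffOn ℝ ∞ Φ J) :
    IsImmersedSurface (region J) (E ×ˢ univ) (revolutionMap id ρ) :=
  isImmersedSurface_revolutionMap h.isOpen contDiffOn_id (h.contDiffOn hJ hJ0 hΦ)
    (fun t _ => hasDerivAt_id t) h.hasDerivAt (fun _ _ => Or.inl one_ne_zero) h.mapsTo

/-- The first-order equation eliminates `ρ'`, so turning points are not special for the induced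
metric. As a difference of two squares it exhibits both lightlike directions. -/
theorem pairing_eq (h : IsProfile Φ R J E ρ ρ') (hJ0 : J ⊆ Ioi 0) {p : ℝ × ℝ}
    (hp : p ∈ E ×ˢ (univ : Set ℝ)) (v : ℝ × ℝ) :
    pairing (sphericalMetric Φ) (revolutionMap id ρ p) (fderiv ℝ (revolutionMap id ρ) p v)
      (fderiv ℝ (revolutionMap id ρ) p v)
      = (ρ p.1 * v.2) ^ 2 - (v.1 * R * Real.exp (2 * Φ (ρ p.1)) / ρ p.1) ^ 2 := by
  have r0 : ρ p.1 ≠ 0 := (hJ0 (h.mapsTo hp.1)).ne'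
  have hN := (Real.exp_pos (2 * Φ (ρ p.1))).ne'
  have e := h.sq_eq _ hp.1
  rw [radialPotential] at e
  rw [fderiv_revolutionMap (hasDerivAt_id _) (h.hasDerivAt _ hp.1), pairing_sphericalMetric]
  simp [revolutionMap]
  field_simp
  field_simp at e
  linear_combination v.1 ^ 2 * e

theorem isTimelikeSurface (h : IsProfile Φ R J E ρ ρ') (hJ0 : J ⊆ Ioi 0) (hR : R ≠ 0) :
    IsTimelikeSurface (sphericalMetric Φ) (E ×ˢ univ) (revolutionMap id ρ) := by
  intro p hp
  refine ⟨(1, 0), ?_⟩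
  rw [h.pairing_eq hJ0 hp]
  have r0 : ρ p.1 ≠ 0 := (hJ0 (h.mapsTo hp.1)).ne'
  have hN := (Real.exp_pos (2 * Φ (ρ p.1))).ne'
  have : 1 * R * Real.exp (2 * Φ (ρ p.1)) / ρ p.1 ≠ 0 := by
    rw [one_mul]
    exact div_ne_zero (mul_ne_zero hR hN) r0
  have := pow_pos (abs_pos.2 this) 2
  rw [sq_abs] at this
  simp only [mul_zero]
  linarith

/-- Every lightlike tangent vector is the initial vector of a geodesic which runs through the
whole surface. -/
theorem exists_generator (h : IsProfile Φ R J E ρ ρ') (hJ : IsOpen J) (hJ0 : J ⊆ Ioi 0)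
    (hΦ : ContDiffOn ℝ ∞ Φ J) {p : ℝ × ℝ} (hp : p ∈ E ×ˢ (univ : Set ℝ)) {v : ℝ × ℝ}
    (hv : IsLightlike (sphericalMetric Φ) (revolutionMap id ρ p)
      (fderiv ℝ (revolutionMap id ρ) p v)) :
    ∃ (D : Set ℝ) (c : ℝ → ℝ × ℝ), IsOpen D ∧ D.OrdConnected ∧ 0 ∈ D ∧ ContinuousOn c D ∧
      MapsTo c D (E ×ˢ univ) ∧ c 0 = p ∧
      IsGeodesicOn (sphericalMetric Φ) (region J) D (revolutionMap id ρ ∘ c) ∧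
      deriv (revolutionMap id ρ ∘ c) 0 = fderiv ℝ (revolutionMap id ρ) p v ∧
      BijOn (fun s => (c s).1) D E ∧
      (StrictMonoOn (fun s => (c s).1) D ∨ StrictAntiOn (fun s => (c s).1) D) := by
  obtain ⟨t₀, φ₀⟩ := p
  have ht₀ : t₀ ∈ E := hp.1
  have r0 : ∀ t ∈ E, ρ t ≠ 0 := fun t ht => (hJ0 (h.mapsTo ht)).ne'
  have hN : ∀ t, Real.exp (2 * Φ (ρ t)) ≠ 0 := fun t => (Real.exp_pos _).ne'
  have hfd := fderiv_revolutionMap (hasDerivAt_id t₀) (h.hasDerivAt t₀ ht₀) v (p := (t₀, φ₀))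
  obtain ⟨ε, hε, hv2⟩ : ∃ ε : ℝ, (ε = 1 ∨ ε = -1) ∧
      v.2 = ε * (v.1 * R * Real.exp (2 * Φ (ρ t₀)) / ρ t₀ ^ 2) := by
    have e := hv.2
    rw [h.pairing_eq hJ0 hp, sub_eq_zero, sq_eq_sq_iff_eq_or_eq_neg] at e
    have := r0 t₀ ht₀
    rcases e with e | e
    · refine ⟨1, Or.inl rfl, ?_⟩
      simp only at e
      field_simp at e ⊢
      linear_combination e
    · refine ⟨-1, Or.inr rfl, ?_⟩
      simp only at e
      field_simp at e ⊢
      linear_combination e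
  have hv1 : v.1 ≠ 0 := by
    intro h0
    apply hv.1
    rw [hfd, hv2, h0]
    funext i
    fin_cases i <;> simp
  -- The energy of the geodesic: `dt/ds = κ e^{-2Φ}` has to equal `v.1` at `s = 0`.
  set κ : ℝ := v.1 * Real.exp (2 * Φ (ρ t₀)) with hκ
  have hκ0 : κ ≠ 0 := mul_ne_zero hv1 (hN _)
  have hρc : ContinuousOn ρ E := fun t ht => (h.hasDerivAt t ht).continuousAt.continuousWithinAt
  have hNc : ContinuousOn (fun t => Real.exp (2 * Φ (ρ t))) E :=
    ((hΦ.continuousOn.comp hρc h.mapsTo).const_mul 2).rexp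
  -- Integrating `dt/ds = κ e^{-2Φ}` gives `κ s = τ(t)`. The inverse of `τ` yields `t` as a function
  -- of `s`, and `η` is the angle as a function of `t`. Since `τ` is defined on all of `E`, the
  -- geodesic runs through the entire profile.
  obtain ⟨τ, hτ0, hτ⟩ := exists_primitive h.isOpen h.ordConnected hNc ht₀ 0
  obtain ⟨η, hη0, hη⟩ := exists_primitive h.isOpen h.ordConnected
    (f := fun t => ε * R * Real.exp (2 * Φ (ρ t)) / ρ t ^ 2)
    ((hNc.const_mul (ε * R)).div (hρc.pow 2) fun t ht => pow_ne_zero 2 (r0 t ht)) ht₀ φ₀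
  have hτm := strictMonoOn_of_hasDerivAt_pos h.isOpen h.ordConnected hτ
    fun t _ => Real.exp_pos _
  have hτc : ContinuousOn τ E := fun t ht => (hτ t ht).continuousAt.continuousWithinAt
  have hτo := isOpen_image_of_strictMonoOn h.isOpen hτc hτm
  obtain ⟨hτoc, g, hgτ, hgc⟩ := exists_continuous_inverse h.ordConnected hτc hτm
  have hgE : ∀ y ∈ τ '' E, g y ∈ E ∧ τ (g y) = y := by
    rintro _ ⟨t, ht, rfl⟩
    rw [hgτ t ht]
    exact ⟨ht, rfl⟩
  have hgd : ∀ y ∈ τ '' E, HasDerivAt g (Real.exp (2 * Φ (ρ (g y))))⁻¹ y := by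
    rintro _ ⟨t, ht, rfl⟩
    rw [hgτ t ht]
    exact hasDerivAt_inverse hτo hgτ hgc ht (hN t) (hτ t ht)
  have hgm : StrictMonoOn g (τ '' E) := by
    rintro _ ⟨t, ht, rfl⟩ _ ⟨u, hu, rfl⟩ htu
    rw [hgτ t ht, hgτ u hu]
    exact (hτm.lt_iff_lt ht hu).1 htu
  let D : Set ℝ := {s | κ * (s - 0) ∈ τ '' E}
  have hDs : ∀ s ∈ D, κ * s ∈ τ '' E := fun s hs => by simpa [D] using hs
  have hDo : IsOpen D := hτo.preimage (by fun_prop)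
  have hD0 : (0 : ℝ) ∈ D := ⟨t₀, ht₀, by simp [hτ0]⟩
  have htd : ∀ s ∈ D, HasDerivAt (fun s => g (κ * s))
      (κ / Real.exp (2 * Φ (ρ (g (κ * s))))) s := by
    intro s hs
    refine (HasDerivAt.comp s (hgd _ (hDs s hs))
      ((hasDerivAt_id s).const_mul κ)).congr_deriv ?_
    simp [div_eq_mul_inv, mul_comm]
  have hφd : ∀ s ∈ D, HasDerivAt (fun s => η (g (κ * s)))
      (κ * (ε * R) / ρ (g (κ * s)) ^ 2) s := by
    intro s hs
    have hE := (hgE _ (hDs s hs)).1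
    have := r0 _ hE
    have := hN (g (κ * s))
    refine (HasDerivAt.comp s (hη _ hE) (htd s hs)).congr_deriv ?_
    field_simp
  have hg0 : g (κ * 0) = t₀ := by
    rw [mul_zero, ← hτ0, hgτ t₀ ht₀]
  have hμd : ∀ s ∈ D, HasDerivAt (revolutionMap id ρ ∘ fun s => (g (κ * s), η (g (κ * s))))
      ![κ / Real.exp (2 * Φ (ρ (g (κ * s)))),
        κ * ρ' (g (κ * s)) / Real.exp (2 * Φ (ρ (g (κ * s)))),
        κ * (ε * R) / ρ (g (κ * s)) ^ 2] s := by
    intro s hs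
    rw [hasDerivAt_pi]
    intro i
    fin_cases i
    · exact htd s hs
    · refine (HasDerivAt.comp s (h.hasDerivAt _ (hgE _ (hDs s hs)).1) (htd s hs)).congr_deriv ?_
      simp
      ring
    · exact hφd s hs
  refine ⟨D, fun s => (g (κ * s), η (g (κ * s))), hDo,
    OrdConnected.preimage_mul_sub hτoc κ 0, hD0, ?_, ?_, ?_, ?_, ?_, ⟨?_, ?_, ?_⟩, ?_⟩
  · intro s hs
    exact ((htd s hs).continuousAt.prodMk (hφd s hs).continuousAt).continuousWithinAt
  · intro s hs
    exact ⟨(hgE _ (hDs s hs)).1, mem_univ _⟩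
  · simp only [hg0, hη0]
  · refine isGeodesicOn_of_conserved (y := fun s => ρ' (g (κ * s))) (R := R) (κ := κ) hJ hJ0 hΦ
      hDo hε (fun s hs => h.mapsTo (hgE _ (hDs s hs)).1) hμd
      (fun s hs => h.sq_eq _ (hgE _ (hDs s hs)).1) fun s hs => ?_
    exact HasDerivAt.comp s (h.hasDerivAt' _ (hgE _ (hDs s hs)).1) (htd s hs)
  · rw [(hμd 0 hD0).deriv, hg0, hfd, hv2]
    have := hN t₀
    have := r0 t₀ ht₀
    funext i
    fin_cases i
    · simp [hκ]
    · simp [hκ]; field_simp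
    · simp [hκ]; field_simp
  · intro s hs
    exact (hgE _ (hDs s hs)).1
  · intro s hs u hu hsu
    have := hgm.injOn (hDs s hs) (hDs u hu) hsu
    exact mul_left_cancel₀ hκ0 this
  · intro t ht
    refine ⟨τ t / κ, ⟨t, ht, by simp; field_simp⟩, ?_⟩
    simp only
    rw [mul_div_cancel₀ _ hκ0, hgτ t ht]
  · rcases lt_or_gt_of_ne hκ0 with hk | hk
    · exact Or.inr fun s hs u hu hsu =>
        hgm (hDs u hu) (hDs s hs) (mul_lt_mul_of_neg_left hsu hk)
    · exact Or.inl fun s hs u hu hsu =>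
        hgm (hDs s hs) (hDs u hu) (mul_lt_mul_of_pos_left hsu hk)

theorem isPhotonSurface (h : IsProfile Φ R J E ρ ρ') (hJ : IsOpen J) (hJ0 : J ⊆ Ioi 0)
    (hΦ : ContDiffOn ℝ ∞ Φ J) (hR : R ≠ 0) :
    IsPhotonSurface (sphericalMetric Φ) (region J) (E ×ˢ univ) (revolutionMap id ρ) := by
  refine .of_timelike (h.isImmersedSurface hJ hJ0 hΦ) (h.isTimelikeSurface hJ0 hR)
    fun p hp v hv => ?_
  obtain ⟨D, c, hDo, -, hD0, hcc, hcm, hc0, hgeo, hd, -⟩ := h.exists_generator hJ hJ0 hΦ hp hv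
  obtain ⟨ε, hε, hball⟩ := Metric.isOpen_iff.1 hDo 0 hD0
  rw [Real.ball_eq_Ioo, zero_sub, zero_add] at hball
  exact ⟨ε, hε, c, hcc.mono hball, hcm.mono_left hball, hc0,
    ⟨isOpen_Ioo, hgeo.2.1.mono_left hball, hgeo.2.2.1.mono hball,
      fun s hs => hgeo.2.2.2 s (hball hs)⟩, hd⟩

end IsProfile

/-! ### The allowed region -/

theorem speed_eq_zero {Φ : ℝ → ℝ} {R r : ℝ} (hr : r ≠ 0)
    (h : R ^ 2 = r ^ 2 * Real.exp (-(2 * Φ r))) : speed Φ R r = 0 := by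
  have hN := (Real.exp_pos (2 * Φ r)).ne'
  have : 1 - R ^ 2 * Real.exp (2 * Φ r) / r ^ 2 = 0 := by
    rw [h, Real.exp_neg]
    field_simp
    ring
  rw [speed, this, Real.sqrt_zero, mul_zero]

theorem radialPotential_eq_zero {Φ : ℝ → ℝ} {R r : ℝ} (hr : r ≠ 0)
    (h : R ^ 2 = r ^ 2 * Real.exp (-(2 * Φ r))) : radialPotential Φ R r = 0 := by
  have hN := (Real.exp_pos (2 * Φ r)).ne'
  rw [radialPotential, h, Real.exp_neg]
  field_simp
  ring

theorem coeffA_equation_rhs {Φ : ℝ → ℝ} {R r : ℝ} (hr : r ≠ 0) :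
    Real.exp (2 * Φ r) * (Real.exp (2 * Φ r) - (coeffA Φ R r ^ 2)⁻¹) = radialPotential Φ R r := by
  have := (Real.exp_pos (2 * Φ r)).ne'
  rw [coeffA, radialPotential, Real.exp_neg]
  field_simp

theorem speed_sq_of_le {Φ : ℝ → ℝ} {R r : ℝ} (hr : r ≠ 0)
    (h : R ^ 2 ≤ r ^ 2 * Real.exp (-(2 * Φ r))) : speed Φ R r ^ 2 = radialPotential Φ R r := by
  rcases h.lt_or_eq with h | h
  · exact Allowed.speed_sq h
  · rw [speed_eq_zero hr h, radialPotential_eq_zero hr h, zero_pow two_ne_zero]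

theorem sq_eq_coeffA_iff {Φ : ℝ → ℝ} {R r : ℝ} (hr : r ≠ 0)
    (h : R ^ 2 ≤ r ^ 2 * Real.exp (-(2 * Φ r))) (X : ℝ) :
    X ^ 2 = Real.exp (2 * Φ r) * (Real.exp (2 * Φ r) - (coeffA Φ R r ^ 2)⁻¹) ↔
      X = speed Φ R r ∨ X = -speed Φ R r := by
  rw [coeffA_equation_rhs hr, ← speed_sq_of_le hr h, sq_eq_sq_iff_eq_or_eq_neg]

theorem not_exists_sq_eq_coeffA {Φ : ℝ → ℝ} {R r : ℝ} (hr : r ≠ 0)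
    (h : r ^ 2 * Real.exp (-(2 * Φ r)) < R ^ 2) :
    ¬ ∃ X : ℝ, X ^ 2 = Real.exp (2 * Φ r) * (Real.exp (2 * Φ r) - (coeffA Φ R r ^ 2)⁻¹) := by
  rintro ⟨X, hX⟩
  rw [coeffA_equation_rhs hr, radialPotential] at hX
  have hN := Real.exp_pos (2 * Φ r)
  have hr2 : 0 < r ^ 2 := by positivity
  have : 1 - R ^ 2 * Real.exp (2 * Φ r) / r ^ 2 < 0 := by
    rw [sub_neg, one_lt_div hr2]
    rwa [Real.exp_neg, ← div_eq_mul_inv, div_lt_iff₀ hN] at h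
  have h2 := mul_neg_of_pos_of_neg (pow_pos hN 2) this
  linarith [sq_nonneg X]

/-! ### The members of the families -/

theorem mem_member_iff {I : Set ℝ} {T : ℝ → ℝ} {σ c : ℝ} {x : Fin 3 → ℝ} :
    x ∈ member I T σ c ↔ x 1 ∈ I ∧ x 0 = σ * T (x 1) + c := by
  constructor
  · rintro ⟨p, hp, rfl⟩
    exact ⟨hp.1, rfl⟩
  · rintro ⟨h1, h0⟩
    refine ⟨(x 1, x 2), ⟨h1, mem_univ _⟩, ?_⟩
    funext i
    fin_cases i
    · simp [memberMap, h0]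
    · simp [memberMap]
    · simp [memberMap]

theorem rotationInvariant_member (I : Set ℝ) (T : ℝ → ℝ) (σ c : ℝ) :
    RotationInvariant (member I T σ c) := by
  intro x hx a
  rw [mem_member_iff] at hx ⊢
  simpa [coordVec] using hx

theorem rotationInvariant_gluedMember (I : Set ℝ) (T : ℝ → ℝ) (b ℓ c : ℝ) :
    RotationInvariant (gluedMember I T b ℓ c) := by
  rintro x ((hx | hx) | hx) a
  · exact Or.inl (Or.inl (rotationInvariant_member _ _ _ _ x hx a))
  · exact Or.inl (Or.inr (by simpa [coordVec] using hx))
  · exact Or.inr (rotationInvariant_member _ _ _ _ x hx a)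

theorem sUnion_range_member (I : Set ℝ) (T : ℝ → ℝ) (σ : ℝ) :
    ⋃₀ range (member I T σ) = region I := by
  ext x
  simp only [sUnion_range, mem_iUnion, mem_member_iff, region, mem_ofPred_eq]
  exact ⟨fun ⟨_, h, _⟩ => h, fun h => ⟨x 0 - σ * T (x 1), h, by ring⟩⟩

theorem pairwiseDisjoint_range_member (I : Set ℝ) (T : ℝ → ℝ) (σ : ℝ) :
    (range (member I T σ)).PairwiseDisjoint id := by
  rintro _ ⟨c, rfl⟩ _ ⟨d, rfl⟩ hcd
  refine disjoint_left.2 fun x hx hx' => hcd ?_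
  have h1 := (mem_member_iff.1 hx).2
  have h2 := (mem_member_iff.1 hx').2
  have : c = d := by linarith
  rw [this]

/-- Used to regard leaves found in one part of the spacetime as photon surfaces in the whole. -/
theorem IsTimelikePhotonSet.mono {n : ℕ} {g : CoordMetric n} {U U' S : Set (Fin n → ℝ)}
    {Q Q' : Set (ℝ × ℝ) → (ℝ × ℝ → (Fin n → ℝ)) → Prop} (h : IsTimelikePhotonSet g U S Q)
    (hU : U ⊆ U') (hQ : ∀ W F, Q W F → Q' W F) : IsTimelikePhotonSet g U' S Q' := by
  obtain ⟨W, F, hW, hF, hS, hp, ht, hq⟩ := h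
  refine ⟨W, F, hW, hF, hS, ⟨⟨hp.immersed.isOpen, hp.immersed.smooth,
    hp.immersed.mapsTo.mono_right hU, hp.immersed.immersive⟩, hp.nowhere_spacelike, ?_⟩, ht,
    hQ W F hq⟩
  intro p hpW v hv
  obtain ⟨ε, hε, c, hc, hm, h0, hg, hd⟩ := hp.contains_geodesics p hpW v hv
  exact ⟨ε, hε, c, hc, hm, h0, ⟨hg.1, hg.2.1.mono_right hU, hg.2.2⟩, hd⟩

section

variable {Φ T : ℝ → ℝ} {R : ℝ} {I : Set ℝ}

theorem IsTimeFunction.contDiffOn (hT : IsTimeFunction Φ R I T) (hI : IsOpen I) (hI0 : I ⊆ Ioi 0)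
    (hΦ : ContDiffOn ℝ ∞ Φ I) (hal : ∀ r ∈ I, Allowed Φ R r) : ContDiffOn ℝ ∞ T I := by
  rw [contDiffOn_infty_iff_deriv_of_isOpen hI]
  refine ⟨fun r hr => (hT r hr).differentiableAt.differentiableWithinAt, ?_⟩
  refine ContDiffOn.congr (f := fun r => 1 / speed Φ R r) ?_ fun r hr => (hT r hr).deriv
  exact contDiffOn_const.div (contDiffOn_speed hI0 hΦ hal) fun r hr => (hal r hr).speed_pos.ne'

theorem IsTimeFunction.strictMonoOn (hT : IsTimeFunction Φ R I T) (hI : IsOpen I)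
    (hIc : I.OrdConnected) (hal : ∀ r ∈ I, Allowed Φ R r) : StrictMonoOn T I :=
  strictMonoOn_of_hasDerivAt_pos hI hIc hT fun r hr => one_div_pos.2 (hal r hr).speed_pos

theorem IsTimeFunction.continuousOn (hT : IsTimeFunction Φ R I T) : ContinuousOn T I :=
  fun r hr => (hT r hr).continuousAt.continuousWithinAt

theorem exists_isTimeFunction (hI : IsOpen I) (hIc : I.OrdConnected) (hne : I.Nonempty)
    (hI0 : I ⊆ Ioi 0) (hΦ : ContDiffOn ℝ ∞ Φ I) (hal : ∀ r ∈ I, Allowed Φ R r) :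
    ∃ T, IsTimeFunction Φ R I T := by
  obtain ⟨r₀, hr₀⟩ := hne
  obtain ⟨T, -, hT⟩ := exists_primitive hI hIc (f := fun r => 1 / speed Φ R r)
    (continuousOn_const.div (contDiffOn_speed hI0 hΦ hal).continuousOn
      fun r hr => (hal r hr).speed_pos.ne') hr₀ 0
  exact ⟨T, hT⟩

theorem IsTimeFunction.hasDerivAt_member (hT : IsTimeFunction Φ R I T) (σ c : ℝ) {r : ℝ}
    (hr : r ∈ I) : HasDerivAt (fun r => σ * T r + c) (σ / speed Φ R r) r := by
  refine (((hT r hr).const_mul σ).add_const c).congr_deriv ?_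
  ring

/-- A solution of `dr/dt = σ speed(r)` solves the equation of second order. -/
theorem hasDerivAt_mul_speed {J : Set ℝ} (hJ : IsOpen J) (hJ0 : J ⊆ Ioi 0)
    (hΦ : ContDiffOn ℝ ∞ Φ J) {σ : ℝ} (hσ : σ = 1 ∨ σ = -1) {ρ : ℝ → ℝ} {t : ℝ}
    (hρ : HasDerivAt ρ (σ * speed Φ R (ρ t)) t) (hJt : ρ t ∈ J) (hal : Allowed Φ R (ρ t)) :
    HasDerivAt (fun t => σ * speed Φ R (ρ t)) (radialForce Φ R (ρ t)) t := by
  refine ((HasDerivAt.comp t (hasDerivAt_speed hJ hJ0 hΦ hJt hal) hρ).const_mul σ).congr_deriv ?_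
  have := hal.speed_pos.ne'
  rcases hσ with rfl | rfl
  · field_simp
  · field_simp

/-- The member `t = σ T(r) + c` is the surface over a profile curve `r = ρ(t)`. -/
theorem IsTimeFunction.exists_profile (hT : IsTimeFunction Φ R I T) (hI : IsOpen I)
    (hIc : I.OrdConnected) (hI0 : I ⊆ Ioi 0) (hΦ : ContDiffOn ℝ ∞ Φ I)
    (hal : ∀ r ∈ I, Allowed Φ R r) {σ : ℝ} (hσ : σ = 1 ∨ σ = -1) (c : ℝ) :
    ∃ (E : Set ℝ) (ρ : ℝ → ℝ), IsProfile Φ R I E ρ (fun t => σ * speed Φ R (ρ t)) ∧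
      BijOn ρ E I ∧ ∀ r ∈ I, σ * T r + c ∈ E ∧ ρ (σ * T r + c) = r := by
  have hm := hT.strictMonoOn hI hIc hal
  have hTo := isOpen_image_of_strictMonoOn hI hT.continuousOn hm
  obtain ⟨hToc, g, hgT, hgc⟩ := exists_continuous_inverse hIc hT.continuousOn hm
  have hσσ : σ * σ = 1 := by rcases hσ with rfl | rfl <;> norm_num
  -- As `σ² = 1`, the equation `t = σ T(r) + c` reads `T(r) = σ (t - c)`, and `r` is obtained with
  -- the inverse `g` of `T`.
  let E : Set ℝ := {t | σ * (t - c) ∈ T '' I}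
  let ρ : ℝ → ℝ := fun t => g (σ * (t - c))
  have hρI : MapsTo ρ E I := by
    rintro t ⟨r, hr, he⟩
    change g (σ * (t - c)) ∈ I
    rw [← he, hgT r hr]
    exact hr
  have hTr : ∀ r ∈ I, σ * T r + c ∈ E ∧ ρ (σ * T r + c) = r := by
    intro r hr
    have e : σ * (σ * T r + c - c) = T r := by
      rw [add_sub_cancel_right, ← mul_assoc, hσσ, one_mul]
    refine ⟨⟨r, hr, e.symm⟩, ?_⟩
    change g (σ * (σ * T r + c - c)) = r
    rw [e, hgT r hr]
  have hEr : ∀ t ∈ E, t = σ * T (ρ t) + c := by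
    rintro t ⟨r, hr, he⟩
    change t = σ * T (g (σ * (t - c))) + c
    rw [← he, hgT r hr, he, ← mul_assoc, hσσ]
    ring
  have hρd : ∀ t ∈ E, HasDerivAt ρ (σ * speed Φ R (ρ t)) t := by
    rintro t ht
    obtain ⟨r, hr, he⟩ := ht
    have hne : (1 / speed Φ R r) ≠ 0 := (one_div_pos.2 (hal r hr).speed_pos).ne'
    have h1 := hasDerivAt_inverse hTo hgT hgc hr hne (hT r hr)
    rw [he] at h1
    have hρt : ρ t = r := by
      change g (σ * (t - c)) = r
      rw [← he, hgT r hr]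
    rw [hρt]
    refine (HasDerivAt.comp t h1 (((hasDerivAt_id t).sub_const c).const_mul σ)).congr_deriv ?_
    simp [mul_comm]
  refine ⟨E, ρ, ⟨hTo.preimage (by fun_prop), OrdConnected.preimage_mul_sub hToc σ c, hρI, hρd,
    fun t ht => ?_, fun t ht => ?_⟩, ⟨hρI, ?_, ?_⟩, hTr⟩
  · have h2 : σ ^ 2 = 1 := by rw [sq, hσσ]
    rw [mul_pow, h2, one_mul, (hal _ (hρI ht)).speed_sq]
  · exact hasDerivAt_mul_speed hI hI0 hΦ hσ (hρd t ht) (hρI ht) (hal _ (hρI ht))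
  · intro t ht u hu htu
    rw [hEr t ht, hEr u hu, htu]
  · intro r hr
    exact ⟨_, (hTr r hr).1, (hTr r hr).2⟩

/-- The member, parametrized by `(r, φ)`, is the surface over a profile parametrized by `(t, φ)`. A
generator passes bijectively through the times in `E`, and the profile maps `E` bijectively onto
`I`. -/
theorem IsTimeFunction.lightlikeGenerators (hT : IsTimeFunction Φ R I T) (hI : IsOpen I)
    (hIc : I.OrdConnected) (hI0 : I ⊆ Ioi 0) (hΦ : ContDiffOn ℝ ∞ Φ I)
    (hal : ∀ r ∈ I, Allowed Φ R r) {σ : ℝ} (hσ : σ = 1 ∨ σ = -1) (c : ℝ) :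
    LightlikeGeneratorsSatisfy (sphericalMetric Φ) (region I) (I ×ˢ univ)
      (memberMap T σ c) (fun D μ => BijOn (fun s => μ s 1) D I) := by
  obtain ⟨E, ρ, hρ, hbij, hTr⟩ := hT.exists_profile hI hIc hI0 hΦ hal hσ c
  rintro ⟨r, φ⟩ hp v hv
  have hr : r ∈ I := hp.1
  have hσσ : σ * σ = 1 := by rcases hσ with rfl | rfl <;> norm_num
  have hs := (hal r hr).speed_pos.ne'
  have hpt : memberMap T σ c (r, φ) = revolutionMap id ρ (σ * T r + c, φ) := by
    simp [memberMap, revolutionMap, (hTr r hr).2]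
  -- Change of parameters: along the member, `dt = (σ / speed) dr`.
  have hfd : fderiv ℝ (memberMap T σ c) (r, φ) v
      = fderiv ℝ (revolutionMap id ρ) (σ * T r + c, φ) (σ / speed Φ R r * v.1, v.2) := by
    rw [memberMap_eq_revolutionMap,
      fderiv_revolutionMap (hT.hasDerivAt_member σ c hr) (hasDerivAt_id r),
      fderiv_revolutionMap (hasDerivAt_id _) (hρ.hasDerivAt _ (hTr r hr).1), (hTr r hr).2]
    have : σ * speed Φ R r * (σ / speed Φ R r * v.1) = v.1 := by
      field_simp
      linear_combination v.1 * hσσ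
    funext i
    fin_cases i
    · simp
    · simp [this]
    · simp
  rw [hpt, hfd] at hv ⊢
  obtain ⟨D, γ, hDo, hDc, hD0, hγc, hγm, hγ0, hgeo, hd, hb, -⟩ :=
    hρ.exists_generator hI hI0 hΦ (p := (σ * T r + c, φ)) ⟨(hTr r hr).1, mem_univ _⟩ hv
  refine ⟨D, _, hDc, hD0, hgeo, ?_, by simp [hγ0], hd, ?_⟩
  · intro s hs
    have hE := (hγm hs).1
    refine ⟨(ρ (γ s).1, (γ s).2), ⟨hρ.mapsTo hE, mem_univ _⟩, ?_⟩
    obtain ⟨r', hr', e⟩ : ∃ r' ∈ I, σ * T r' + c = (γ s).1 := by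
      refine ⟨ρ (γ s).1, hρ.mapsTo hE, ?_⟩
      exact hbij.injOn (hTr _ (hρ.mapsTo hE)).1 hE (hTr _ (hρ.mapsTo hE)).2
    simp only [Function.comp_apply, revolutionMap, memberMap, id]
    rw [← e, (hTr r' hr').2]
  · exact hbij.comp hb

end

/-! ### Integral manifolds of the ansatz -/

section

variable {Φ X T : ℝ → ℝ} {R : ℝ} {I J : Set ℝ}

/-- Since `L^±` equals `k` times the velocity of the profile curve plus or minus `r⁻¹ ∂_φ`, both
pairs span the same plane. The factor `k` leaves the parametrization of the curve free. -/
theorem range_fderiv_revolutionMap {a b : ℝ → ℝ} {a' b' : ℝ} {p : ℝ × ℝ}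
    (ha : HasDerivAt a a' p.1) (hb : HasDerivAt b b' p.1) {A X : ℝ → ℝ} {k : ℝ}
    (hk : k ≠ 0) (h0 : A (b p.1) = k * a') (h1 : A (b p.1) * X (b p.1) = k * b')
    (hr : b p.1 ≠ 0) :
    LinearMap.range (fderiv ℝ (revolutionMap a b) p : ℝ × ℝ →ₗ[ℝ] (Fin 3 → ℝ))
      = Submodule.span ℝ {ansatz A X 1 (revolutionMap a b p),
          ansatz A X (-1) (revolutionMap a b p)} := by
  have hL : ∀ ε, ansatz A X ε (revolutionMap a b p) = ![k * a', k * b', ε * (b p.1)⁻¹] := by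
    intro ε
    funext i
    fin_cases i
    · simp [ansatz_zero, revolutionMap, h0]
    · simp [ansatz_one, revolutionMap, h1]
    · simp [ansatz_two, revolutionMap]
  ext w
  rw [Submodule.mem_span_pair, hL, hL]
  simp only [LinearMap.mem_range, ContinuousLinearMap.coe_coe, fderiv_revolutionMap ha hb]
  constructor
  · rintro ⟨v, rfl⟩
    -- The coefficients `x`, `y` of `L⁺`, `L⁻` have to satisfy `x + y = v.1 / k` and `(x - y) / r =
    -- v.2`.
    refine ⟨(v.1 / k + v.2 * b p.1) / 2, (v.1 / k - v.2 * b p.1) / 2, ?_⟩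
    funext i
    fin_cases i
    · simp; field_simp; ring
    · simp; field_simp; ring
    · simp; field_simp; ring
  · rintro ⟨x, y, rfl⟩
    refine ⟨(k * (x + y), (x - y) * (b p.1)⁻¹), ?_⟩
    funext i
    fin_cases i
    · simp; ring
    · simp; ring
    · simp; ring

theorem contDiffOn_ansatz {A : ℝ → ℝ} {n : WithTop ℕ∞} (hJ0 : J ⊆ Ioi 0)
    (hA : ContDiffOn ℝ n A J) (hX : ContDiffOn ℝ n X J) (ε : ℝ) :
    ContDiffOn ℝ n (ansatz A X ε) (region J) := by
  have h1 : ContDiffOn ℝ n (fun x : Fin 3 → ℝ => x 1) (region J) :=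
    (contDiff_apply ℝ ℝ 1).contDiffOn
  have hm : MapsTo (fun x : Fin 3 → ℝ => x 1) (region J) J := fun x hx => hx
  have hA1 := hA.comp h1 hm
  have hX1 := hX.comp h1 hm
  have hinv := h1.inv fun x hx => (hJ0 (hm hx)).ne'
  exact (hA1.smul (contDiffOn_const.add (hX1.smul contDiffOn_const))).add
    ((contDiffOn_const.mul hinv).smul contDiffOn_const)

theorem coeffA_ne_zero {r : ℝ} (hr : r ≠ 0) (hR : R ≠ 0) : coeffA Φ R r ≠ 0 :=
  mul_ne_zero (div_ne_zero hr hR) (Real.exp_pos _).ne'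

theorem linearIndependent_ansatz {A : ℝ → ℝ} {x : Fin 3 → ℝ} (hx : x 1 ≠ 0) (hA : A (x 1) ≠ 0) :
    LinearIndependent ℝ ![ansatz A X 1 x, ansatz A X (-1) x] := by
  rw [LinearIndependent.pair_iff]
  intro s t h
  have h0 := congrFun h 0
  have h2 := congrFun h 2
  simp [ansatz_zero, ansatz_two] at h0 h2
  have e0 : s + t = 0 := by
    have : (s + t) * A (x 1) = 0 := by linear_combination h0
    exact (mul_eq_zero.1 this).resolve_right hA
  have e2 : s - t = 0 := by
    have : (s - t) * (x 1)⁻¹ = 0 := by linear_combination h2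
    exact (mul_eq_zero.1 this).resolve_right (inv_ne_zero hx)
  constructor <;> linarith

/-- For a smooth solution `X` the ansatz fields are foliated by their integral manifolds. -/
theorem isPhotonFoliation_ansatz (hJ : IsOpen J) (hJ0 : J ⊆ Ioi 0) (hΦ : ContDiffOn ℝ ∞ Φ J)
    (hR : R ≠ 0) (hX : ContDiffOn ℝ ∞ X J) {𝓕 : Set (Set (Fin 3 → ℝ))}
    (hcover : ⋃₀ 𝓕 = region J) (hdisj : 𝓕.PairwiseDisjoint id)
    (hleaf : ∀ S ∈ 𝓕, IsTimelikePhotonSet (sphericalMetric Φ) (region J) S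
      (IsIntegralSurface (ansatz (coeffA Φ R) X 1) (ansatz (coeffA Φ R) X (-1)))) :
    IsPhotonFoliation (sphericalMetric Φ) (region J) (ansatz (coeffA Φ R) X 1)
      (ansatz (coeffA Φ R) X (-1)) 𝓕 where
  smooth_p := contDiffOn_ansatz hJ0 (contDiffOn_coeffA hΦ R) hX 1
  smooth_m := contDiffOn_ansatz hJ0 (contDiffOn_coeffA hΦ R) hX (-1)
  independent x hx := linearIndependent_ansatz (hJ0 hx).ne' (coeffA_ne_zero (hJ0 hx).ne' hR)
  involutive x hx := by
    rw [lieBracket_ansatz (hJ0 hx).ne'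
      (differentiableAt_of_smooth hJ (contDiffOn_coeffA hΦ R) hx)
      (differentiableAt_of_smooth hJ hX hx)]
    exact Submodule.smul_mem _ _ (Submodule.sub_mem _
      (Submodule.subset_span (by simp)) (Submodule.subset_span (by simp)))
  cover := hcover
  disjoint := hdisj
  leaf := hleaf

/-- A common criterion for members, where `r` is the parameter, and for the photon sphere, where `r`
is constant and `t` is the parameter. `X` lives on all of `J`, possibly beyond the radii of the
surface, so that leaves with different signs can share one field. -/
theorem isTimelikePhotonSet_of_revolutionMap (hJ : IsOpen J) (hJ0 : J ⊆ Ioi 0)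
    (hΦ : ContDiffOn ℝ ∞ Φ J) (hR : R ≠ 0) (hX : ContDiffOn ℝ 1 X J)
    (hXsq : ∀ r ∈ J, X r ^ 2 = radialPotential Φ R r)
    {E : Set ℝ} (hE : IsOpen E) (hEc : IsConnected E) {a b a' b' k : ℝ → ℝ}
    (ha : ContDiffOn ℝ ∞ a E) (hb : ContDiffOn ℝ ∞ b E)
    (ha' : ∀ t ∈ E, HasDerivAt a (a' t) t) (hb' : ∀ t ∈ E, HasDerivAt b (b' t) t)
    (h0 : ∀ t ∈ E, a' t ≠ 0 ∨ b' t ≠ 0) (hbJ : MapsTo b E J)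
    (hinj : InjOn (fun t => (a t, b t)) E) (hk : ∀ t ∈ E, k t ≠ 0)
    (hka : ∀ t ∈ E, coeffA Φ R (b t) = k t * a' t)
    (hkb : ∀ t ∈ E, coeffA Φ R (b t) * X (b t) = k t * b' t) :
    IsTimelikePhotonSet (sphericalMetric Φ) (region J) (revolutionMap a b '' (E ×ˢ univ))
      (IsIntegralSurface (ansatz (coeffA Φ R) X 1) (ansatz (coeffA Φ R) X (-1))) := by
  have himm := isImmersedSurface_revolutionMap hE ha hb ha' hb' h0 hbJ
  have hint : IsIntegralSurface (ansatz (coeffA Φ R) X 1) (ansatz (coeffA Φ R) X (-1))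
      (E ×ˢ univ) (revolutionMap a b) := fun p hp =>
    range_fderiv_revolutionMap (ha' _ hp.1) (hb' _ hp.1) (hk _ hp.1) (hka _ hp.1) (hkb _ hp.1)
      (hJ0 (hbJ hp.1)).ne'
  obtain ⟨ht, hp⟩ := integralSurface_isPhotonSurface hJ hJ0 hΦ hX hR
    (A := coeffA Φ R)
    (fun r hr => ⟨rfl, by rw [coeffA_equation_rhs (hJ0 hr).ne', hXsq r hr]⟩) himm hint
  refine ⟨E ×ˢ univ, revolutionMap a b, hEc.prod isConnected_univ, ?_, rfl, hp, ht, hint⟩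
  intro p hp q hq h
  have e0 := congrFun h 0
  have e1 := congrFun h 1
  have e2 := congrFun h 2
  simp [revolutionMap] at e0 e1 e2
  exact Prod.ext (hinj hp.1 hq.1 (Prod.ext e0 e1)) e2

theorem isTimelikePhotonSet_member (hJ : IsOpen J) (hJ0 : J ⊆ Ioi 0)
    (hΦ : ContDiffOn ℝ ∞ Φ J) (hR : R ≠ 0) (hX : ContDiffOn ℝ 1 X J)
    (hXsq : ∀ r ∈ J, X r ^ 2 = radialPotential Φ R r) (hI : IsOpen I) (hIc : IsConnected I)
    (hIJ : I ⊆ J) (hal : ∀ r ∈ I, Allowed Φ R r) (hT : IsTimeFunction Φ R I T) {σ : ℝ}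
    (hσ : σ = 1 ∨ σ = -1) (hXI : ∀ r ∈ I, X r = σ * speed Φ R r) (c : ℝ) :
    IsTimelikePhotonSet (sphericalMetric Φ) (region J) (member I T σ c)
      (IsIntegralSurface (ansatz (coeffA Φ R) X 1) (ansatz (coeffA Φ R) X (-1))) := by
  have hTs := hT.contDiffOn hI (hIJ.trans hJ0) (hΦ.mono hIJ) hal
  have hσσ : σ * σ = 1 := by rcases hσ with rfl | rfl <;> norm_num
  have hσ0 : σ ≠ 0 := by rcases hσ with rfl | rfl <;> norm_num
  -- With `r` as parameter the velocity is `(σ / speed, 1)`, so `A X = k · 1` dictates `k = A σ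
  -- speed`; then `k σ / speed = A` by `σ² = 1`.
  refine isTimelikePhotonSet_of_revolutionMap (a := fun r => σ * T r + c) (b := id)
    (k := fun r => coeffA Φ R r * (σ * speed Φ R r)) hJ hJ0 hΦ hR hX hXsq hI hIc
    ((contDiffOn_const.mul hTs).add contDiffOn_const) contDiffOn_id
    (fun r hr => hT.hasDerivAt_member σ c hr) (fun r _ => hasDerivAt_id r)
    (fun _ _ => Or.inr one_ne_zero) hIJ ?_ ?_ ?_ ?_
  · exact fun r _ s _ h => congrArg Prod.snd h
  · exact fun r hr => mul_ne_zero (coeffA_ne_zero (hJ0 (hIJ hr)).ne' hR)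
      (mul_ne_zero hσ0 (hal r hr).speed_pos.ne')
  · intro r hr
    have := (hal r hr).speed_pos.ne'
    simp only [id]
    field_simp
    linear_combination -coeffA Φ R r * hσσ
  · intro r hr
    simp only [id, hXI r hr]
    ring

theorem isPhotonFoliation_member (hI : IsOpen I) (hIc : IsConnected I) (hI0 : I ⊆ Ioi 0)
    (hΦ : ContDiffOn ℝ ∞ Φ I) (hR : R ≠ 0) (hal : ∀ r ∈ I, Allowed Φ R r)
    (hT : IsTimeFunction Φ R I T) {σ : ℝ} (hσ : σ = 1 ∨ σ = -1) :
    IsPhotonFoliation (sphericalMetric Φ) (region I)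
      (ansatz (coeffA Φ R) (fun r => σ * speed Φ R r) 1)
      (ansatz (coeffA Φ R) (fun r => σ * speed Φ R r) (-1)) (range (member I T σ)) := by
  have hX : ContDiffOn ℝ ∞ (fun r => σ * speed Φ R r) I :=
    contDiffOn_const.mul (contDiffOn_speed hI0 hΦ hal)
  have hσ2 : σ ^ 2 = 1 := by rcases hσ with rfl | rfl <;> norm_num
  refine isPhotonFoliation_ansatz hI hI0 hΦ hR hX (sUnion_range_member I T σ)
    (pairwiseDisjoint_range_member I T σ) ?_
  rintro _ ⟨c, rfl⟩
  exact isTimelikePhotonSet_member hI hI0 hΦ hR (hX.of_le (by norm_cast))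
    (fun r hr => by rw [mul_pow, hσ2, one_mul, (hal r hr).speed_sq]) hI hIc Subset.rfl hal hT hσ
    (fun _ _ => rfl) c

end

/-! ### Boundary points of the allowed region -/

theorem forall_lt_or_forall_gt {I : Set ℝ} (hIc : I.OrdConnected) {b : ℝ} (hb : b ∉ I) :
    (∀ r ∈ I, r < b) ∨ ∀ r ∈ I, b < r := by
  by_contra! h
  obtain ⟨⟨x, hx, hbx⟩, y, hy, hyb⟩ := h
  exact hb (hIc.out hy hx ⟨hyb, hbx⟩)

theorem tendsto_or_tendsto_atTop_of_monotoneOn {I : Set ℝ} {f : ℝ → ℝ} (hf : MonotoneOn f I)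
    {b : ℝ} (hb : ∀ r ∈ I, r < b) (hne : I.Nonempty) :
    (∃ ℓ, Tendsto f (𝓝[I] b) (𝓝 ℓ)) ∨ Tendsto f (𝓝[I] b) atTop := by
  have key : ∀ r₀ ∈ I, ∀ᶠ r in 𝓝[I] b, r ∈ I ∧ f r₀ ≤ f r := by
    intro r₀ hr₀
    filter_upwards [self_mem_nhdsWithin, nhdsWithin_le_nhds (lt_mem_nhds (hb r₀ hr₀))]
      with r hr hlt using ⟨hr, hf hr₀ hr hlt.le⟩
  by_cases hbd : BddAbove (f '' I)
  · refine Or.inl ⟨sSup (f '' I), tendsto_order.2 ⟨fun a ha => ?_, fun a ha => ?_⟩⟩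
    · obtain ⟨_, ⟨r₀, hr₀, rfl⟩, h⟩ := exists_lt_of_lt_csSup (hne.image f) ha
      filter_upwards [key r₀ hr₀] with r hr using h.trans_le hr.2
    · filter_upwards [self_mem_nhdsWithin] with r hr
      exact (le_csSup hbd ⟨r, hr, rfl⟩).trans_lt ha
  · refine Or.inr (tendsto_atTop.2 fun M => ?_)
    obtain ⟨_, ⟨r₀, hr₀, rfl⟩, h⟩ := not_bddAbove_iff.1 hbd M
    filter_upwards [key r₀ hr₀] with r hr using h.le.trans hr.2

theorem tendsto_or_tendsto_atBot_of_monotoneOn {I : Set ℝ} {f : ℝ → ℝ} (hf : MonotoneOn f I)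
    {b : ℝ} (hb : ∀ r ∈ I, b < r) (hne : I.Nonempty) :
    (∃ ℓ, Tendsto f (𝓝[I] b) (𝓝 ℓ)) ∨ Tendsto f (𝓝[I] b) atBot := by
  have key : ∀ r₀ ∈ I, ∀ᶠ r in 𝓝[I] b, r ∈ I ∧ f r ≤ f r₀ := by
    intro r₀ hr₀
    filter_upwards [self_mem_nhdsWithin, nhdsWithin_le_nhds (gt_mem_nhds (hb r₀ hr₀))]
      with r hr hlt using ⟨hr, hf hr hr₀ hlt.le⟩
  by_cases hbd : BddBelow (f '' I)
  · refine Or.inl ⟨sInf (f '' I), tendsto_order.2 ⟨fun a ha => ?_, fun a ha => ?_⟩⟩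
    · filter_upwards [self_mem_nhdsWithin] with r hr
      exact ha.trans_le (csInf_le hbd ⟨r, hr, rfl⟩)
    · obtain ⟨_, ⟨r₀, hr₀, rfl⟩, h⟩ := exists_lt_of_csInf_lt (hne.image f) ha
      filter_upwards [key r₀ hr₀] with r hr using hr.2.trans_lt h
  · refine Or.inr (tendsto_atBot.2 fun M => ?_)
    obtain ⟨_, ⟨r₀, hr₀, rfl⟩, h⟩ := not_bddBelow_iff.1 hbd M
    filter_upwards [key r₀ hr₀] with r hr using hr.2.trans h.le

theorem tendsto_or_tendsto_abs_of_monotoneOn {I : Set ℝ} {f : ℝ → ℝ} (hf : MonotoneOn f I)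
    (hIc : I.OrdConnected) {b : ℝ} (hb : b ∉ I) (hne : I.Nonempty) :
    (∃ ℓ, Tendsto f (𝓝[I] b) (𝓝 ℓ)) ∨ Tendsto (fun r => |f r|) (𝓝[I] b) atTop := by
  rcases forall_lt_or_forall_gt hIc hb with h | h
  · exact (tendsto_or_tendsto_atTop_of_monotoneOn hf h hne).imp id
      tendsto_abs_atTop_atTop.comp
  · exact (tendsto_or_tendsto_atBot_of_monotoneOn hf h hne).imp id
      tendsto_abs_atBot_atTop.comp

/-- An increasing function with finite limit at an endpoint extends to an increasing continuous
function on the interval with this endpoint. -/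
theorem strictMonoOn_update_endpoint {I : Set ℝ} (hI : IsOpen I) (hIc : I.OrdConnected)
    {f f' : ℝ → ℝ} (hf : ∀ x ∈ I, HasDerivAt f (f' x) x) (hpos : ∀ x ∈ I, 0 < f' x) {b ℓ : ℝ}
    (hb : b ∉ I) (hbI : b ∈ closure I) (hlim : Tendsto f (𝓝[I] b) (𝓝 ℓ)) :
    (insert b I).OrdConnected ∧ ContinuousOn (Function.update f b ℓ) (insert b I) ∧
      StrictMonoOn (Function.update f b ℓ) (insert b I) := by
  have hK : (insert b I).OrdConnected :=
    (hIc.isPreconnected.subset_closure (subset_insert b I)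
      (insert_subset hbI subset_closure)).ordConnected
  have hdiff : insert b I \ {b} = I := by
    rw [insert_sdiff_of_mem _ (mem_singleton b)]
    exact sdiff_singleton_eq_self hb
  have hc : ContinuousOn (Function.update f b ℓ) (insert b I) := by
    rw [continuousOn_update_iff, hdiff]
    exact ⟨fun x hx => (hf x hx).continuousAt.continuousWithinAt, fun _ => hlim⟩
  refine ⟨hK, hc, strictMonoOn_of_deriv_pos hK.convex hc fun x hx => ?_⟩
  -- The interval `I` lies on one side of `b`, so `b` is not an interior point after it has been
  -- adjoined.
  have hxI : x ∈ I := by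
    rcases interior_subset hx with rfl | h
    · exfalso
      rcases forall_lt_or_forall_gt hIc hb with h | h
      · have hsub : insert x I ⊆ Iic x := insert_subset self_mem_Iic fun r hr => (h r hr).le
        have := interior_mono hsub hx
        rw [interior_Iic] at this
        exact lt_irrefl x this
      · have hsub : insert x I ⊆ Ici x := insert_subset self_mem_Ici fun r hr => (h r hr).le
        have := interior_mono hsub hx
        rw [interior_Ici] at this
        exact lt_irrefl x this
    · exact h
  have hev : Function.update f b ℓ =ᶠ[𝓝 x] f := by
    filter_upwards [hI.mem_nhds hxI] with y hy
    exact Function.update_of_ne (ne_of_mem_of_not_mem hy hb) _ _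
  rw [hev.deriv_eq, (hf x hxI).deriv]
  exact hpos x hxI

theorem BijOn.inter_of_iff {t : ℝ → ℝ} {D E A B : Set ℝ} (h : BijOn t D E)
    (hAB : ∀ s ∈ D, s ∈ A ↔ t s ∈ B) : BijOn t (D ∩ A) (E ∩ B) := by
  refine ⟨fun s hs => ⟨h.mapsTo hs.1, (hAB s hs.1).1 hs.2⟩, h.injOn.mono inter_subset_left, ?_⟩
  rintro y ⟨hy, hyB⟩
  obtain ⟨s, hs, rfl⟩ := h.surjOn hy
  exact ⟨s, ⟨hs, (hAB s hs).2 hyB⟩, rfl⟩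

theorem continuousOn_speed {Φ : ℝ → ℝ} {J : Set ℝ} (hJ0 : J ⊆ Ioi 0)
    (hΦ : ContDiffOn ℝ ∞ Φ J) (R : ℝ) : ContinuousOn (speed Φ R) J := by
  have hN := (contDiffOn_exp_two_mul hΦ).continuousOn
  exact hN.mul (continuousOn_const.sub ((hN.const_mul (R ^ 2)).div (continuousOn_id.pow 2)
    fun r hr => pow_ne_zero 2 (hJ0 hr).ne')).sqrt

theorem mem_gluedMember_iff {I : Set ℝ} {T : ℝ → ℝ} {b ℓ c : ℝ} {x : Fin 3 → ℝ} :
    x ∈ gluedMember I T b ℓ c ↔ (x 1 ∈ I ∧ x 0 = T (x 1) + c) ∨ (x 0 = c + ℓ ∧ x 1 = b) ∨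
      (x 1 ∈ I ∧ x 0 = -T (x 1) + (c + 2 * ℓ)) := by
  simp [gluedMember, mem_member_iff, or_assoc]

section

variable {Φ T : ℝ → ℝ} {R b ℓ : ℝ} {I J : Set ℝ}

theorem not_mem_of_not_allowed (hal : ∀ r ∈ I, Allowed Φ R r)
    (hb : R ^ 2 = b ^ 2 * Real.exp (-(2 * Φ b))) : b ∉ I :=
  fun h => (hal b h).ne hb

/-- Two members joined along a circle are the surface over a profile curve. -/
theorem IsTimeFunction.exists_glued_profile (hT : IsTimeFunction Φ R I T) (hJ : IsOpen J)
    (hJ0 : J ⊆ Ioi 0) (hΦ : ContDiffOn ℝ ∞ Φ J) (hI : IsOpen I) (hIc : I.OrdConnected)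
    (hne : I.Nonempty) (hIJ : I ⊆ J) (hal : ∀ r ∈ I, Allowed Φ R r) (hbJ : b ∈ J)
    (hbI : b ∈ closure I) (hb : R ^ 2 = b ^ 2 * Real.exp (-(2 * Φ b)))
    (hlim : Tendsto T (𝓝[I] b) (𝓝 ℓ)) (c : ℝ) :
    ∃ (E : Set ℝ) (ρ ρ' : ℝ → ℝ), IsProfile Φ R J E ρ ρ' ∧ c + ℓ ∈ E ∧ ρ (c + ℓ) = b ∧
      revolutionMap id ρ '' (E ×ˢ univ) = gluedMember I T b ℓ c ∧
      BijOn ρ (E ∩ Iic (c + ℓ)) (insert b I) ∧ BijOn ρ (E ∩ Ici (c + ℓ)) (insert b I) := by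
  have hbn : b ∉ I := not_mem_of_not_allowed hal hb
  have hpos : ∀ r ∈ I, 0 < 1 / speed Φ R r := fun r hr => one_div_pos.2 (hal r hr).speed_pos
  obtain ⟨hK, hTc, hTm⟩ := strictMonoOn_update_endpoint hI hIc hT hpos hbn hbI hlim
  obtain ⟨hP, g, hgT, hgc⟩ := exists_continuous_inverse hK hTc hTm
  have hTo := isOpen_image_of_strictMonoOn hI hT.continuousOn (hT.strictMonoOn hI hIc hal)
  set Th : ℝ → ℝ := Function.update T b ℓ
  set P : Set ℝ := Th '' insert b I
  have hThb : Th b = ℓ := Function.update_self _ _ _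
  have hThI : ∀ r ∈ I, Th r = T r := fun r hr =>
    Function.update_of_ne (ne_of_mem_of_not_mem hr hbn) _ _
  have hTP : T '' I ⊆ P := by
    rintro _ ⟨r, hr, rfl⟩
    exact ⟨r, Or.inr hr, hThI r hr⟩
  have hℓP : ℓ ∈ P := ⟨b, Or.inl rfl, hThb⟩
  have hgI : ∀ r ∈ I, g (T r) = r := fun r hr => by rw [← hThI r hr]; exact hgT r (Or.inr hr)
  have hgℓ : g ℓ = b := by rw [← hThb]; exact hgT b (Or.inl rfl)
  have hKJ : insert b I ⊆ J := insert_subset hbJ hIJ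
  -- the direction in which the time function leaves its limit
  obtain ⟨δ, hδ, hδP⟩ : ∃ δ : ℝ, (δ = 1 ∨ δ = -1) ∧ ∀ r ∈ insert b I, 0 ≤ δ * (Th r - ℓ) := by
    rcases forall_lt_or_forall_gt hIc hbn with h | h
    · refine ⟨-1, Or.inr rfl, fun r hr => ?_⟩
      have : Th r ≤ Th b := hTm.monotoneOn hr (Or.inl rfl)
        (hr.elim (fun e => e.le) fun e => (h r e).le)
      rw [hThb] at this
      linarith
    · refine ⟨1, Or.inl rfl, fun r hr => ?_⟩
      have : Th b ≤ Th r := hTm.monotoneOn (Or.inl rfl) hr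
        (hr.elim (fun e => e.ge) fun e => (h r e).le)
      rw [hThb] at this
      linarith
  have hδ0 : δ ≠ 0 := by rcases hδ with h | h <;> rw [h] <;> norm_num
  have hδabs : ∀ r ∈ insert b I, ℓ + δ * |Th r - ℓ| = Th r := by
    intro r hr
    have h := hδP r hr
    rcases hδ with rfl | rfl
    · rw [abs_of_nonneg (by linarith)]; ring
    · rw [abs_of_nonpos (by linarith)]; ring
  -- `P` is an interval with endpoint `ℓ`; measured by the distance `w` from `ℓ` it is closed under
  -- decreasing `w`. This gives openness of `E` at `m` and its connectedness.
  have hstar : ∀ w w' : ℝ, 0 ≤ w → w ≤ w' → ℓ + δ * w' ∈ P → ℓ + δ * w ∈ P := by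
    intro w w' h0 hw h
    rcases hδ with rfl | rfl
    · exact hP.out hℓP h ⟨by linarith, by linarith⟩
    · exact hP.out h hℓP ⟨by linarith, by linarith⟩
  set m : ℝ := c + ℓ with hm
  -- Both branches `t = T + c` and `t = -T + c + 2ℓ` satisfy `|t - m| = |T - ℓ|`. Thus `r` is the
  -- same function of `|t - m|` on both, and the glued curve is symmetric about the turning time
  -- `m`.
  let E : Set ℝ := {t | ℓ + δ * |t - m| ∈ P}
  let ρ : ℝ → ℝ := fun t => g (ℓ + δ * |t - m|)
  -- The sign chosen at `t = m` is immaterial, because the speed vanishes at `b`.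
  let ρ' : ℝ → ℝ := fun t => (if m < t then δ else -δ) * speed Φ R (ρ t)
  have hmE : m ∈ E := by simpa [E] using hℓP
  have hρm : ρ m = b := by simpa [ρ] using hgℓ
  have hEK : ∀ t ∈ E, ρ t ∈ insert b I ∧ Th (ρ t) = ℓ + δ * |t - m| := by
    rintro t ⟨r, hr, e⟩
    have : ρ t = r := by
      change g (ℓ + δ * |t - m|) = r
      rw [← e, hgT r hr]
    rw [this]
    exact ⟨hr, e⟩
  have hEI : ∀ t ∈ E, t ≠ m → ρ t ∈ I ∧ T (ρ t) = ℓ + δ * |t - m| := by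
    intro t ht htm
    obtain ⟨h1, h2⟩ := hEK t ht
    rcases h1 with h1 | h1
    · rw [h1, hThb] at h2
      have : δ * |t - m| = 0 := by linarith
      rcases mul_eq_zero.1 this with h | h
      · exact absurd h hδ0
      · exact absurd (sub_eq_zero.1 (abs_eq_zero.1 h)) htm
    · exact ⟨h1, by rw [← hThI _ h1, h2]⟩
  have hKE : ∀ r ∈ insert b I, ∀ t, |t - m| = |Th r - ℓ| → t ∈ E ∧ ρ t = r := by
    intro r hr t ht
    have e : ℓ + δ * |t - m| = Th r := by rw [ht, hδabs r hr]
    refine ⟨⟨r, hr, e.symm⟩, ?_⟩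
    change g (ℓ + δ * |t - m|) = r
    rw [e, hgT r hr]
  have hfc : Continuous fun t => ℓ + δ * |t - m| := by fun_prop
  have hEo : IsOpen E := by
    rw [isOpen_iff_mem_nhds]
    intro t ht
    by_cases htm : t = m
    -- Any radius of `I` is reached at the positive distance `|Th r₀ - ℓ|` from the turning time,
    -- which gives a symmetric neighbourhood of `m` in `E`.
    · obtain ⟨r₀, hr₀⟩ := hne
      have hne' : Th r₀ - ℓ ≠ 0 := by
        rw [sub_ne_zero, ← hThb]
        exact fun h => hbn (hTm.injOn (Or.inr hr₀) (Or.inl rfl) h ▸ hr₀)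
      have hmem : Ioo (m - |Th r₀ - ℓ|) (m + |Th r₀ - ℓ|) ∈ 𝓝 t := by
        rw [htm]
        exact Ioo_mem_nhds (by linarith [abs_pos.2 hne']) (by linarith [abs_pos.2 hne'])
      refine mem_of_superset hmem fun u hu => ?_
      refine hstar _ |Th r₀ - ℓ| (abs_nonneg _) (abs_le.2 ⟨?_, ?_⟩) ?_
      · linarith [hu.1]
      · linarith [hu.2]
      · rw [hδabs r₀ (Or.inr hr₀)]
        exact ⟨r₀, Or.inr hr₀, rfl⟩
    · have h1 : ℓ + δ * |t - m| ∈ T '' I := ⟨ρ t, (hEI t ht htm).1, (hEI t ht htm).2⟩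
      exact mem_of_superset (hfc.continuousAt.preimage_mem_nhds (hTo.mem_nhds h1))
        fun u hu => hTP hu
  have hEc : E.OrdConnected := by
    refine ⟨fun t₁ h₁ t₂ h₂ t ht => ?_⟩
    have : |t - m| ≤ |t₁ - m| ∨ |t - m| ≤ |t₂ - m| := by
      rcases le_total m t with h | h
      · exact Or.inr (abs_le_abs_of_nonneg (by linarith) (by linarith [ht.2]))
      · exact Or.inl (abs_le_abs_of_nonpos (by linarith) (by linarith [ht.1]))
    rcases this with h | h
    · exact hstar _ _ (abs_nonneg _) h h₁
    · exact hstar _ _ (abs_nonneg _) h h₂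
  have hρc : ContinuousOn ρ E := hgc.comp hfc.continuousOn fun t ht => ht
  have hρJ : MapsTo ρ E J := fun t ht => hKJ (hEK t ht).1
  have hbpos : b ≠ 0 := (hJ0 hbJ).ne'
  have hspb : speed Φ R b = 0 := speed_eq_zero hbpos hb
  -- away from the circle
  have hsign : ∀ t, t ≠ m → ∃ σ : ℝ, (σ = 1 ∨ σ = -1) ∧ ∀ᶠ u in 𝓝 t, u ≠ m ∧
      (if m < u then δ else -δ) = σ ∧ ℓ + δ * |u - m| = ℓ + σ * (u - m) := by
    intro t htm
    rcases lt_or_gt_of_ne htm with h | h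
    · refine ⟨-δ, by rcases hδ with h | h <;> simp [h], ?_⟩
      filter_upwards [gt_mem_nhds h] with u hu
      refine ⟨hu.ne, if_neg hu.not_gt, ?_⟩
      rw [abs_of_neg (by linarith)]
      ring
    · refine ⟨δ, hδ, ?_⟩
      filter_upwards [lt_mem_nhds h] with u hu
      exact ⟨hu.ne', if_pos hu, by rw [abs_of_pos (by linarith)]⟩
  have hρd : ∀ t ∈ E, t ≠ m → HasDerivAt ρ (ρ' t) t := by
    intro t ht htm
    obtain ⟨σ, -, hev⟩ := hsign t htm
    obtain ⟨hr, he⟩ := hEI t ht htm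
    have hd := hasDerivAt_inverse hTo hgI (hgc.mono hTP) hr (hpos _ hr).ne' (hT _ hr)
    rw [he, hev.self_of_nhds.2.2] at hd
    have h1 : HasDerivAt (fun u => ℓ + σ * (u - m)) σ t := by
      simpa using (((hasDerivAt_id t).sub_const m).const_mul σ).const_add ℓ
    have h2 := HasDerivAt.comp t hd h1
    have hev' : ρ =ᶠ[𝓝 t] g ∘ fun u => ℓ + σ * (u - m) := by
      filter_upwards [hev] with u hu
      change g (ℓ + δ * |u - m|) = g (ℓ + σ * (u - m))
      rw [hu.2.2]
    refine (h2.congr_of_eventuallyEq hev').congr_deriv ?_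
    simp only [ρ', hev.self_of_nhds.2.1, one_div, inv_inv]
    ring
  have hρd' : ∀ t ∈ E, t ≠ m → HasDerivAt ρ' (radialForce Φ R (ρ t)) t := by
    intro t ht htm
    obtain ⟨σ, hσ, hev⟩ := hsign t htm
    have h1 := hρd t ht htm
    have hr := (hEI t ht htm).1
    simp only [ρ', hev.self_of_nhds.2.1] at h1
    refine (hasDerivAt_mul_speed hJ hJ0 hΦ hσ h1 (hIJ hr) (hal _ hr)).congr_of_eventuallyEq ?_
    filter_upwards [hev] with u hu
    simp only [ρ', hu.2.1]
  -- on the circle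
  have hEm : ∀ᶠ t in 𝓝[≠] m, t ∈ E ∧ t ≠ m := by
    filter_upwards [nhdsWithin_le_nhds (hEo.mem_nhds hmE), self_mem_nhdsWithin] with t h1 h2
      using ⟨h1, h2⟩
  have hρcm : ContinuousAt ρ m := hρc.continuousAt (hEo.mem_nhds hmE)
  have hJm : J ∈ 𝓝 (ρ m) := hJ.mem_nhds (hρJ hmE)
  have hρ'm : ρ' m = 0 := by simp [ρ', hρm, hspb]
  have hρ'cm : ContinuousAt ρ' m := by
    have h1 : Tendsto (fun t => speed Φ R (ρ t)) (𝓝 m) (𝓝 0) := by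
      have := ((continuousOn_speed hJ0 hΦ R).continuousAt hJm).comp hρcm
      rwa [ContinuousAt, Function.comp_apply, hρm, hspb] at this
    rw [ContinuousAt, hρ'm]
    -- The sign of `ρ'` jumps at `m`, but `|ρ'|` is the speed, which tends to `0`.
    refine squeeze_zero_norm (fun t => ?_) h1
    have h2 : |(if m < t then δ else -δ)| = 1 := by
      split_ifs <;> rcases hδ with h | h <;> simp [h]
    have h3 : 0 ≤ speed Φ R (ρ t) := mul_nonneg (Real.exp_pos _).le (Real.sqrt_nonneg _)
    rw [Real.norm_eq_abs, abs_mul, h2, one_mul, abs_of_nonneg h3]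
  have hd1 : ∀ t ∈ E, HasDerivAt ρ (ρ' t) t := by
    intro t ht
    by_cases htm : t = m
    · rw [htm]
      exact hasDerivAt_of_eventually_ne (hEm.mono fun u hu => hρd u hu.1 hu.2) hρcm hρ'cm
    · exact hρd t ht htm
  have hd2 : ∀ t ∈ E, HasDerivAt ρ' (radialForce Φ R (ρ t)) t := by
    intro t ht
    by_cases htm : t = m
    · rw [htm]
      exact hasDerivAt_of_eventually_ne (g := fun t => radialForce Φ R (ρ t))
        (hEm.mono fun u hu => hρd' u hu.1 hu.2) hρ'cm
        (((contDiffOn_radialForce hJ hJ0 hΦ R).continuousOn.continuousAt hJm).comp hρcm)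
    · exact hρd' t ht htm
  have hle : ∀ r ∈ insert b I, R ^ 2 ≤ r ^ 2 * Real.exp (-(2 * Φ r)) := by
    rintro r (rfl | hr)
    · exact hb.le
    · exact (hal r hr).le
  refine ⟨E, ρ, ρ', ⟨hEo, hEc, hρJ, hd1, fun t ht => ?_, hd2⟩, hmE, hρm, ?_, ?_, ?_⟩
  · rw [← speed_sq_of_le (hJ0 (hρJ ht)).ne' (hle _ (hEK t ht).1)]
    simp only [ρ']
    split_ifs <;> rcases hδ with h | h <;> simp [h]
  · ext x
    rw [mem_gluedMember_iff]
    constructor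
    · rintro ⟨⟨t, φ⟩, ⟨ht, -⟩, rfl⟩
      simp only [revolutionMap, id]
      by_cases htm : t = m
      · exact Or.inr (Or.inl ⟨htm, by rw [htm]; exact hρm⟩)
      · obtain ⟨h1, h2⟩ := hEI t ht htm
        have h3 : T (ρ t) = ℓ + (t - m) ∨ T (ρ t) = ℓ - (t - m) := by
          rw [h2]
          rcases hδ with h | h <;> rcases abs_choice (t - m) with h' | h' <;> rw [h, h']
          · left; ring
          · right; ring
          · right; ring
          · left; ring
        rcases h3 with h3 | h3
        · exact Or.inl ⟨h1, by simp [h3, hm]; ring⟩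
        · refine Or.inr (Or.inr ⟨h1, ?_⟩)
          simp [h3, hm]
          ring
    · have hx : ∀ t, t ∈ E ∧ ρ t = x 1 → x 0 = t →
          x ∈ revolutionMap id ρ '' (E ×ˢ univ) := by
        rintro t ⟨ht, he⟩ hxt
        refine ⟨(t, x 2), ⟨ht, mem_univ _⟩, ?_⟩
        funext i
        fin_cases i
        · simp [revolutionMap, hxt]
        · simp [revolutionMap, he]
        · simp [revolutionMap]
      rintro (⟨h1, h2⟩ | ⟨h1, h2⟩ | ⟨h1, h2⟩)
      · refine hx _ (hKE _ (Or.inr h1) _ ?_) rfl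
        rw [h2, hThI _ h1, hm]
        ring_nf
      · exact hx m ⟨hmE, by rw [hρm, h2]⟩ h1
      · refine hx _ (hKE _ (Or.inr h1) _ ?_) rfl
        rw [h2, hThI _ h1, hm, ← abs_neg]
        ring_nf
  · refine ⟨fun t ht => (hEK t ht.1).1, fun t ht u hu h => ?_, fun r hr => ?_⟩
    · have e : ℓ + δ * |t - m| = ℓ + δ * |u - m| := by
        rw [← (hEK t ht.1).2, ← (hEK u hu.1).2, h]
      have e' := mul_left_cancel₀ hδ0 (add_left_cancel e)
      rw [abs_of_nonpos (sub_nonpos.2 ht.2), abs_of_nonpos (sub_nonpos.2 hu.2)] at e'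
      linarith
    · obtain ⟨h1, h2⟩ := hKE r hr (m - |Th r - ℓ|) (by rw [sub_sub_cancel_left, abs_neg, abs_abs])
      exact ⟨_, ⟨h1, by simp⟩, h2⟩
  · refine ⟨fun t ht => (hEK t ht.1).1, fun t ht u hu h => ?_, fun r hr => ?_⟩
    · have e : ℓ + δ * |t - m| = ℓ + δ * |u - m| := by
        rw [← (hEK t ht.1).2, ← (hEK u hu.1).2, h]
      have e' := mul_left_cancel₀ hδ0 (add_left_cancel e)
      rw [abs_of_nonneg (sub_nonneg.2 ht.2), abs_of_nonneg (sub_nonneg.2 hu.2)] at e'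
      linarith
    · obtain ⟨h1, h2⟩ := hKE r hr (m + |Th r - ℓ|) (by rw [add_sub_cancel_left, abs_abs])
      exact ⟨_, ⟨h1, by simp⟩, h2⟩

/-- A generator meets each time of the glued profile once and monotonically; the parameter at which
`t = c + ℓ` cuts it into the two runs through the radii, in an order that depends on the direction
of time along it. Tangency to `r = b` holds because the square of `ρ'` is the potential, which
vanishes at `b`. -/
theorem IsTimeFunction.isTimelikePhotonSet_gluedMember (hT : IsTimeFunction Φ R I T)
    (hJ : IsOpen J) (hJ0 : J ⊆ Ioi 0) (hΦ : ContDiffOn ℝ ∞ Φ J) (hR : R ≠ 0) (hI : IsOpen I)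
    (hIc : I.OrdConnected) (hne : I.Nonempty) (hIJ : I ⊆ J) (hal : ∀ r ∈ I, Allowed Φ R r)
    (hbJ : b ∈ J) (hbI : b ∈ closure I) (hb : R ^ 2 = b ^ 2 * Real.exp (-(2 * Φ b)))
    (hlim : Tendsto T (𝓝[I] b) (𝓝 ℓ)) (c : ℝ) :
    IsTimelikePhotonSet (sphericalMetric Φ) (region J) (gluedMember I T b ℓ c)
      (fun W F =>
        (∀ p ∈ W, F p 1 = b → ∀ v, fderiv ℝ F p v 1 = 0) ∧
        LightlikeGeneratorsSatisfy (sphericalMetric Φ) (region J) W F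
          (fun D μ => ∃ s₀ ∈ D, μ s₀ 1 = b ∧
            BijOn (fun s => μ s 1) (D ∩ Iic s₀) (insert b I) ∧
            BijOn (fun s => μ s 1) (D ∩ Ici s₀) (insert b I))) := by
  obtain ⟨E, ρ, ρ', hρ, hmE, hρm, himg, hleft, hright⟩ :=
    hT.exists_glued_profile hJ hJ0 hΦ hI hIc hne hIJ hal hbJ hbI hb hlim c
  refine ⟨E ×ˢ univ, revolutionMap id ρ, ?_, ?_, himg, hρ.isPhotonSurface hJ hJ0 hΦ hR,
    hρ.isTimelikeSurface hJ0 hR, ?_, ?_⟩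
  · exact IsConnected.prod ⟨⟨_, hmE⟩, hρ.ordConnected.isPreconnected⟩ isConnected_univ
  · intro p _ q _ h
    have e0 := congrFun h 0
    have e2 := congrFun h 2
    simp [revolutionMap] at e0 e2
    exact Prod.ext e0 e2
  · intro p hp hpb v
    have hρb : ρ p.1 = b := hpb
    have h0 := hρ.sq_eq _ hp.1
    rw [hρb, radialPotential_eq_zero (hJ0 hbJ).ne' hb] at h0
    rw [fderiv_revolutionMap (hasDerivAt_id _) (hρ.hasDerivAt _ hp.1)]
    simp [pow_eq_zero_iff two_ne_zero |>.1 h0]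
  · intro p hp v hv
    obtain ⟨D, γ, hDo, hDc, hD0, hγc, hγm, hγ0, hgeo, hd, hbij, hmono⟩ :=
      hρ.exists_generator hJ hJ0 hΦ hp hv
    obtain ⟨s₀, hs₀, hs₀m⟩ := hbij.surjOn hmE
    simp only at hs₀m
    refine ⟨D, _, hDc, hD0, hgeo, fun s hs => ⟨γ s, hγm hs, rfl⟩, by simp [hγ0], hd, s₀, hs₀,
      ?_, ?_⟩
    · simp [revolutionMap, hs₀m, hρm]
    · rcases hmono with hmono | hmono
      · refine ⟨hleft.comp (BijOn.inter_of_iff hbij fun s hs => ?_),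
          hright.comp (BijOn.inter_of_iff hbij fun s hs => ?_)⟩
        · rw [mem_Iic, mem_Iic, ← hs₀m]
          exact (hmono.le_iff_le hs hs₀).symm
        · rw [mem_Ici, mem_Ici, ← hs₀m]
          exact (hmono.le_iff_le hs₀ hs).symm
      · refine ⟨hright.comp (BijOn.inter_of_iff hbij fun s hs => ?_),
          hleft.comp (BijOn.inter_of_iff hbij fun s hs => ?_)⟩
        · rw [mem_Ici, mem_Iic, ← hs₀m]
          exact (hmono.le_iff_ge hs₀ hs).symm
        · rw [mem_Iic, mem_Ici, ← hs₀m]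
          exact (hmono.le_iff_ge hs hs₀).symm

/-- Each of the two branches determines one constant `c`. They would agree only if `T(r) = ℓ`, which
strict monotonicity up to the endpoint excludes. -/
theorem IsTimeFunction.ncard_gluedMember (hT : IsTimeFunction Φ R I T) (hI : IsOpen I)
    (hIc : I.OrdConnected) (hal : ∀ r ∈ I, Allowed Φ R r) (hbI : b ∈ closure I) (hbn : b ∉ I)
    (hlim : Tendsto T (𝓝[I] b) (𝓝 ℓ)) {x : Fin 3 → ℝ} (hx : x ∈ region I) :
    {c | x ∈ gluedMember I T b ℓ c}.ncard = 2 := by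
  have hpos : ∀ r ∈ I, 0 < 1 / speed Φ R r := fun r hr => one_div_pos.2 (hal r hr).speed_pos
  obtain ⟨-, -, hTm⟩ := strictMonoOn_update_endpoint hI hIc hT hpos hbn hbI hlim
  have hx1 : x 1 ∈ I := hx
  have hxb : x 1 ≠ b := fun h => hbn (h ▸ hx1)
  have hne : T (x 1) ≠ ℓ := by
    intro h
    apply hxb
    apply hTm.injOn (Or.inr hx1) (Or.inl rfl)
    rw [Function.update_self, Function.update_of_ne hxb, h]
  have hset : {c | x ∈ gluedMember I T b ℓ c}
      = {x 0 - T (x 1), x 0 + T (x 1) - 2 * ℓ} := by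
    ext c
    simp only [mem_ofPred_eq, mem_gluedMember_iff, hx1, hxb, true_and, and_false, false_or,
      mem_insert_iff, mem_singleton_iff]
    constructor
    · rintro (h | h)
      · left; linarith
      · right; linarith
    · rintro (h | h)
      · left; linarith
      · right; linarith
  rw [hset, ncard_pair]
  intro h
  apply hne
  linarith

end

/-! ### Comparison with logarithms and square roots -/

theorem tendsto_const_sub_nhdsGT (b : ℝ) :
    Tendsto (fun r => 2 * b - r) (𝓝[>] b) (𝓝[<] b) := by
  refine tendsto_nhdsWithin_iff.2 ⟨?_, ?_⟩
  · have : Tendsto (fun r : ℝ => 2 * b - r) (𝓝 b) (𝓝 (2 * b - b)) :=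
      (continuous_const.sub continuous_id).tendsto b
    rw [show 2 * b - b = b by ring] at this
    exact this.mono_left nhdsWithin_le_nhds
  · filter_upwards [self_mem_nhdsWithin] with r hr
    have : b < r := hr
    exact mem_Iio.2 (by linarith)

/-- The point reflection of the graph preserves slopes, and so reduces limits from the right at `b`
to limits from the left. -/
theorem hasDerivAt_neg_reflect {f : ℝ → ℝ} {d b r : ℝ} (h : HasDerivAt f d (2 * b - r)) :
    HasDerivAt (fun r => -f (2 * b - r)) d r := by
  have h1 : HasDerivAt (fun r => 2 * b - r) (-1) r := (hasDerivAt_id r).const_sub (2 * b)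
  refine (HasDerivAt.comp r h h1).neg.congr_deriv ?_
  ring

/-- The function `f + C log (b - r)` is nondecreasing, so `f` grows at least like `-C log (b - r)`.
-/
theorem tendsto_atTop_of_le_deriv {f f' : ℝ → ℝ} {a b C : ℝ} (hab : a < b)
    (hf : ∀ r ∈ Ioo a b, HasDerivAt f (f' r) r) (hC : 0 < C)
    (hle : ∀ r ∈ Ioo a b, C / (b - r) ≤ f' r) : Tendsto f (𝓝[<] b) atTop := by
  have hd : ∀ r ∈ Ioo a b,
      HasDerivAt (fun r => f r + C * Real.log (b - r)) (f' r - C / (b - r)) r := by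
    intro r hr
    have h1 : HasDerivAt (fun r => b - r) (-1) r := (hasDerivAt_id r).const_sub b
    have h0 : b - r ≠ 0 := (sub_pos.2 hr.2).ne'
    refine ((hf r hr).add ((h1.log h0).const_mul C)).congr_deriv ?_
    field_simp
    ring
  have hm : MonotoneOn (fun r => f r + C * Real.log (b - r)) (Ioo a b) := by
    refine monotoneOn_of_deriv_nonneg (convex_Ioo a b)
      (fun r hr => (hd r hr).continuousAt.continuousWithinAt) ?_ ?_
    · rw [interior_Ioo]
      exact fun r hr => (hd r hr).differentiableAt.differentiableWithinAt
    · rw [interior_Ioo]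
      intro r hr
      rw [(hd r hr).deriv]
      linarith [hle r hr]
  have hmid : (a + b) / 2 ∈ Ioo a b := ⟨by linarith, by linarith⟩
  have hlog : Tendsto (fun r => -(C * Real.log (b - r))) (𝓝[<] b) atTop := by
    refine tendsto_neg_atBot_atTop.comp (Tendsto.const_mul_atBot hC ?_)
    refine Real.tendsto_log_nhdsGT_zero.comp (tendsto_nhdsWithin_iff.2 ⟨?_, ?_⟩)
    · have : Tendsto (fun r : ℝ => b - r) (𝓝 b) (𝓝 (b - b)) :=
        (continuous_const.sub continuous_id).tendsto b
      rw [sub_self] at this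
      exact this.mono_left nhdsWithin_le_nhds
    · filter_upwards [self_mem_nhdsWithin] with r hr using mem_Ioi.2 (sub_pos.2 hr)
  refine tendsto_atTop_mono' _ ?_ (tendsto_atTop_add_const_left _
    (f ((a + b) / 2) + C * Real.log (b - (a + b) / 2)) hlog)
  filter_upwards [Ioo_mem_nhdsLT hmid.2] with r hr
  have := hm hmid ⟨hmid.1.trans hr.1, hr.2⟩ hr.1.le
  simp only at this
  linarith

theorem tendsto_atBot_of_le_deriv {f f' : ℝ → ℝ} {a b C : ℝ} (hab : b < a)
    (hf : ∀ r ∈ Ioo b a, HasDerivAt f (f' r) r) (hC : 0 < C)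
    (hle : ∀ r ∈ Ioo b a, C / (r - b) ≤ f' r) : Tendsto f (𝓝[>] b) atBot := by
  have hmem : ∀ r ∈ Ioo (2 * b - a) b, 2 * b - r ∈ Ioo b a := fun r hr =>
    ⟨by linarith [hr.2], by linarith [hr.1]⟩
  have h := tendsto_atTop_of_le_deriv (f := fun r => -f (2 * b - r)) (f' := fun r => f' (2 * b - r))
    (a := 2 * b - a) (b := b) (by linarith) (fun r hr => hasDerivAt_neg_reflect (hf _ (hmem r hr)))
    hC fun r hr => by
      have := hle _ (hmem r hr)
      rwa [show 2 * b - r - b = b - r by ring] at this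
  have h2 := tendsto_neg_atTop_atBot.comp (h.comp (tendsto_const_sub_nhdsGT b))
  refine h2.congr fun r => ?_
  simp

/-- The function `f + 2C √(b - r)` is nonincreasing, and its second summand is nonnegative. -/
theorem exists_upper_bound_of_deriv_le {f f' : ℝ → ℝ} {a b C : ℝ} (hab : a < b)
    (hf : ∀ r ∈ Ioo a b, HasDerivAt f (f' r) r) (hC : 0 < C)
    (hle : ∀ r ∈ Ioo a b, f' r ≤ C / Real.sqrt (b - r)) :
    ∃ M, ∀ᶠ r in 𝓝[<] b, f r ≤ M := by
  have hd : ∀ r ∈ Ioo a b, HasDerivAt (fun r => f r + 2 * C * Real.sqrt (b - r))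
      (f' r - C / Real.sqrt (b - r)) r := by
    intro r hr
    have h1 : HasDerivAt (fun r => b - r) (-1) r := (hasDerivAt_id r).const_sub b
    have h0 : b - r ≠ 0 := (sub_pos.2 hr.2).ne'
    have hs := (Real.sqrt_pos.2 (sub_pos.2 hr.2)).ne'
    refine ((hf r hr).add ((h1.sqrt h0).const_mul (2 * C))).congr_deriv ?_
    field_simp
    ring
  have hm : AntitoneOn (fun r => f r + 2 * C * Real.sqrt (b - r)) (Ioo a b) := by
    refine antitoneOn_of_deriv_nonpos (convex_Ioo a b)
      (fun r hr => (hd r hr).continuousAt.continuousWithinAt) ?_ ?_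
    · rw [interior_Ioo]
      exact fun r hr => (hd r hr).differentiableAt.differentiableWithinAt
    · rw [interior_Ioo]
      intro r hr
      rw [(hd r hr).deriv]
      linarith [hle r hr]
  have hmid : (a + b) / 2 ∈ Ioo a b := ⟨by linarith, by linarith⟩
  refine ⟨f ((a + b) / 2) + 2 * C * Real.sqrt (b - (a + b) / 2), ?_⟩
  filter_upwards [Ioo_mem_nhdsLT hmid.2] with r hr
  have := hm hmid ⟨hmid.1.trans hr.1, hr.2⟩ hr.1.le
  simp only at this
  have h2 : 0 ≤ 2 * C * Real.sqrt (b - r) := by positivity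
  linarith

theorem exists_lower_bound_of_deriv_le {f f' : ℝ → ℝ} {a b C : ℝ} (hab : b < a)
    (hf : ∀ r ∈ Ioo b a, HasDerivAt f (f' r) r) (hC : 0 < C)
    (hle : ∀ r ∈ Ioo b a, f' r ≤ C / Real.sqrt (r - b)) :
    ∃ M, ∀ᶠ r in 𝓝[>] b, M ≤ f r := by
  have hmem : ∀ r ∈ Ioo (2 * b - a) b, 2 * b - r ∈ Ioo b a := fun r hr =>
    ⟨by linarith [hr.2], by linarith [hr.1]⟩
  obtain ⟨M, hM⟩ := exists_upper_bound_of_deriv_le (f := fun r => -f (2 * b - r))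
    (f' := fun r => f' (2 * b - r)) (a := 2 * b - a) (b := b) (by linarith)
    (fun r hr => hasDerivAt_neg_reflect (hf _ (hmem r hr))) hC fun r hr => by
      have := hle _ (hmem r hr)
      rwa [show 2 * b - r - b = b - r by ring] at this
  refine ⟨-M, ?_⟩
  filter_upwards [(tendsto_const_sub_nhdsGT b).eventually hM] with r hr
  rw [sub_sub_cancel] at hr
  linarith

/-- If `speed² = |r - b| h` with `h(b) > 0` then `1 / speed` has at most an integrable singularity
at `b`. -/
theorem inv_speed_le_of_sq_eq {Φ h : ℝ → ℝ} {R b : ℝ} (hh : ContinuousAt h b) (hb : 0 < h b) :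
    ∃ C > 0, ∃ η > 0, ∀ r, |r - b| < η → r ≠ b → 0 < speed Φ R r →
      speed Φ R r ^ 2 = |r - b| * h r → 1 / speed Φ R r ≤ C / Real.sqrt |r - b| := by
  have hev : ∀ᶠ r in 𝓝 b, h b / 2 < h r := hh.eventually (lt_mem_nhds (by linarith))
  obtain ⟨η, hη, hball⟩ := Metric.eventually_nhds_iff.1 hev
  have hc : 0 < Real.sqrt (h b / 2) := Real.sqrt_pos.2 (by linarith)
  refine ⟨1 / Real.sqrt (h b / 2), one_div_pos.2 hc, η, hη, fun r hr hrb hs hsq => ?_⟩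
  have hpos : 0 < |r - b| := abs_pos.2 (sub_ne_zero.2 hrb)
  have h1 : Real.sqrt |r - b| * Real.sqrt (h b / 2) ≤ speed Φ R r := by
    rw [← Real.sqrt_mul hpos.le]
    apply Real.sqrt_le_iff.2 ⟨hs.le, ?_⟩
    rw [hsq]
    exact mul_le_mul_of_nonneg_left (hball (by rwa [Real.dist_eq])).le hpos.le
  rw [div_div, mul_comm]
  exact one_div_le_one_div_of_le (mul_pos (Real.sqrt_pos.2 hpos) hc) h1

/-- At a simple zero of `speed²` the derivative of `T` is at most of order `(b - r)^{-1/2}`. So `T`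
stays bounded above near `b`, and being monotone it converges. -/
theorem IsTimeFunction.exists_tendsto_left {Φ T h : ℝ → ℝ} {R a b : ℝ} {I : Set ℝ}
    (hT : IsTimeFunction Φ R I T) (hm : MonotoneOn T I) (hab : a < b) (hI : Ioo a b ⊆ I)
    (hIb : ∀ r ∈ I, r < b) (hal : ∀ r ∈ I, Allowed Φ R r) (hh : ContinuousAt h b) (hb : 0 < h b)
    (hsq : ∀ r ∈ I, speed Φ R r ^ 2 = (b - r) * h r) : ∃ ℓ, Tendsto T (𝓝[I] b) (𝓝 ℓ) := by
  obtain ⟨C, hC, η, hη, hle⟩ := inv_speed_le_of_sq_eq (Φ := Φ) (R := R) hh hb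
  have hsub : Ioo (max a (b - η)) b ⊆ I := (Ioo_subset_Ioo_left (le_max_left _ _)).trans hI
  obtain ⟨M, hM⟩ := exists_upper_bound_of_deriv_le (f := T) (f' := fun r => 1 / speed Φ R r)
    (a := max a (b - η)) (b := b) (max_lt hab (by linarith)) (fun r hr => hT r (hsub hr)) hC
    fun r hr => by
      have h1 : |r - b| = b - r := by rw [abs_of_neg (by linarith [hr.2])]; ring
      have h2 := (le_max_right a (b - η)).trans_lt hr.1
      have := hle r (by rw [h1]; linarith) hr.2.ne (hal r (hsub hr)).speed_pos
        (by rw [h1, hsq r (hsub hr)])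
      rwa [h1] at this
  have hmid : (a + b) / 2 ∈ I := hI ⟨by linarith, by linarith⟩
  rcases tendsto_or_tendsto_atTop_of_monotoneOn hm hIb ⟨_, hmid⟩ with h | h
  · exact h
  · exfalso
    have hmono : 𝓝[Ioo a b] b ≤ 𝓝[I] b := nhdsWithin_mono b hI
    rw [nhdsWithin_Ioo_eq_nhdsLT hab] at hmono
    obtain ⟨r, h1, h2⟩ := (((h.mono_left hmono).eventually (eventually_gt_atTop M)).and hM).exists
    linarith

theorem IsTimeFunction.exists_tendsto_right {Φ T h : ℝ → ℝ} {R a b : ℝ} {I : Set ℝ}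
    (hT : IsTimeFunction Φ R I T) (hm : MonotoneOn T I) (hab : b < a) (hI : Ioo b a ⊆ I)
    (hIb : ∀ r ∈ I, b < r) (hal : ∀ r ∈ I, Allowed Φ R r) (hh : ContinuousAt h b) (hb : 0 < h b)
    (hsq : ∀ r ∈ I, speed Φ R r ^ 2 = (r - b) * h r) : ∃ ℓ, Tendsto T (𝓝[I] b) (𝓝 ℓ) := by
  obtain ⟨C, hC, η, hη, hle⟩ := inv_speed_le_of_sq_eq (Φ := Φ) (R := R) hh hb
  have hsub : Ioo b (min a (b + η)) ⊆ I := (Ioo_subset_Ioo_right (min_le_left _ _)).trans hI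
  obtain ⟨M, hM⟩ := exists_lower_bound_of_deriv_le (f := T) (f' := fun r => 1 / speed Φ R r)
    (a := min a (b + η)) (b := b) (lt_min hab (by linarith)) (fun r hr => hT r (hsub hr)) hC
    fun r hr => by
      have h1 : |r - b| = r - b := abs_of_pos (by linarith [hr.1])
      have h2 := hr.2.trans_le (min_le_right a (b + η))
      have := hle r (by rw [h1]; linarith) hr.1.ne' (hal r (hsub hr)).speed_pos
        (by rw [h1, hsq r (hsub hr)])
      rwa [h1] at this
  have hmid : (a + b) / 2 ∈ I := hI ⟨by linarith, by linarith⟩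
  rcases tendsto_or_tendsto_atBot_of_monotoneOn hm hIb ⟨_, hmid⟩ with h | h
  · exact h
  · exfalso
    have hmono : 𝓝[Ioo b a] b ≤ 𝓝[I] b := nhdsWithin_mono b hI
    rw [nhdsWithin_Ioo_eq_nhdsGT hab] at hmono
    obtain ⟨r, h1, h2⟩ := (((h.mono_left hmono).eventually (eventually_lt_atBot M)).and hM).exists
    linarith

/-! ### Reissner–Nordström -/

section

variable {Φ F : ℝ → ℝ} {J : Set ℝ}

theorem sphericalMetric_of_exp_eq {x : Fin 3 → ℝ} (h : Real.exp (2 * Φ (x 1)) = F (x 1)) :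
    sphericalMetric Φ x = Matrix.diagonal ![-F (x 1), (F (x 1))⁻¹, (x 1) ^ 2] := by
  rw [sphericalMetric, Real.exp_neg, h]

theorem mul_exp_neg_of_exp_eq {r : ℝ} (h : Real.exp (2 * Φ r) = F r) :
    r ^ 2 * Real.exp (-(2 * Φ r)) = r ^ 2 / F r := by
  rw [Real.exp_neg, h, div_eq_mul_inv]

theorem ansatzLightlikeGeodesic_iff_of_exp_eq {A X : ℝ → ℝ} (hJ : IsOpen J)
    (hJc : J.OrdConnected) (hJ0 : J ⊆ Ioi 0) (hΦ : ContDiffOn ℝ ∞ Φ J)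
    (hF : ∀ r ∈ J, Real.exp (2 * Φ r) = F r) (hA : ContDiffOn ℝ 1 A J)
    (hX : ContDiffOn ℝ 1 X J) :
    AnsatzLightlikeGeodesic Φ A X J ↔
      ∃ R : ℝ, R ≠ 0 ∧ ∀ r ∈ J, A r = r / (R * F r) ∧ X r ^ 2 = F r * (F r - (A r ^ 2)⁻¹) := by
  rw [ansatzLightlikeGeodesic_iff hJ hJc hJ0 (hΦ.differentiableOn (by simp))
    (hA.differentiableOn (by simp)) (hX.differentiableOn (by simp))]
  refine exists_congr fun R => and_congr_right fun _ => forall₂_congr fun r hr => ?_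
  rw [Real.exp_neg, hF r hr, ← div_eq_mul_inv, div_div]

end

theorem exp_two_mul_reissnerPhi {M Q r : ℝ} (h : 0 < reissnerF M Q r) :
    Real.exp (2 * reissnerPhi M Q r) = reissnerF M Q r := by
  rw [reissnerPhi, ← mul_assoc, mul_one_div_cancel two_ne_zero, one_mul, Real.exp_log h]

theorem contDiffOn_reissnerPhi {M Q : ℝ} {J : Set ℝ} (hJ0 : J ⊆ Ioi 0)
    (h : ∀ r ∈ J, 0 < reissnerF M Q r) : ContDiffOn ℝ ∞ (reissnerPhi M Q) J := by
  have hr : ∀ r ∈ J, r ≠ 0 := fun r hr => (hJ0 hr).ne'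
  have hF : ContDiffOn ℝ ∞ (reissnerF M Q) J :=
    (contDiffOn_const.sub (contDiffOn_const.div contDiffOn_id hr)).add
      (contDiffOn_const.div (contDiffOn_id.pow 2) fun r hr' => pow_ne_zero 2 (hr r hr'))
  exact contDiffOn_const.mul (hF.log fun r hr => (h r hr).ne')

/-! ### Schwarzschild -/

theorem schwarzschildF_eq (M : ℝ) : schwarzschildF M = reissnerF M 0 := by
  funext r
  simp [schwarzschildF, reissnerF]

theorem schwarzschildPhi_eq (M : ℝ) : schwarzschildPhi M = reissnerPhi M 0 := by
  funext r
  simp [schwarzschildPhi, reissnerPhi, schwarzschildF_eq]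

section

variable {M R r : ℝ}

theorem Ioi_two_mul_subset (hM : 0 < M) : Ioi (2 * M) ⊆ Ioi (0 : ℝ) :=
  Ioi_subset_Ioi (by linarith)

theorem schwarzschildF_pos (hM : 0 < M) (hr : 2 * M < r) : 0 < schwarzschildF M r := by
  have : 0 < r := by linarith
  rw [schwarzschildF, sub_pos, div_lt_one this]
  exact hr

theorem exp_two_mul_schwarzschildPhi (hM : 0 < M) (hr : 2 * M < r) :
    Real.exp (2 * schwarzschildPhi M r) = schwarzschildF M r := by
  have := schwarzschildF_pos hM hr
  rw [schwarzschildF_eq] at this ⊢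
  rw [schwarzschildPhi_eq, exp_two_mul_reissnerPhi this]

theorem contDiffOn_schwarzschildPhi (hM : 0 < M) :
    ContDiffOn ℝ ∞ (schwarzschildPhi M) (Ioi (2 * M)) := by
  rw [schwarzschildPhi_eq]
  refine contDiffOn_reissnerPhi (Ioi_two_mul_subset hM) fun r hr => ?_
  rw [← schwarzschildF_eq]
  exact schwarzschildF_pos hM hr

theorem schwarzschild_threshold (hM : 0 < M) (hr : 2 * M < r) :
    r ^ 2 * Real.exp (-(2 * schwarzschildPhi M r)) = r ^ 3 / (r - 2 * M) := by
  rw [mul_exp_neg_of_exp_eq (exp_two_mul_schwarzschildPhi hM hr), schwarzschildF]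
  have : r ≠ 0 := by linarith
  have : r - 2 * M ≠ 0 := by linarith
  field_simp

/-- Outside the horizon the factor `r - 2M` may be cleared. The zeros of the resulting cubic decide
between the three cases for `R`. -/
theorem allowed_schwarzschild_iff (hM : 0 < M) (hr : 2 * M < r) :
    Allowed (schwarzschildPhi M) R r ↔ 0 < r ^ 3 - R ^ 2 * (r - 2 * M) := by
  rw [Allowed, schwarzschild_threshold hM hr, lt_div_iff₀ (by linarith), sub_pos]

theorem eq_threshold_schwarzschild_iff (hM : 0 < M) (hr : 2 * M < r) :
    R ^ 2 = r ^ 2 * Real.exp (-(2 * schwarzschildPhi M r)) ↔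
      r ^ 3 - R ^ 2 * (r - 2 * M) = 0 := by
  rw [schwarzschild_threshold hM hr, eq_div_iff (by linarith), sub_eq_zero, eq_comm]

theorem radialPotential_schwarzschild (hM : 0 < M) (hr : 2 * M < r) :
    radialPotential (schwarzschildPhi M) R r
      = schwarzschildF M r ^ 2 * ((r ^ 3 - R ^ 2 * (r - 2 * M)) / r ^ 3) := by
  rw [radialPotential, exp_two_mul_schwarzschildPhi hM hr]
  have h0 : r ≠ 0 := by linarith
  congr 1
  rw [schwarzschildF]
  field_simp

/-- The double root explains the value `√27 M`: it is where the two positive roots merge, at `r =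
3M`. -/
theorem cubic_critical (M r : ℝ) :
    r ^ 3 - (Real.sqrt 27 * M) ^ 2 * (r - 2 * M) = (r - 3 * M) ^ 2 * (r + 6 * M) := by
  rw [mul_pow, Real.sq_sqrt (by norm_num)]
  ring

/-- For `r > 2M` the cubic decreases in `R²`, and at the critical value it is still nonnegative. -/
theorem allowed_schwarzschild_of_lt (hM : 0 < M) (hR : 0 < R) (hR' : R < Real.sqrt 27 * M)
    (hr : 2 * M < r) : Allowed (schwarzschildPhi M) R r := by
  rw [allowed_schwarzschild_iff hM hr]
  have h1 := cubic_critical M r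
  have h2 : R ^ 2 < (Real.sqrt 27 * M) ^ 2 := by gcongr
  have h3 : 0 ≤ (r - 3 * M) ^ 2 * (r + 6 * M) := mul_nonneg (sq_nonneg _) (by linarith)
  have h4 := mul_lt_mul_of_pos_right h2 (show 0 < r - 2 * M by linarith)
  linarith

/-! ### The critical impact parameter and the photon sphere -/

theorem allowed_schwarzschild_critical_iff (hM : 0 < M) (hr : 2 * M < r) :
    Allowed (schwarzschildPhi M) (Real.sqrt 27 * M) r ↔ r ≠ 3 * M := by
  rw [allowed_schwarzschild_iff hM hr, cubic_critical]
  constructor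
  · rintro h rfl
    simp at h
  · intro h
    have h1 : r - 3 * M ≠ 0 := sub_ne_zero.2 h
    have h2 : 0 < r + 6 * M := by linarith
    positivity

/-- The smooth solution `X` for the critical impact parameter. -/
noncomputable def criticalSpeed (M r : ℝ) : ℝ :=
  schwarzschildF M r * (r - 3 * M) * Real.sqrt ((r + 6 * M) / r ^ 3)

theorem contDiffOn_criticalSpeed (hM : 0 < M) :
    ContDiffOn ℝ ∞ (criticalSpeed M) (Ioi (2 * M)) := by
  have hr : ∀ r ∈ Ioi (2 * M), r ≠ 0 := fun r hr => (Ioi_two_mul_subset hM hr).ne'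
  have hF : ContDiffOn ℝ ∞ (schwarzschildF M) (Ioi (2 * M)) :=
    contDiffOn_const.sub (contDiffOn_const.div contDiffOn_id hr)
  refine (hF.mul (contDiffOn_id.sub contDiffOn_const)).mul (ContDiffOn.sqrt
    ((contDiffOn_id.add contDiffOn_const).div (contDiffOn_id.pow 3)
      fun r hr' => pow_ne_zero 3 (hr r hr')) fun r hr' => ?_)
  have h1 : 2 * M < r := hr'
  have h2 : 0 < r := by linarith
  exact (div_pos (by linarith) (pow_pos h2 3)).ne'

theorem criticalSpeed_sq (hM : 0 < M) (hr : 2 * M < r) :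
    criticalSpeed M r ^ 2 = radialPotential (schwarzschildPhi M) (Real.sqrt 27 * M) r := by
  have h2 : 0 < r := by linarith
  have h3 : 0 ≤ (r + 6 * M) / r ^ 3 := div_nonneg (by linarith) (pow_pos h2 3).le
  rw [radialPotential_schwarzschild hM hr, cubic_critical, criticalSpeed, mul_pow,
    Real.sq_sqrt h3]
  ring

theorem abs_criticalSpeed (hM : 0 < M) (hr : 2 * M < r) :
    |criticalSpeed M r| = speed (schwarzschildPhi M) (Real.sqrt 27 * M) r := by
  have h0 : 0 ≤ speed (schwarzschildPhi M) (Real.sqrt 27 * M) r :=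
    mul_nonneg (Real.exp_pos _).le (Real.sqrt_nonneg _)
  rw [← abs_of_nonneg h0, ← sq_eq_sq_iff_abs_eq_abs, criticalSpeed_sq hM hr]
  refine (speed_sq_of_le (by linarith) ?_).symm
  rcases eq_or_ne r (3 * M) with h | h
  · apply le_of_eq
    rw [eq_threshold_schwarzschild_iff hM hr, cubic_critical, h]
    ring
  · exact ((allowed_schwarzschild_critical_iff hM hr).2 h).le

theorem criticalSpeed_of_lt (hM : 0 < M) (hr : 2 * M < r) (h : r < 3 * M) :
    criticalSpeed M r = -speed (schwarzschildPhi M) (Real.sqrt 27 * M) r := by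
  rw [← abs_criticalSpeed hM hr, abs_of_nonpos, neg_neg]
  exact mul_nonpos_of_nonpos_of_nonneg (mul_nonpos_of_nonneg_of_nonpos
    (schwarzschildF_pos hM hr).le (by linarith)) (Real.sqrt_nonneg _)

theorem criticalSpeed_of_gt (hM : 0 < M) (h : 3 * M < r) :
    criticalSpeed M r = speed (schwarzschildPhi M) (Real.sqrt 27 * M) r := by
  have hr : 2 * M < r := by linarith
  rw [← abs_criticalSpeed hM hr, abs_of_nonneg]
  exact mul_nonneg (mul_nonneg (schwarzschildF_pos hM hr).le (by linarith)) (Real.sqrt_nonneg _)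

/-- The double root makes the speed vanish at least linearly at `3M`, so `1 / speed` is not
integrable there. The constant comes from `F ≤ 1` and `(r + 6M) / r³ ≤ 1 / M²`. -/
theorem speed_critical_le (hM : 0 < M) (hr : 2 * M < r) :
    speed (schwarzschildPhi M) (Real.sqrt 27 * M) r ≤ |r - 3 * M| / M := by
  have h2 : 0 < r := by linarith
  have hF := schwarzschildF_pos hM hr
  have hF1 : schwarzschildF M r ≤ 1 := by
    rw [schwarzschildF]
    have : 0 ≤ 2 * M / r := by positivity
    linarith
  have hq : (r + 6 * M) / r ^ 3 ≤ (1 / M) ^ 2 := by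
    rw [div_pow, one_pow, div_le_div_iff₀ (pow_pos h2 3) (pow_pos hM 2)]
    -- Repeated use of `M ≤ r / 2` gives `M² r + 6 M³ ≤ r³ / 4 + 6 r³ / 8 = r³`.
    have h4 : M * r ^ 2 ≤ r ^ 3 / 2 := by nlinarith [sq_nonneg r, pow_pos h2 2]
    have h5 : M ^ 2 * r ≤ M * r ^ 2 / 2 := by nlinarith [mul_pos hM h2]
    have h6 : M ^ 3 ≤ M ^ 2 * r / 2 := by nlinarith [pow_pos hM 2]
    nlinarith
  have hs : Real.sqrt ((r + 6 * M) / r ^ 3) ≤ 1 / M := by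
    rw [← Real.sqrt_sq (one_div_pos.2 hM).le]
    exact Real.sqrt_le_sqrt hq
  rw [← abs_criticalSpeed hM hr, criticalSpeed, abs_mul, abs_mul, abs_of_pos hF,
    abs_of_nonneg (Real.sqrt_nonneg _)]
  calc schwarzschildF M r * |r - 3 * M| * Real.sqrt ((r + 6 * M) / r ^ 3)
      ≤ 1 * |r - 3 * M| * (1 / M) := by gcongr
    _ = |r - 3 * M| / M := by ring

theorem le_inv_speed_critical (hM : 0 < M) (hr : 2 * M < r) (h : r ≠ 3 * M) :
    M / |r - 3 * M| ≤ 1 / speed (schwarzschildPhi M) (Real.sqrt 27 * M) r := by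
  have h1 := ((allowed_schwarzschild_critical_iff hM hr).2 h).speed_pos
  have h2 := one_div_le_one_div_of_le h1 (speed_critical_le hM hr)
  rwa [one_div_div] at h2

theorem tendsto_time_critical_left {T : ℝ → ℝ} (hM : 0 < M)
    (hT : IsTimeFunction (schwarzschildPhi M) (Real.sqrt 27 * M) (Ioo (2 * M) (3 * M)) T) :
    Tendsto T (𝓝[<] (3 * M)) atTop := by
  refine tendsto_atTop_of_le_deriv (a := 2 * M) (by linarith) hT hM fun r hr => ?_
  have := le_inv_speed_critical hM hr.1 hr.2.ne
  rwa [abs_of_neg (by linarith [hr.2]), neg_sub] at this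

theorem tendsto_time_critical_right {T : ℝ → ℝ} (hM : 0 < M)
    (hT : IsTimeFunction (schwarzschildPhi M) (Real.sqrt 27 * M) (Ioi (3 * M)) T) :
    Tendsto T (𝓝[>] (3 * M)) atBot := by
  -- Any endpoint beyond `3M` would serve, as only radii close to `3M` matter.
  refine tendsto_atBot_of_le_deriv (a := 4 * M) (by linarith) (fun r hr => hT r hr.1) hM
    fun r hr => ?_
  have h1 := hr.1
  have := le_inv_speed_critical (r := r) hM (by linarith) hr.1.ne'
  rwa [abs_of_pos (by linarith)] at this

/-- Because `X(3M) = 0`, the fields `L^±` are tangent to `r = 3M`, whatever signs `X` has on the two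
sides. -/
theorem isTimelikePhotonSet_photonSphere (hM : 0 < M) {X : ℝ → ℝ}
    (hX : ContDiffOn ℝ 1 X (Ioi (2 * M)))
    (hXsq : ∀ r ∈ Ioi (2 * M),
      X r ^ 2 = radialPotential (schwarzschildPhi M) (Real.sqrt 27 * M) r)
    (hX3 : X (3 * M) = 0) :
    IsTimelikePhotonSet (sphericalMetric (schwarzschildPhi M)) (region (Ioi (2 * M)))
      {x | x 1 = 3 * M}
      (IsIntegralSurface (ansatz (coeffA (schwarzschildPhi M) (Real.sqrt 27 * M)) X 1)
        (ansatz (coeffA (schwarzschildPhi M) (Real.sqrt 27 * M)) X (-1))) := by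
  have hR : Real.sqrt 27 * M ≠ 0 := by positivity
  have h := isTimelikePhotonSet_of_revolutionMap (a := id) (b := fun _ => 3 * M) (E := univ)
    (a' := fun _ => 1) (b' := fun _ => 0)
    (k := fun _ => coeffA (schwarzschildPhi M) (Real.sqrt 27 * M) (3 * M)) isOpen_Ioi
    (Ioi_two_mul_subset hM) (contDiffOn_schwarzschildPhi hM) hR hX hXsq isOpen_univ
    isConnected_univ contDiffOn_id contDiffOn_const (fun t _ => hasDerivAt_id t)
    (fun t _ => hasDerivAt_const t _) (fun _ _ => Or.inl one_ne_zero)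
    (fun _ _ => mem_Ioi.2 (by linarith)) (fun t _ u _ h => congrArg Prod.fst h)
    (fun _ _ => coeffA_ne_zero (by positivity) hR) (fun _ _ => by ring)
    (fun _ _ => by rw [hX3])
  convert h using 1
  ext x
  constructor
  · intro hx
    refine ⟨(x 0, x 2), by simp, ?_⟩
    have hx' : x 1 = 3 * M := hx
    funext i
    fin_cases i
    · simp [revolutionMap]
    · simp [revolutionMap, hx']
    · simp [revolutionMap]
  · rintro ⟨p, -, rfl⟩
    simp [revolutionMap]

theorem sUnion_critical_family (hM : 0 < M) (T₁ T₂ : ℝ → ℝ) (σ₁ σ₂ : ℝ) :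
    ⋃₀ ({{x | x 1 = 3 * M}} ∪ range (member (Ioo (2 * M) (3 * M)) T₁ σ₁)
      ∪ range (member (Ioi (3 * M)) T₂ σ₂)) = region (Ioi (2 * M)) := by
  rw [sUnion_union, sUnion_union, sUnion_singleton, sUnion_range_member, sUnion_range_member]
  ext x
  simp only [region, mem_union, mem_ofPred_eq, mem_Ioo, mem_Ioi]
  constructor
  · rintro ((h | h) | h)
    · linarith
    · exact h.1
    · linarith
  · intro h
    rcases lt_trichotomy (x 1) (3 * M) with h' | h' | h'
    · exact Or.inl (Or.inr ⟨h, h'⟩)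
    · exact Or.inl (Or.inl h')
    · exact Or.inr h'

theorem pairwiseDisjoint_critical_family (M : ℝ) (T₁ T₂ : ℝ → ℝ) (σ₁ σ₂ : ℝ) :
    (({{x | x 1 = 3 * M}} ∪ range (member (Ioo (2 * M) (3 * M)) T₁ σ₁)
      ∪ range (member (Ioi (3 * M)) T₂ σ₂) : Set (Set (Fin 3 → ℝ)))).PairwiseDisjoint id := by
  rw [pairwiseDisjoint_union, pairwiseDisjoint_union]
  refine ⟨⟨pairwiseDisjoint_singleton _ _, pairwiseDisjoint_range_member _ _ _, ?_⟩,
    pairwiseDisjoint_range_member _ _ _, ?_⟩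
  · rintro _ rfl _ ⟨c, rfl⟩ -
    refine disjoint_left.2 fun x hx hx' => ?_
    have h1 : x 1 = 3 * M := hx
    exact (mem_member_iff.1 hx').1.2.ne h1
  · rintro _ (rfl | ⟨c, rfl⟩) _ ⟨d, rfl⟩ -
    · refine disjoint_left.2 fun x hx hx' => ?_
      have h1 : x 1 = 3 * M := hx
      exact (mem_Ioi.1 (mem_member_iff.1 hx').1).ne' h1
    · refine disjoint_left.2 fun x hx hx' => ?_
      exact lt_asymm (mem_member_iff.1 hx).1.2 (mem_Ioi.1 (mem_member_iff.1 hx').1)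

/-- Each leaf is a photon surface within its own region, so no compatibility of the signs across `r
= 3M` is needed. -/
theorem isPhotonDecomposition_critical (hM : 0 < M) {T₁ T₂ : ℝ → ℝ}
    (hT₁ : IsTimeFunction (schwarzschildPhi M) (Real.sqrt 27 * M) (Ioo (2 * M) (3 * M)) T₁)
    (hT₂ : IsTimeFunction (schwarzschildPhi M) (Real.sqrt 27 * M) (Ioi (3 * M)) T₂)
    {σ₁ σ₂ : ℝ} (hσ₁ : σ₁ = 1 ∨ σ₁ = -1) (hσ₂ : σ₂ = 1 ∨ σ₂ = -1) :
    IsPhotonDecomposition (sphericalMetric (schwarzschildPhi M)) (region (Ioi (2 * M)))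
      ({{x | x 1 = 3 * M}} ∪ range (member (Ioo (2 * M) (3 * M)) T₁ σ₁)
        ∪ range (member (Ioi (3 * M)) T₂ σ₂)) where
  cover := sUnion_critical_family hM T₁ T₂ σ₁ σ₂
  disjoint := pairwiseDisjoint_critical_family M T₁ T₂ σ₁ σ₂
  leaf := by
    have hR : Real.sqrt 27 * M ≠ 0 := by positivity
    have hΦ := contDiffOn_schwarzschildPhi hM
    have hs1 : Ioo (2 * M) (3 * M) ⊆ Ioi (2 * M) := Ioo_subset_Ioi_self
    have hs2 : Ioi (3 * M) ⊆ Ioi (2 * M) := Ioi_subset_Ioi (by linarith)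
    rintro S ((hS | hS) | hS)
    · rw [mem_singleton_iff.1 hS]
      refine (isTimelikePhotonSet_photonSphere hM
        ((contDiffOn_criticalSpeed hM).of_le (by norm_cast))
        (fun r hr => criticalSpeed_sq hM hr) ?_).mono Subset.rfl fun _ _ _ => trivial
      simp [criticalSpeed]
    · refine ((isPhotonFoliation_member isOpen_Ioo (isConnected_Ioo (by linarith))
        (hs1.trans (Ioi_two_mul_subset hM)) (hΦ.mono hs1) hR
        (fun r hr => (allowed_schwarzschild_critical_iff hM hr.1).2 hr.2.ne) hT₁ hσ₁).leaf S
        hS).mono (fun x hx => hs1 hx) fun _ _ _ => trivial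
    · refine ((isPhotonFoliation_member isOpen_Ioi isConnected_Ioi
        (hs2.trans (Ioi_two_mul_subset hM)) (hΦ.mono hs2) hR
        (fun r hr => (allowed_schwarzschild_critical_iff hM (hs2 hr)).2 (mem_Ioi.1 hr).ne') hT₂
        hσ₂).leaf S hS).mono (fun x hx => hs2 hx) fun _ _ _ => trivial

/-- For opposite signs `X` is `σ` times `criticalSpeed`, whose factor `r - 3M` supplies the change
of sign; hence `X` is smooth across the photon sphere. -/
theorem isPhotonFoliation_critical (hM : 0 < M) {T₁ T₂ : ℝ → ℝ}
    (hT₁ : IsTimeFunction (schwarzschildPhi M) (Real.sqrt 27 * M) (Ioo (2 * M) (3 * M)) T₁)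
    (hT₂ : IsTimeFunction (schwarzschildPhi M) (Real.sqrt 27 * M) (Ioi (3 * M)) T₂)
    {σ : ℝ} (hσ : σ = 1 ∨ σ = -1) {X : ℝ → ℝ}
    (h1 : ∀ r ∈ Ioo (2 * M) (3 * M),
      X r = -σ * speed (schwarzschildPhi M) (Real.sqrt 27 * M) r)
    (h3 : X (3 * M) = 0)
    (h2 : ∀ r ∈ Ioi (3 * M), X r = σ * speed (schwarzschildPhi M) (Real.sqrt 27 * M) r) :
    IsPhotonFoliation (sphericalMetric (schwarzschildPhi M)) (region (Ioi (2 * M)))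
      (ansatz (coeffA (schwarzschildPhi M) (Real.sqrt 27 * M)) X 1)
      (ansatz (coeffA (schwarzschildPhi M) (Real.sqrt 27 * M)) X (-1))
      ({{x | x 1 = 3 * M}} ∪ range (member (Ioo (2 * M) (3 * M)) T₁ (-σ))
        ∪ range (member (Ioi (3 * M)) T₂ σ)) := by
  have hR : Real.sqrt 27 * M ≠ 0 := by positivity
  have hΦ := contDiffOn_schwarzschildPhi hM
  have hs1 : Ioo (2 * M) (3 * M) ⊆ Ioi (2 * M) := Ioo_subset_Ioi_self
  have hs2 : Ioi (3 * M) ⊆ Ioi (2 * M) := Ioi_subset_Ioi (by linarith)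
  have hXc : ∀ r ∈ Ioi (2 * M), X r = σ * criticalSpeed M r := by
    intro r hr
    rcases lt_trichotomy r (3 * M) with h | h | h
    · rw [h1 r ⟨hr, h⟩, criticalSpeed_of_lt hM hr h]; ring
    · rw [h, h3]; simp [criticalSpeed]
    · rw [h2 r h, criticalSpeed_of_gt hM h]
  have hσ2 : σ ^ 2 = 1 := by rcases hσ with h | h <;> simp [h]
  have hX : ContDiffOn ℝ ∞ X (Ioi (2 * M)) :=
    (contDiffOn_const.mul (contDiffOn_criticalSpeed hM)).congr hXc
  have hX1 : ContDiffOn ℝ 1 X (Ioi (2 * M)) := hX.of_le (by norm_cast)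
  have hXsq : ∀ r ∈ Ioi (2 * M),
      X r ^ 2 = radialPotential (schwarzschildPhi M) (Real.sqrt 27 * M) r := fun r hr => by
    rw [hXc r hr, mul_pow, hσ2, one_mul, criticalSpeed_sq hM hr]
  refine isPhotonFoliation_ansatz isOpen_Ioi (Ioi_two_mul_subset hM) hΦ hR hX
    (sUnion_critical_family hM _ _ _ _) (pairwiseDisjoint_critical_family M _ _ _ _) ?_
  rintro S ((hS | ⟨c, rfl⟩) | ⟨c, rfl⟩)
  · rw [mem_singleton_iff.1 hS]
    exact isTimelikePhotonSet_photonSphere hM hX1 hXsq h3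
  · refine isTimelikePhotonSet_member isOpen_Ioi (Ioi_two_mul_subset hM) hΦ hR hX1 hXsq isOpen_Ioo
      (isConnected_Ioo (by linarith)) hs1
      (fun r hr => (allowed_schwarzschild_critical_iff hM hr.1).2 hr.2.ne) hT₁ ?_ h1 c
    rcases hσ with h | h <;> simp [h]
  · exact isTimelikePhotonSet_member isOpen_Ioi (Ioi_two_mul_subset hM) hΦ hR hX1 hXsq isOpen_Ioi
      isConnected_Ioi hs2
      (fun r hr => (allowed_schwarzschild_critical_iff hM (hs2 hr)).2 (mem_Ioi.1 hr).ne') hT₂ hσ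
      h2 c

/-! ### Turning radii above the critical impact parameter -/

/-- Above the critical value of `R` there are two radii where `r³ = R² (r - 2M)`. -/
theorem exists_turning_radii (hM : 0 < M) (hR : Real.sqrt 27 * M < R) :
    ∃ r₁ r₂ : ℝ, 2 * M < r₁ ∧ r₁ < 3 * M ∧ 3 * M < r₂ ∧
      ∀ r, r ^ 3 - R ^ 2 * (r - 2 * M) = (r - r₁) * (r - r₂) * (r + r₁ + r₂) := by
  have hR0 : 0 < R := lt_trans (by positivity) hR
  have hR2 : 27 * M ^ 2 < R ^ 2 := by
    have h : (Real.sqrt 27 * M) ^ 2 < R ^ 2 := by gcongr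
    rwa [mul_pow, Real.sq_sqrt (by norm_num)] at h
  let p : ℝ → ℝ := fun r => r ^ 3 - R ^ 2 * (r - 2 * M)
  have hpc : Continuous p := by fun_prop
  have h2 : 0 < p (2 * M) := by
    have : p (2 * M) = 8 * M ^ 3 := by simp only [p]; ring
    rw [this]
    positivity
  have h3 : p (3 * M) < 0 := by
    have : p (3 * M) = (27 * M ^ 2 - R ^ 2) * M := by simp only [p]; ring
    rw [this]
    exact mul_neg_of_neg_of_pos (by linarith) hM
  have h4 : 0 < p (R + 3 * M) := by
    have : p (R + 3 * M) = 8 * R ^ 2 * M + 27 * R * M ^ 2 + 27 * M ^ 3 := by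
      simp only [p]; ring
    rw [this]
    positivity
  obtain ⟨r₁, hr₁, e₁⟩ := intermediate_value_Ioo' (by linarith : 2 * M ≤ 3 * M) hpc.continuousOn
    (show (0 : ℝ) ∈ Ioo (p (3 * M)) (p (2 * M)) from ⟨h3, h2⟩)
  obtain ⟨r₂, hr₂, e₂⟩ := intermediate_value_Ioo (by linarith : 3 * M ≤ R + 3 * M)
    hpc.continuousOn (show (0 : ℝ) ∈ Ioo (p (3 * M)) (p (R + 3 * M)) from ⟨h3, h4⟩)
  refine ⟨r₁, r₂, hr₁.1, hr₁.2, hr₂.1, fun r => ?_⟩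
  have hne : r₂ - r₁ ≠ 0 := by linarith [hr₁.2, hr₂.1]
  simp only [p] at e₁ e₂
  -- The difference of the two root equations, divided by `r₂ - r₁`. The third root is `-(r₁ + r₂)`,
  -- since the cubic has no quadratic term.
  have e : r₂ ^ 2 + r₁ * r₂ + r₁ ^ 2 = R ^ 2 := by
    apply mul_left_cancel₀ hne
    linear_combination e₂ - e₁
  linear_combination e₁ + (r - r₁) * e

theorem continuousAt_schwarzschildF (hr : r ≠ 0) : ContinuousAt (schwarzschildF M) r :=
  continuousAt_const.sub (continuousAt_const.div continuousAt_id hr)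

theorem exists_tendsto_time_inner {T : ℝ → ℝ} {r₁ r₂ : ℝ} (hM : 0 < M) (h1 : 2 * M < r₁)
    (h12 : r₁ < r₂)
    (hp : ∀ r, r ^ 3 - R ^ 2 * (r - 2 * M) = (r - r₁) * (r - r₂) * (r + r₁ + r₂))
    (hal : ∀ r ∈ Ioo (2 * M) r₁, Allowed (schwarzschildPhi M) R r)
    (hT : IsTimeFunction (schwarzschildPhi M) R (Ioo (2 * M) r₁) T) :
    ∃ ℓ, Tendsto T (𝓝[Ioo (2 * M) r₁] r₁) (𝓝 ℓ) := by
  have hpos : 0 < r₁ := by linarith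
  -- Here `h` is the cofactor of `r₁ - r` in `speed²`; it is positive at `r₁` because the root is
  -- simple.
  refine hT.exists_tendsto_left
    (h := fun r => schwarzschildF M r ^ 2 * ((r₂ - r) * (r + r₁ + r₂) / r ^ 3))
    (hT.strictMonoOn isOpen_Ioo ordConnected_Ioo hal).monotoneOn h1 Subset.rfl
    (fun r hr => hr.2) hal ?_ ?_ fun r hr => ?_
  · refine ((continuousAt_schwarzschildF hpos.ne').pow 2).mul (ContinuousAt.div ?_ ?_ ?_)
    · fun_prop
    · fun_prop
    · positivity
  · have hF := schwarzschildF_pos hM h1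
    have h3 : 0 < (r₂ - r₁) * (r₁ + r₁ + r₂) := mul_pos (by linarith) (by linarith)
    positivity
  · rw [(hal r hr).speed_sq, radialPotential_schwarzschild hM hr.1, hp]
    ring

theorem exists_tendsto_time_outer {T : ℝ → ℝ} {r₁ r₂ : ℝ} (hM : 0 < M) (h1 : 2 * M < r₁)
    (h12 : r₁ < r₂)
    (hp : ∀ r, r ^ 3 - R ^ 2 * (r - 2 * M) = (r - r₁) * (r - r₂) * (r + r₁ + r₂))
    (hal : ∀ r ∈ Ioi r₂, Allowed (schwarzschildPhi M) R r)
    (hT : IsTimeFunction (schwarzschildPhi M) R (Ioi r₂) T) :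
    ∃ ℓ, Tendsto T (𝓝[Ioi r₂] r₂) (𝓝 ℓ) := by
  have hpos : 0 < r₂ := by linarith
  refine hT.exists_tendsto_right (a := r₂ + 1)
    (h := fun r => schwarzschildF M r ^ 2 * ((r - r₁) * (r + r₁ + r₂) / r ^ 3))
    (hT.strictMonoOn isOpen_Ioi ordConnected_Ioi hal).monotoneOn (by linarith) Ioo_subset_Ioi_self
    (fun r hr => hr) hal ?_ ?_ fun r hr => ?_
  · refine ((continuousAt_schwarzschildF hpos.ne').pow 2).mul (ContinuousAt.div ?_ ?_ ?_)
    · fun_prop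
    · fun_prop
    · positivity
  · have hF := schwarzschildF_pos hM (h1.trans h12)
    have h3 : 0 < (r₂ - r₁) * (r₂ + r₁ + r₂) := mul_pos (by linarith) (by linarith)
    positivity
  · have hr' : r₂ < r := hr
    rw [(hal r hr).speed_sq, radialPotential_schwarzschild hM (by linarith), hp]
    ring

theorem setOf_allowed_schwarzschild {r₁ r₂ : ℝ} (hM : 0 < M) (h1 : 2 * M < r₁) (h12 : r₁ < r₂)
    (hp : ∀ r, r ^ 3 - R ^ 2 * (r - 2 * M) = (r - r₁) * (r - r₂) * (r + r₁ + r₂)) :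
    {r ∈ Ioi (2 * M) | Allowed (schwarzschildPhi M) R r} = Ioo (2 * M) r₁ ∪ Ioi r₂ := by
  ext r
  constructor
  · rintro ⟨hr, h⟩
    have hr' : 2 * M < r := hr
    rw [allowed_schwarzschild_iff hM hr, hp] at h
    have h3 := pos_of_mul_pos_left h (by linarith)
    rcases lt_or_ge r r₁ with h4 | h4
    · exact Or.inl ⟨hr, h4⟩
    · refine Or.inr (mem_Ioi.2 (not_le.1 fun h5 => ?_))
      exact absurd h3 (not_lt.2 (mul_nonpos_of_nonneg_of_nonpos (by linarith) (by linarith)))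
  · rintro (⟨hr, h⟩ | h)
    · refine ⟨hr, (allowed_schwarzschild_iff hM hr).2 ?_⟩
      rw [hp]
      exact mul_pos (mul_pos_of_neg_of_neg (by linarith) (by linarith)) (by linarith)
    · have h' : r₂ < r := h
      have hr : 2 * M < r := by linarith
      refine ⟨hr, (allowed_schwarzschild_iff hM hr).2 ?_⟩
      rw [hp]
      exact mul_pos (mul_pos (by linarith) (by linarith)) (by linarith)

end

end PhotonSurface

/-! ### The main theorem -/

open PhotonSurface in
theorem mainTheorem7 :
    -- The general metric, on a region given by an open interval `J` of radii.
    (∀ (Φ : ℝ → ℝ) (J : Set ℝ), IsOpen J → J.OrdConnected → J ⊆ Ioi 0 → ContDiffOn ℝ ∞ Φ J →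
      -- The ansatz.
      (∀ A X : ℝ → ℝ, ContDiffOn ℝ 1 A J → ContDiffOn ℝ 1 X J →
        -- Lie bracket
        (∀ x ∈ region J, VectorField.lieBracket ℝ (ansatz A X 1) (ansatz A X (-1)) x
          = (A (x 1) * X (x 1) / x 1) • (ansatz A X 1 x - ansatz A X (-1) x)) ∧
        -- lightlike
        (∀ x ∈ region J, ∀ ε : ℝ, ε = 1 ∨ ε = -1 →
          (IsLightlike (sphericalMetric Φ) x (ansatz A X ε x) ↔
            A (x 1) ≠ 0 ∧ X (x 1) ^ 2
              = Real.exp (2 * Φ (x 1)) * (Real.exp (2 * Φ (x 1)) - (A (x 1) ^ 2)⁻¹))) ∧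
        -- lightlike and geodesic
        (AnsatzLightlikeGeodesic Φ A X J ↔
          ∃ R : ℝ, R ≠ 0 ∧ ∀ r ∈ J, A r = r / R * Real.exp (-(2 * Φ r)) ∧
            X r ^ 2 = Real.exp (2 * Φ r) * (Real.exp (2 * Φ r) - (A r ^ 2)⁻¹)) ∧
        -- the sign of `R` can be chosen
        (∀ x ∈ region J, ∀ ε : ℝ, ansatz (-A) X ε x = -ansatz A X (-ε) x) ∧
        -- the integral manifolds are timelike photon surfaces
        (AnsatzLightlikeGeodesic Φ A X J → ∀ (W : Set (ℝ × ℝ)) (F : ℝ × ℝ → (Fin 3 → ℝ)),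
          IsImmersedSurface (region J) W F →
          IsIntegralSurface (ansatz A X 1) (ansatz A X (-1)) W F →
            IsTimelikeSurface (sphericalMetric Φ) W F ∧
            IsPhotonSurface (sphericalMetric Φ) (region J) W F)) ∧
      -- For given `R > 0`: solutions `X` exist where `r² e^{-2Φ} ≥ R²`; one positive and one
      -- negative solution where the inequality is strict.
      (∀ R : ℝ, 0 < R → ∀ r ∈ J,
        (Allowed Φ R r → 0 < speed Φ R r) ∧
        (R ^ 2 ≤ r ^ 2 * Real.exp (-(2 * Φ r)) → ∀ X : ℝ,
          (X ^ 2 = Real.exp (2 * Φ r) * (Real.exp (2 * Φ r) - (coeffA Φ R r ^ 2)⁻¹) ↔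
            X = speed Φ R r ∨ X = -speed Φ R r)) ∧
        (R ^ 2 = r ^ 2 * Real.exp (-(2 * Φ r)) → speed Φ R r = 0) ∧
        (r ^ 2 * Real.exp (-(2 * Φ r)) < R ^ 2 → ¬ ∃ X : ℝ,
          X ^ 2 = Real.exp (2 * Φ r) * (Real.exp (2 * Φ r) - (coeffA Φ R r ^ 2)⁻¹))) ∧
      -- Where the inequality holds, either family foliates.
      (∀ R : ℝ, 0 < R → ∀ I : Set ℝ, IsOpen I → I.OrdConnected → I.Nonempty → I ⊆ J →
        (∀ r ∈ I, Allowed Φ R r) →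
        (∃ T, IsTimeFunction Φ R I T) ∧
        ∀ T, IsTimeFunction Φ R I T →
          (∀ σ : ℝ, σ = 1 ∨ σ = -1 →
            IsPhotonFoliation (sphericalMetric Φ) (region I)
              (ansatz (coeffA Φ R) (fun r => σ * speed Φ R r) 1)
              (ansatz (coeffA Φ R) (fun r => σ * speed Φ R r) (-1))
              (range (member I T σ)) ∧
            ∀ c, RotationInvariant (member I T σ c) ∧
              LightlikeGeneratorsSatisfy (sphericalMetric Φ) (region I) (I ×ˢ univ)
                (memberMap T σ c) (fun D μ => BijOn (fun s => μ s 1) D I)) ∧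
          -- Behaviour at a boundary point `b` of the allowed region.
          (∀ b ∈ J, b ∈ closure I → R ^ 2 = b ^ 2 * Real.exp (-(2 * Φ b)) →
            ((∃ ℓ, Tendsto T (𝓝[I] b) (𝓝 ℓ)) ∨ Tendsto (fun r => |T r|) (𝓝[I] b) atTop) ∧
            ∀ ℓ, Tendsto T (𝓝[I] b) (𝓝 ℓ) →
              (∀ c, RotationInvariant (gluedMember I T b ℓ c) ∧
                IsTimelikePhotonSet (sphericalMetric Φ) (region J) (gluedMember I T b ℓ c)
                  (fun W F =>
                    (∀ p ∈ W, F p 1 = b → ∀ v, fderiv ℝ F p v 1 = 0) ∧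
                    LightlikeGeneratorsSatisfy (sphericalMetric Φ) (region J) W F
                      (fun D μ => ∃ s₀ ∈ D, μ s₀ 1 = b ∧
                        BijOn (fun s => μ s 1) (D ∩ Iic s₀) (insert b I) ∧
                        BijOn (fun s => μ s 1) (D ∩ Ici s₀) (insert b I)))) ∧
              (∀ x ∈ region I, {c | x ∈ gluedMember I T b ℓ c}.ncard = 2)))) ∧
    -- The equatorial plane of Reissner–Nordström.
    (∀ (M Q : ℝ) (J : Set ℝ), IsOpen J → J.OrdConnected → J ⊆ Ioi 0 →
      (∀ r ∈ J, 0 < reissnerF M Q r) →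
      ContDiffOn ℝ ∞ (reissnerPhi M Q) J ∧
      (∀ x ∈ region J, sphericalMetric (reissnerPhi M Q) x
        = Matrix.diagonal ![-reissnerF M Q (x 1), (reissnerF M Q (x 1))⁻¹, (x 1) ^ 2]) ∧
      (∀ R : ℝ, ∀ r ∈ J, Allowed (reissnerPhi M Q) R r ↔ R ^ 2 < r ^ 2 / reissnerF M Q r) ∧
      (∀ A X : ℝ → ℝ, ContDiffOn ℝ 1 A J → ContDiffOn ℝ 1 X J →
        (AnsatzLightlikeGeodesic (reissnerPhi M Q) A X J ↔
          ∃ R : ℝ, R ≠ 0 ∧ ∀ r ∈ J, A r = r / (R * reissnerF M Q r) ∧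
            X r ^ 2 = reissnerF M Q r * (reissnerF M Q r - (A r ^ 2)⁻¹)))) ∧
    -- The equatorial plane of the exterior Schwarzschild spacetime.
    (∀ M : ℝ, 0 < M →
      ContDiffOn ℝ ∞ (schwarzschildPhi M) (Ioi (2 * M)) ∧
      (∀ x ∈ region (Ioi (2 * M)), sphericalMetric (schwarzschildPhi M) x
        = Matrix.diagonal ![-schwarzschildF M (x 1), (schwarzschildF M (x 1))⁻¹, (x 1) ^ 2]) ∧
      (∀ A X : ℝ → ℝ, ContDiffOn ℝ 1 A (Ioi (2 * M)) → ContDiffOn ℝ 1 X (Ioi (2 * M)) →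
        (AnsatzLightlikeGeodesic (schwarzschildPhi M) A X (Ioi (2 * M)) ↔
          ∃ R : ℝ, R ≠ 0 ∧ ∀ r ∈ Ioi (2 * M), A r = r / (R * schwarzschildF M r) ∧
            X r ^ 2 = schwarzschildF M r * (schwarzschildF M r - (A r ^ 2)⁻¹))) ∧
      -- `R < √27 M`: two foliations, generators from the horizon to infinity
      (∀ R : ℝ, 0 < R → R < Real.sqrt 27 * M →
        (∀ r ∈ Ioi (2 * M), Allowed (schwarzschildPhi M) R r) ∧
        ∀ T, IsTimeFunction (schwarzschildPhi M) R (Ioi (2 * M)) T →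
          ∀ σ : ℝ, σ = 1 ∨ σ = -1 →
            IsPhotonFoliation (sphericalMetric (schwarzschildPhi M)) (region (Ioi (2 * M)))
              (ansatz (coeffA (schwarzschildPhi M) R)
                (fun r => σ * speed (schwarzschildPhi M) R r) 1)
              (ansatz (coeffA (schwarzschildPhi M) R)
                (fun r => σ * speed (schwarzschildPhi M) R r) (-1))
              (range (member (Ioi (2 * M)) T σ)) ∧
            ∀ c, LightlikeGeneratorsSatisfy (sphericalMetric (schwarzschildPhi M))
              (region (Ioi (2 * M))) (Ioi (2 * M) ×ˢ univ) (memberMap T σ c)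
              (fun D μ => BijOn (fun s => μ s 1) D (Ioi (2 * M)))) ∧
      -- `R = √27 M`: the surface `r = 3M` belongs to both families, the others approach it
      (∀ R : ℝ, R = Real.sqrt 27 * M →
        (∀ r ∈ Ioi (2 * M), Allowed (schwarzschildPhi M) R r ↔ r ≠ 3 * M) ∧
        R ^ 2 = (3 * M) ^ 2 * Real.exp (-(2 * schwarzschildPhi M (3 * M))) ∧
        ∀ T₁ T₂, IsTimeFunction (schwarzschildPhi M) R (Ioo (2 * M) (3 * M)) T₁ →
          IsTimeFunction (schwarzschildPhi M) R (Ioi (3 * M)) T₂ →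
          Tendsto T₁ (𝓝[<] (3 * M)) atTop ∧ Tendsto T₂ (𝓝[>] (3 * M)) atBot ∧
          (∀ σ₁ σ₂ : ℝ, σ₁ = 1 ∨ σ₁ = -1 → σ₂ = 1 ∨ σ₂ = -1 →
            IsPhotonDecomposition (sphericalMetric (schwarzschildPhi M)) (region (Ioi (2 * M)))
              ({{x | x 1 = 3 * M}} ∪ range (member (Ioo (2 * M) (3 * M)) T₁ σ₁)
                ∪ range (member (Ioi (3 * M)) T₂ σ₂))) ∧
          (∀ σ : ℝ, σ = 1 ∨ σ = -1 → ∀ X : ℝ → ℝ,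
            (∀ r ∈ Ioo (2 * M) (3 * M), X r = -σ * speed (schwarzschildPhi M) R r) →
            X (3 * M) = 0 →
            (∀ r ∈ Ioi (3 * M), X r = σ * speed (schwarzschildPhi M) R r) →
            IsPhotonFoliation (sphericalMetric (schwarzschildPhi M)) (region (Ioi (2 * M)))
              (ansatz (coeffA (schwarzschildPhi M) R) X 1)
              (ansatz (coeffA (schwarzschildPhi M) R) X (-1))
              ({{x | x 1 = 3 * M}} ∪ range (member (Ioo (2 * M) (3 * M)) T₁ (-σ))
                ∪ range (member (Ioi (3 * M)) T₂ σ)))) ∧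
      -- `R > √27 M`: two allowed regions; in each of them the two families are glued together
      (∀ R : ℝ, Real.sqrt 27 * M < R →
        ∃ r₁ r₂ : ℝ, 2 * M < r₁ ∧ r₁ < 3 * M ∧ 3 * M < r₂ ∧
          {r ∈ Ioi (2 * M) | Allowed (schwarzschildPhi M) R r} = Ioo (2 * M) r₁ ∪ Ioi r₂ ∧
          ∀ (b : ℝ) (I : Set ℝ), (b = r₁ ∧ I = Ioo (2 * M) r₁) ∨ (b = r₂ ∧ I = Ioi r₂) →
            R ^ 2 = b ^ 2 * Real.exp (-(2 * schwarzschildPhi M b)) ∧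
            ∀ T, IsTimeFunction (schwarzschildPhi M) R I T →
              ∃ ℓ, Tendsto T (𝓝[I] b) (𝓝 ℓ) ∧
                (∀ c, IsTimelikePhotonSet (sphericalMetric (schwarzschildPhi M))
                  (region (Ioi (2 * M))) (gluedMember I T b ℓ c)
                  (fun W F =>
                    LightlikeGeneratorsSatisfy (sphericalMetric (schwarzschildPhi M))
                      (region (Ioi (2 * M))) W F
                      (fun D μ => ∃ s₀ ∈ D, μ s₀ 1 = b ∧
                        BijOn (fun s => μ s 1) (D ∩ Iic s₀) (insert b I) ∧
                        BijOn (fun s => μ s 1) (D ∩ Ici s₀) (insert b I)))) ∧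
                (∀ x ∈ region I, {c | x ∈ gluedMember I T b ℓ c}.ncard = 2))) := by
  refine ⟨fun Φ J hJ hJc hJ0 hΦ => ⟨fun A X hA hX => ?_, fun R hR r hr => ?_,
    fun R hR I hI hIc hne hIJ hal => ?_⟩, fun M Q J hJ hJc hJ0 hF => ?_, fun M hM => ?_⟩
  · have hΦd : DifferentiableOn ℝ Φ J := hΦ.differentiableOn (by simp)
    have hAd : DifferentiableOn ℝ A J := hA.differentiableOn (by simp)
    have hXd : DifferentiableOn ℝ X J := hX.differentiableOn (by simp)
    have hiff := ansatzLightlikeGeodesic_iff hJ hJc hJ0 hΦd hAd hXd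
    refine ⟨fun x hx => ?_, fun x hx ε hε => isLightlike_ansatz_iff (hJ0 hx).ne' hε, hiff,
      fun x _ ε => ansatz_neg A X ε x, fun h W F hF hi => ?_⟩
    · exact lieBracket_ansatz (hJ0 hx).ne' (hAd.differentiableAt (hJ.mem_nhds hx))
        (hXd.differentiableAt (hJ.mem_nhds hx))
    · obtain ⟨R, hR, hAX⟩ := hiff.1 h
      exact integralSurface_isPhotonSurface hJ hJ0 hΦ hX hR hAX hF hi
  · have r0 : r ≠ 0 := (hJ0 hr).ne'
    exact ⟨fun h => h.speed_pos, fun h X => sq_eq_coeffA_iff r0 h X, speed_eq_zero r0,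
      not_exists_sq_eq_coeffA r0⟩
  · have hI0 := hIJ.trans hJ0
    have hΦI := hΦ.mono hIJ
    have hIconn : IsConnected I := ⟨hne, hIc.isPreconnected⟩
    refine ⟨exists_isTimeFunction hI hIc hne hI0 hΦI hal, fun T hT => ⟨fun σ hσ =>
      ⟨isPhotonFoliation_member hI hIconn hI0 hΦI hR.ne' hal hT hσ, fun c =>
        ⟨rotationInvariant_member I T σ c, hT.lightlikeGenerators hI hIc hI0 hΦI hal hσ c⟩⟩,
      fun b hbJ hbI hb => ?_⟩⟩
    have hbn : b ∉ I := not_mem_of_not_allowed hal hb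
    refine ⟨tendsto_or_tendsto_abs_of_monotoneOn (hT.strictMonoOn hI hIc hal).monotoneOn hIc hbn
      hne, fun ℓ hℓ => ⟨fun c => ⟨rotationInvariant_gluedMember I T b ℓ c, ?_⟩, fun x hx => ?_⟩⟩
    · exact hT.isTimelikePhotonSet_gluedMember hJ hJ0 hΦ hR.ne' hI hIc hne hIJ hal hbJ hbI hb hℓ c
    · exact hT.ncard_gluedMember hI hIc hal hbI hbn hℓ hx
  · have hexp : ∀ r ∈ J, Real.exp (2 * reissnerPhi M Q r) = reissnerF M Q r := fun r hr =>
      exp_two_mul_reissnerPhi (hF r hr)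
    have hΦ := contDiffOn_reissnerPhi hJ0 hF
    refine ⟨hΦ, fun x hx => sphericalMetric_of_exp_eq (hexp _ hx), fun R r hr => ?_,
      fun A X hA hX => ansatzLightlikeGeodesic_iff_of_exp_eq hJ hJc hJ0 hΦ hexp hA hX⟩
    rw [Allowed, mul_exp_neg_of_exp_eq (hexp r hr)]
  · have hΦ := contDiffOn_schwarzschildPhi hM
    have hJ0 := Ioi_two_mul_subset hM
    have hexp : ∀ r ∈ Ioi (2 * M), Real.exp (2 * schwarzschildPhi M r) = schwarzschildF M r :=
      fun r hr => exp_two_mul_schwarzschildPhi hM hr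
    refine ⟨hΦ, fun x hx => sphericalMetric_of_exp_eq (hexp _ hx),
      fun A X hA hX => ansatzLightlikeGeodesic_iff_of_exp_eq isOpen_Ioi ordConnected_Ioi hJ0 hΦ
        hexp hA hX, fun R hR hRM => ?_, fun R hR => ?_, fun R hR => ?_⟩
    · have hal : ∀ r ∈ Ioi (2 * M), Allowed (schwarzschildPhi M) R r := fun r hr =>
        allowed_schwarzschild_of_lt hM hR hRM hr
      exact ⟨hal, fun T hT σ hσ =>
        ⟨isPhotonFoliation_member isOpen_Ioi isConnected_Ioi hJ0 hΦ hR.ne' hal hT hσ,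
          fun c => hT.lightlikeGenerators isOpen_Ioi ordConnected_Ioi hJ0 hΦ hal hσ c⟩⟩
    · subst hR
      refine ⟨fun r hr => allowed_schwarzschild_critical_iff hM hr, ?_, fun T₁ T₂ hT₁ hT₂ =>
        ⟨tendsto_time_critical_left hM hT₁, tendsto_time_critical_right hM hT₂,
          fun σ₁ σ₂ hσ₁ hσ₂ => isPhotonDecomposition_critical hM hT₁ hT₂ hσ₁ hσ₂,
          fun σ hσ X h1 h3 h2 => isPhotonFoliation_critical hM hT₁ hT₂ hσ h1 h3 h2⟩⟩
      rw [eq_threshold_schwarzschild_iff hM (by linarith), cubic_critical]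
      ring
    · have hR0 : R ≠ 0 := (lt_trans (by positivity) hR).ne'
      obtain ⟨r₁, r₂, h1, h13, h32, hp⟩ := exists_turning_radii hM hR
      have h12 : r₁ < r₂ := h13.trans h32
      have hset := setOf_allowed_schwarzschild hM h1 h12 hp
      refine ⟨r₁, r₂, h1, h13, h32, hset, fun b I hbI => ?_⟩
      have hal : ∀ r ∈ I, r ∈ Ioi (2 * M) ∧ Allowed (schwarzschildPhi M) R r := by
        intro r hr
        have : r ∈ Ioo (2 * M) r₁ ∪ Ioi r₂ := by
          rcases hbI with ⟨-, rfl⟩ | ⟨-, rfl⟩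
          · exact Or.inl hr
          · exact Or.inr hr
        rwa [← hset] at this
      have hb2 : 2 * M < b := by rcases hbI with ⟨rfl, -⟩ | ⟨rfl, -⟩ <;> linarith
      have hb : R ^ 2 = b ^ 2 * Real.exp (-(2 * schwarzschildPhi M b)) := by
        rw [eq_threshold_schwarzschild_iff hM hb2, hp]
        rcases hbI with ⟨rfl, -⟩ | ⟨rfl, -⟩ <;> ring
      have hIo : IsOpen I := by
        rcases hbI with ⟨-, rfl⟩ | ⟨-, rfl⟩
        · exact isOpen_Ioo
        · exact isOpen_Ioi
      have hIconn : IsConnected I := by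
        rcases hbI with ⟨-, rfl⟩ | ⟨-, rfl⟩
        · exact isConnected_Ioo h1
        · exact isConnected_Ioi
      have hcl : b ∈ closure I := by
        rcases hbI with ⟨rfl, rfl⟩ | ⟨rfl, rfl⟩
        · rw [closure_Ioo h1.ne]
          exact right_mem_Icc.2 h1.le
        · rw [closure_Ioi]
          exact self_mem_Ici
      refine ⟨hb, fun T hT => ?_⟩
      obtain ⟨ℓ, hℓ⟩ : ∃ ℓ, Tendsto T (𝓝[I] b) (𝓝 ℓ) := by
        rcases hbI with ⟨rfl, rfl⟩ | ⟨rfl, rfl⟩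
        · exact exists_tendsto_time_inner hM h1 h12 hp (fun r hr => (hal r hr).2) hT
        · exact exists_tendsto_time_outer hM h1 h12 hp (fun r hr => (hal r hr).2) hT
      have hIc : I.OrdConnected := hIconn.isPreconnected.ordConnected
      refine ⟨ℓ, hℓ, fun c => ?_, fun x hx => ?_⟩
      · exact (hT.isTimelikePhotonSet_gluedMember isOpen_Ioi hJ0 hΦ hR0 hIo hIc hIconn.nonempty
          (fun r hr => (hal r hr).1) (fun r hr => (hal r hr).2) hb2 hcl hb hℓ c).mono Subset.rfl
          fun _ _ h => h.2
      · exact hT.ncard_gluedMember hIo hIc (fun r hr => (hal r hr).2) hcl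
          (not_mem_of_not_allowed (fun r hr => (hal r hr).2) hb) hℓ hx
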